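/- Let $n\ge 1$, $s\in(0,1)$ and $a=1-2s\in(-1,1)$. Write $z=(x,y)$ for the points of $\mathbb R^{n+1}$ ($x\in\mathbb R^n$, $y\in\mathbb R$), $\mathbb R^{n+1}_+=\{y>0\}$, $L_au=\operatorname{div}(y^a\nabla u)$, and, on $\partial\mathbb R^{n+1}_+=\mathbb R^n$, $\partial_y^au=\lim_{y\to0^+}y^a\,\partial u/\partial y$. Let $(u,v)$ be a (classical) positive solution of the extended system $$L_au=L_av=0\ \text{ in }\mathbb R^{n+1}_+,\qquad \partial_y^au=uv^2,\quad \partial_y^av=vu^2\ \text{ on }\partial\mathbb R^{n+1}_+ ,$$ that is, $u,v\in C^2(\mathbb R^{n+1}_+)\cap C(\overline{\mathbb R^{n+1}_+})$, $u,v>0$ on $\overline{\mathbb R^{n+1}_+}$, the equations hold pointwise, and the limits defining $\partial_y^au,\partial_y^av$ are attained locally uniformly in $x$. For $r>0$ let $B_r^+=\{|z|<r,\ y>0\}$, $\partial^+B_r^+=\{|z|=r,\ y>0\}$, $\partial^0B_r^+=\{|x|\le r,\ y=0\}$, and $$E(r)=\frac1{r^{n-1+a}}\int_{B_r^+}y^a\big(|\nabla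 u|^2+|\nabla v|^2\big)+\frac1{r^{n-1+a}}\int_{\partial^0B_r^+}u^2v^2,\qquad H(r)=\frac1{r^{n+a}}\int_{\partial^+B_r^+}y^a(u^2+v^2).$$ Then for every $r>0$ these integrals are finite and $H(r)>0$, and the Almgren frequency $N(r)=E(r)/H(r)$ is non-decreasing in $r\in(0,\infty)$. -/

import Mathlib

open MeasureTheory Set Filter Topology

noncomputable section

namespace FracSystem

/-- The Euclidean space `ℝⁿ⁺¹`. A point `z = (x, y)` has the last coordinate `y`. -/
abbrev Space (n : ℕ) : Type := EuclideanSpace ℝ (Fin (n + 1))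

/-- The point `(x, y)` of `ℝⁿ⁺¹`, for `x ∈ ℝⁿ` and `y ∈ ℝ`. -/
def pt {n : ℕ} (x : EuclideanSpace ℝ (Fin n)) (y : ℝ) : Space n :=
  WithLp.toLp 2 (Fin.snoc (α := fun _ => ℝ) (fun i => x i) y)

/-- The last coordinate `y` of `z = (x, y)`. -/
def ht {n : ℕ} (z : Space n) : ℝ := z (Fin.last n)

/-- The open upper half-space `ℝⁿ⁺¹₊ = {(x, y) : y > 0}`. -/
def upperHalf (n : ℕ) : Set (Space n) := {z | 0 < ht z}

/-- The closed upper half-space `{(x, y) : y ≥ 0}`. -/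
def closedUpperHalf (n : ℕ) : Set (Space n) := {z | 0 ≤ ht z}

/-- The divergence of a vector field on `ℝⁿ⁺¹`, the trace of its derivative. -/
def divergence {n : ℕ} (F : Space n → Space n) (z : Space n) : ℝ :=
  LinearMap.trace ℝ (Space n) (fderiv ℝ F z).toLinearMap

/-- The degenerate elliptic operator `L_a u = div (y ^ a ∇u)`. -/
def La {n : ℕ} (a : ℝ) (u : Space n → ℝ) (z : Space n) : ℝ :=
  divergence (fun w => ht w ^ a • gradient u w) z

/-- The partial derivative `∂u/∂y`. -/
def dy {n : ℕ} (u : Space n → ℝ) (z : Space n) : ℝ := fderiv ℝ u z (pt 0 1)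

/-- The boundary condition `∂_y^a u = g` on `∂ℝⁿ⁺¹₊ = ℝⁿ`, where
`∂_y^a u = lim_{y → 0+} y ^ a ∂u/∂y`, the limit being locally uniform in `x`. -/
def HasWeightedNormalDeriv {n : ℕ} (a : ℝ) (u : Space n → ℝ)
    (g : EuclideanSpace ℝ (Fin n) → ℝ) : Prop :=
  TendstoLocallyUniformly (fun (y : ℝ) (x : EuclideanSpace ℝ (Fin n)) => y ^ a * dy u (pt x y))
    g (𝓝[>] 0)

/-- Positive (classical) solutions `(u, v)` of the extended system
`L_a u = L_a v = 0` in `ℝⁿ⁺¹₊`, `∂_y^a u = u v²`, `∂_y^a v = v u²` on `∂ℝⁿ⁺¹₊`.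
Values of `u` and `v` below `{y = 0}` play no role. -/
structure IsSolution {n : ℕ} (a : ℝ) (u v : Space n → ℝ) : Prop where
  contDiffOn_u : ContDiffOn ℝ 2 u (upperHalf n)
  contDiffOn_v : ContDiffOn ℝ 2 v (upperHalf n)
  continuousOn_u : ContinuousOn u (closedUpperHalf n)
  continuousOn_v : ContinuousOn v (closedUpperHalf n)
  pos_u : ∀ z ∈ closedUpperHalf n, 0 < u z
  pos_v : ∀ z ∈ closedUpperHalf n, 0 < v z
  eq_u : ∀ z ∈ upperHalf n, La a u z = 0
  eq_v : ∀ z ∈ upperHalf n, La a v z = 0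
  boundary_u : HasWeightedNormalDeriv a u (fun x => u (pt x 0) * v (pt x 0) ^ 2)
  boundary_v : HasWeightedNormalDeriv a v (fun x => v (pt x 0) * u (pt x 0) ^ 2)

/-- The half-ball `B_r⁺ = B_r ∩ ℝⁿ⁺¹₊`. -/
def halfBall (n : ℕ) (r : ℝ) : Set (Space n) := Metric.ball 0 r ∩ upperHalf n

/-- The half-sphere `∂⁺B_r⁺ = ∂B_r ∩ ℝⁿ⁺¹₊`. -/
def halfSphere (n : ℕ) (r : ℝ) : Set (Space n) := Metric.sphere 0 r ∩ upperHalf n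

/-- The flat part `∂⁰B_r⁺` of the boundary of the half-ball, as a subset of `ℝⁿ`. -/
def flatPart (n : ℕ) (r : ℝ) : Set (EuclideanSpace ℝ (Fin n)) := Metric.closedBall 0 r

/-- The surface measure (`n`-dimensional area) of the sphere `∂B_r ⊆ ℝⁿ⁺¹`, as a measure on
`ℝⁿ⁺¹`: the image under `ω ↦ r ω` of the surface measure of the unit sphere, times `r ^ n`. -/
def surfaceMeasure (n : ℕ) (r : ℝ) : Measure (Space n) :=
  ENNReal.ofReal (r ^ n) •
    ((volume : Measure (Space n)).toSphere).map
      (fun ω : Metric.sphere (0 : Space n) 1 => r • (ω : Space n))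

/-- The density `y ^ a (|∇u|² + |∇v|²)` of the weighted Dirichlet energy. -/
def dirichletDensity {n : ℕ} (a : ℝ) (u v : Space n → ℝ) (z : Space n) : ℝ :=
  ht z ^ a * (‖gradient u z‖ ^ 2 + ‖gradient v z‖ ^ 2)

/-- The density `y ^ a (u² + v²)`. -/
def massDensity {n : ℕ} (a : ℝ) (u v : Space n → ℝ) (z : Space n) : ℝ :=
  ht z ^ a * (u z ^ 2 + v z ^ 2)

/-- `E(r) = r^{-(n-1+a)} ∫_{B_r⁺} y ^ a (|∇u|² + |∇v|²) + r^{-(n-1+a)} ∫_{∂⁰B_r⁺} u² v²`. -/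
def energy {n : ℕ} (a : ℝ) (u v : Space n → ℝ) (r : ℝ) : ℝ :=
  1 / r ^ ((n : ℝ) - 1 + a) * (∫ z in halfBall n r, dirichletDensity a u v z) +
  1 / r ^ ((n : ℝ) - 1 + a) * (∫ x in flatPart n r, u (pt x 0) ^ 2 * v (pt x 0) ^ 2)

/-- `H(r) = r^{-(n+a)} ∫_{∂⁺B_r⁺} y ^ a (u² + v²)`. -/
def height {n : ℕ} (a : ℝ) (u v : Space n → ℝ) (r : ℝ) : ℝ :=
  1 / r ^ ((n : ℝ) + a) * ∫ z in halfSphere n r, massDensity a u v z ∂(surfaceMeasure n r)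

/-- The Almgren frequency `N(r) = E(r) / H(r)`. -/
def frequency {n : ℕ} (a : ℝ) (u v : Space n → ℝ) (r : ℝ) : ℝ :=
  energy a u v r / height a u v r

end FracSystem

end

/-! Put `t = log r` and regard the solution as a curve `W(t) = (u, v)(e^t ·)` in the space `L²(y^a
dS)` of the unit half-sphere. Then `H = ‖W‖²`. Green's formula gives `H' = 2F`, where `F = ⟨W, W'⟩`
equals `e^{-(n-1+a)t}` times the Dirichlet energy plus twice the potential energy. The potential
counts twice because `u · uv² + v · vu² = 2u²v²`. Hence the energy is `E = F - J`, with `J ≥ 0` the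
normalized potential. Formally `E' = 2‖W'‖² + (1 - a) J`, and Cauchy–Schwarz gives `‖W'‖² ≥ F² / H`.
So `E' ≥ 2F²/H ≥ (E/H) · 2F = (E/H) H'`, because `E ≤ F` and `F ≥ 0`, and this is the monotonicity
of `E/H`.

The formula for `E'` is a Pohozaev identity, and deriving it directly would need control of second
derivatives up to `{y = 0}`. Here it is replaced by an inequality between finite differences in `t`,
that is, between the solution and its dilates `f(e^r ·)`. A dilate again solves a Neumann problem
(`IsNeumann.dilate`), so Green's identity expresses the Wronskian `⟨W(t), W'(t+r)⟩ - ⟨W'(t),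
W(t+r)⟩` by boundary values alone (`IsNeumann.wronskian_eq`). The algebra of the coupling
(`coupling_ge`) bounds it below by `J(t+r) - J(t)`, up to a quadratic expression in the boundary
increments of `u` and `v`. That error is `O(r²)` (`IsSolution.exists_boundary_difference`): the
increments solve Neumann problems whose data are controlled by the increments themselves, and
Caccioppoli together with a trace inequality with small constant closes the estimate.

Integrating the Wronskian in `r ∈ [0, k]` turns it into second differences of the correlation
`c(s,t) = ⟨W(s), W(t)⟩` (`IsL2Curve.integral_corr_shift`). This bounds `∫ ‖W(τ+k) - W(τ)‖² dτ` from
above. Cauchy–Schwarz bounds the same integrand below by `(c(τ,τ+k) - H(τ))² / H(τ)`. Dividing by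
`k²` and letting `k → 0` gives the integrated form of `E' ≥ 2F²/H` (`IsCorrelation.flux_growth`),
and `monotone_div_of_growth` concludes without differentiating `E`.

The analytic input is the weak formulation. It comes from cutting off in the height `y`, where the
locally uniform limit of `y^a ∂_y f` produces the boundary term. Tested against radial functions, it
gives the flux formula through almost every half-sphere (`IsNeumann.flux`). -/

noncomputable section

namespace FracSystem

/-! ### Coordinates on the half-space and the weighted measure `y^a dz`. -/

section

variable {n : ℕ} {a : ℝ}

/-- The last coordinate, as a continuous linear functional. -/
def htL (n : ℕ) : Space n →L[ℝ] ℝ := EuclideanSpace.proj (Fin.last n)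

lemma continuous_ht : Continuous (ht : Space n → ℝ) := (htL n).continuous

@[simp] lemma htL_apply (z : Space n) : htL n z = ht z := rfl

@[simp] lemma ht_smul (c : ℝ) (z : Space n) : ht (c • z) = c * ht z := by simp [ht]

@[simp] lemma ht_pt (x : EuclideanSpace ℝ (Fin n)) (y : ℝ) : ht (pt x y) = y := by simp [ht, pt]

lemma isOpen_upperHalf : IsOpen (upperHalf n) := isOpen_lt continuous_const continuous_ht

lemma isClosed_closedUpperHalf : IsClosed (closedUpperHalf n) :=
  isClosed_le continuous_const continuous_ht

lemma measurableSet_upperHalf : MeasurableSet (upperHalf n) := isOpen_upperHalf.measurableSet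

lemma upperHalf_subset_closedUpperHalf : upperHalf n ⊆ closedUpperHalf n := fun z hz => show 0 ≤ ht z from le_of_lt hz

lemma pt_mem_upperHalf {x : EuclideanSpace ℝ (Fin n)} {y : ℝ} (hy : 0 < y) :
    pt x y ∈ upperHalf n := by simpa [upperHalf] using hy

lemma pt_mem_closedUpperHalf {x : EuclideanSpace ℝ (Fin n)} {y : ℝ} (hy : 0 ≤ y) :
    pt x y ∈ closedUpperHalf n := by simpa [closedUpperHalf] using hy

lemma smul_mem_upperHalf {c : ℝ} (hc : 0 < c) {z : Space n} (hz : z ∈ upperHalf n) :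
    c • z ∈ upperHalf n := by
  simpa [upperHalf] using mul_pos hc hz

lemma smul_mem_closedUpperHalf {c : ℝ} (hc : 0 ≤ c) {z : Space n} (hz : z ∈ closedUpperHalf n) :
    c • z ∈ closedUpperHalf n := by
  simpa [closedUpperHalf] using mul_nonneg hc hz

@[simp] lemma pt_castSucc (x : EuclideanSpace ℝ (Fin n)) (y : ℝ) (i : Fin n) :
    pt x y i.castSucc = x i := by simp [pt]

@[simp] lemma pt_last (x : EuclideanSpace ℝ (Fin n)) (y : ℝ) :
    pt x y (Fin.last n) = y := by simp [pt]

lemma smul_pt (c : ℝ) (x : EuclideanSpace ℝ (Fin n)) (y : ℝ) :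
    c • pt x y = pt (c • x) (c * y) := by
  ext i
  refine Fin.lastCases ?_ (fun i => ?_) i <;> simp

lemma pt_eq_add (x : EuclideanSpace ℝ (Fin n)) (y : ℝ) : pt x y = pt x 0 + y • pt 0 1 := by
  ext i
  refine Fin.lastCases ?_ (fun i => ?_) i <;> simp

lemma norm_pt_sq (x : EuclideanSpace ℝ (Fin n)) (y : ℝ) : ‖pt x y‖ ^ 2 = ‖x‖ ^ 2 + y ^ 2 := by
  simp [EuclideanSpace.norm_sq_eq, Fin.sum_univ_castSucc]

@[simp] lemma norm_pt_zero_right (x : EuclideanSpace ℝ (Fin n)) : ‖pt x 0‖ = ‖x‖ := by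
  have := norm_pt_sq x 0
  rw [← abs_of_nonneg (norm_nonneg (pt x 0)), ← abs_of_nonneg (norm_nonneg x), ← sq_eq_sq_iff_abs_eq_abs]
  simpa using this

lemma norm_le_norm_pt (x : EuclideanSpace ℝ (Fin n)) (y : ℝ) : ‖x‖ ≤ ‖pt x y‖ := by
  have := norm_pt_sq x y
  exact le_of_sq_le_sq (by nlinarith [sq_nonneg y]) (norm_nonneg _)

lemma abs_le_norm_pt (x : EuclideanSpace ℝ (Fin n)) (y : ℝ) : |y| ≤ ‖pt x y‖ := by
  have := norm_pt_sq x y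
  exact le_of_sq_le_sq (by rw [sq_abs]; nlinarith [sq_nonneg ‖x‖]) (norm_nonneg _)

lemma continuous_pt : Continuous fun p : EuclideanSpace ℝ (Fin n) × ℝ => pt p.1 p.2 := by
  unfold pt
  refine (PiLp.continuous_toLp 2 _).comp (continuous_pi fun i => ?_)
  refine Fin.lastCases ?_ (fun i => ?_) i <;> simp <;> fun_prop

lemma pt_injective : Function.Injective
    fun p : EuclideanSpace ℝ (Fin n) × ℝ => (pt p.1 p.2 : Space n) := by
  rintro ⟨x, y⟩ ⟨x', y'⟩ h
  have h' : ∀ i, pt x y i = pt x' y' i := fun i => congrArg (fun z : Space n => z i) h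
  refine Prod.ext (PiLp.ext fun i => ?_) ?_
  · simpa using h' i.castSucc
  · simpa using h' (Fin.last n)

lemma measurableEmbedding_pt : MeasurableEmbedding
    fun p : EuclideanSpace ℝ (Fin n) × ℝ => (pt p.1 p.2 : Space n) :=
  continuous_pt.measurableEmbedding pt_injective

lemma measurePreserving_pt : MeasurePreserving
    (fun p : EuclideanSpace ℝ (Fin n) × ℝ => (pt p.1 p.2 : Space n)) := by
  have h1 := (volume_preserving_piFinSuccAbove (fun _ : Fin (n + 1) => ℝ) (Fin.last n)).symm
  have h2 : MeasurePreserving (fun p : EuclideanSpace ℝ (Fin n) × ℝ =>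
      ((p.2, WithLp.ofLp p.1) : ℝ × (Fin n → ℝ))) :=
    (Measure.measurePreserving_swap).comp
      ((PiLp.volume_preserving_ofLp (Fin n)).prod (MeasurePreserving.id volume))
  have h3 := (PiLp.volume_preserving_toLp (Fin (n + 1))).comp (h1.comp h2)
  convert h3 using 1
  funext p
  ext i
  refine Fin.lastCases ?_ (fun i => ?_) i
  · simp [pt]
  · simp only [pt_castSucc, Function.comp]
    simp [MeasurableEquiv.piFinSuccAbove_symm_apply, Fin.insertNthEquiv]

/-- The weighted measure `y ^ a dz` on the upper half-space. -/
def wt (n : ℕ) (a : ℝ) : Measure (Space n) :=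
  (volume.restrict (upperHalf n)).withDensity fun z => ENNReal.ofReal (ht z ^ a)

/-- The weighted measure `y ^ a dy` on `(0, ∞)`. -/
def wt1 (a : ℝ) : Measure ℝ :=
  (volume.restrict (Ioi 0)).withDensity fun y => ENNReal.ofReal (y ^ a)

lemma measurable_weight (a : ℝ) : Measurable fun z : Space n => ENNReal.ofReal (ht z ^ a) :=
  (continuous_ht.measurable.pow_const a).ennreal_ofReal

lemma measurable_weight1 (a : ℝ) : Measurable fun y : ℝ => ENNReal.ofReal (y ^ a) :=
  (measurable_id.pow_const a).ennreal_ofReal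

instance : SFinite (wt n a) := by unfold wt; infer_instance

instance : SFinite (wt1 a) := by unfold wt1; infer_instance

lemma lintegral_wt {f : Space n → ENNReal} :
    ∫⁻ z, f z ∂(wt n a) = ∫⁻ z in upperHalf n, ENNReal.ofReal (ht z ^ a) * f z := by
  unfold wt
  rw [lintegral_withDensity_eq_lintegral_mul_non_measurable _ (measurable_weight a)]
  · rfl
  · simp

lemma lintegral_wt1 {f : ℝ → ENNReal} :
    ∫⁻ y, f y ∂(wt1 a) = ∫⁻ y in Ioi 0, ENNReal.ofReal (y ^ a) * f y := by
  unfold wt1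
  rw [lintegral_withDensity_eq_lintegral_mul_non_measurable _ (measurable_weight1 a)]
  · rfl
  · simp

lemma integral_wt {f : Space n → ℝ} :
    ∫ z, f z ∂(wt n a) = ∫ z in upperHalf n, ht z ^ a * f z := by
  unfold wt
  rw [integral_withDensity_eq_integral_toReal_smul (measurable_weight a) (by simp)]
  refine setIntegral_congr_fun measurableSet_upperHalf fun z hz => ?_
  simp [ENNReal.toReal_ofReal (Real.rpow_nonneg (le_of_lt hz) a)]

lemma integrable_wt_iff {f : Space n → ℝ} :
    Integrable f (wt n a) ↔ IntegrableOn (fun z => ht z ^ a * f z) (upperHalf n) := by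
  unfold wt
  rw [integrable_withDensity_iff_integrable_smul' (measurable_weight a) (by simp), IntegrableOn]
  refine integrable_congr ?_
  filter_upwards [ae_restrict_mem measurableSet_upperHalf] with z hz
  simp [ENNReal.toReal_ofReal (Real.rpow_nonneg (le_of_lt hz) a)]

lemma wt_restrict {s : Set (Space n)} (hs : MeasurableSet s) :
    (wt n a).restrict s =
      (volume.restrict (s ∩ upperHalf n)).withDensity fun z => ENNReal.ofReal (ht z ^ a) := by
  unfold wt
  rw [restrict_withDensity hs, Measure.restrict_restrict hs]

lemma setIntegral_wt {f : Space n → ℝ} {s : Set (Space n)} (hs : MeasurableSet s) :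
    ∫ z in s, f z ∂(wt n a) = ∫ z in s ∩ upperHalf n, ht z ^ a * f z := by
  rw [wt_restrict hs, integral_withDensity_eq_integral_toReal_smul (measurable_weight a) (by simp)]
  refine setIntegral_congr_fun (hs.inter measurableSet_upperHalf) fun z hz => ?_
  simp [ENNReal.toReal_ofReal (Real.rpow_nonneg (le_of_lt hz.2) a)]

lemma integrableOn_wt_iff {f : Space n → ℝ} {s : Set (Space n)} (hs : MeasurableSet s) :
    IntegrableOn f s (wt n a) ↔ IntegrableOn (fun z => ht z ^ a * f z) (s ∩ upperHalf n) := by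
  rw [IntegrableOn, wt_restrict hs,
    integrable_withDensity_iff_integrable_smul' (measurable_weight a) (by simp), IntegrableOn]
  refine integrable_congr ?_
  filter_upwards [ae_restrict_mem (hs.inter measurableSet_upperHalf)] with z hz
  simp [ENNReal.toReal_ofReal (Real.rpow_nonneg (le_of_lt hz.2) a)]

lemma ae_mem_upperHalf : ∀ᵐ z ∂(wt n a), z ∈ upperHalf n :=
  (withDensity_absolutelyContinuous _ _).ae_le (ae_restrict_mem measurableSet_upperHalf)

lemma ae_wt1_pos : ∀ᵐ y ∂(wt1 a), 0 < y :=
  (withDensity_absolutelyContinuous _ _).ae_le (ae_restrict_mem measurableSet_Ioi)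

lemma aestronglyMeasurable_wt {E : Type*} [NormedAddCommGroup E] [SecondCountableTopology E]
    {f : Space n → E} (hf : ContinuousOn f (upperHalf n)) :
    AEStronglyMeasurable f (wt n a) :=
  (hf.aestronglyMeasurable measurableSet_upperHalf).mono_ac (withDensity_absolutelyContinuous _ _)

/-- The weight depends on `y` only, so the weighted measure is the product of `dx` and `y^a dy`.
Fubini in this form serves both the boundary limit and the trace inequality. -/
lemma measurePreserving_pt_wt : MeasurePreserving
    (fun p : EuclideanSpace ℝ (Fin n) × ℝ => (pt p.1 p.2 : Space n))
    (volume.prod (wt1 a)) (wt n a) := by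
  refine ⟨continuous_pt.measurable, Measure.ext_of_lintegral _ fun f hf => ?_⟩
  rw [measurableEmbedding_pt.lintegral_map, lintegral_wt,
    ← lintegral_indicator measurableSet_upperHalf,
    ← measurePreserving_pt.lintegral_comp_emb measurableEmbedding_pt, Measure.volume_eq_prod,
    lintegral_prod (fun p => f (pt p.1 p.2)) (hf.comp continuous_pt.measurable).aemeasurable, lintegral_prod]
  · refine lintegral_congr fun x => ?_
    rw [lintegral_wt1, ← lintegral_indicator measurableSet_Ioi]
    refine lintegral_congr fun y => ?_
    by_cases hy : 0 < y
    · rw [indicator_of_mem (by simpa using hy), indicator_of_mem (pt_mem_upperHalf hy)]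
      simp
    · rw [indicator_of_notMem (by simpa using hy), indicator_of_notMem (by simpa [upperHalf] using hy)]
  · exact ((((measurable_weight a).mul hf).indicator measurableSet_upperHalf).comp
      continuous_pt.measurable).aemeasurable

lemma integrableOn_rpow_Ioc (ha : -1 < a) (R : ℝ) : IntegrableOn (fun y : ℝ => y ^ a) (Ioc 0 R) := by
  rcases le_total 0 R with h | h
  · exact (intervalIntegrable_iff_integrableOn_Ioc_of_le h).1 (intervalIntegral.intervalIntegrable_rpow' ha)
  · simp [Ioc_eq_empty_of_le h]

lemma wt1_Iic_lt_top (ha : -1 < a) (R : ℝ) : wt1 a (Iic R) < ⊤ := by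
  unfold wt1
  rw [withDensity_apply _ measurableSet_Iic, Measure.restrict_restrict measurableSet_Iic, inter_comm,
    Ioi_inter_Iic]
  refine lt_of_le_of_lt ?_ (integrableOn_rpow_Ioc ha R).hasFiniteIntegral
  refine lintegral_mono fun y => ?_
  rw [← ofReal_norm]
  exact ENNReal.ofReal_le_ofReal (le_abs_self _)

/-- A ball lies in a cylinder, and `y^a` is integrable at `0` because `a > -1`. -/
lemma wt_closedBall_lt_top (ha : -1 < a) (R : ℝ) : wt n a (Metric.closedBall 0 R) < ⊤ := by
  rw [← (measurePreserving_pt_wt).measure_preimage Metric.isClosed_closedBall.nullMeasurableSet]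
  refine lt_of_le_of_lt (measure_mono (t := Metric.closedBall 0 R ×ˢ Iic R) ?_) ?_
  · rintro ⟨x, y⟩ h
    simp only [mem_preimage, mem_closedBall_zero_iff] at h
    exact ⟨by simpa using (norm_le_norm_pt x y).trans h,
      (le_abs_self y).trans ((abs_le_norm_pt x y).trans h)⟩
  · rw [Measure.prod_prod]
    exact ENNReal.mul_lt_top measure_closedBall_lt_top (wt1_Iic_lt_top ha R)

lemma isLocallyFiniteMeasure_wt (ha : -1 < a) : IsLocallyFiniteMeasure (wt n a) where
  finiteAtNhds z := by
    refine ⟨Metric.ball 0 (‖z‖ + 1), Metric.isOpen_ball.mem_nhds (by simp), ?_⟩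
    exact (measure_mono Metric.ball_subset_closedBall).trans_lt (wt_closedBall_lt_top ha _)

end

/-! ### Logarithmic polar coordinates and the weighted measure on the half-sphere. -/

section

variable {n : ℕ} {a : ℝ}

/-- The open upper half of the unit sphere. -/
abbrev HS (n : ℕ) : Type := {ω : Metric.sphere (0 : Space n) 1 | 0 < ht (ω : Space n)}

/-- The inclusion of the upper half-sphere into the ambient space. -/
def hsv (ω : HS n) : Space n := ((ω : Metric.sphere (0 : Space n) 1) : Space n)

lemma isOpen_HS : IsOpen {ω : Metric.sphere (0 : Space n) 1 | 0 < ht (ω : Space n)} :=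
  isOpen_lt continuous_const (continuous_ht.comp continuous_subtype_val)

instance : PolishSpace (HS n) := isOpen_HS.polishSpace

lemma continuous_hsv : Continuous (hsv : HS n → Space n) :=
  continuous_subtype_val.comp continuous_subtype_val

lemma norm_hsv (ω : HS n) : ‖hsv ω‖ = 1 := by
  have := ω.1.2
  rwa [mem_sphere_zero_iff_norm] at this

lemma hsv_mem (ω : HS n) : hsv ω ∈ upperHalf n := ω.2

/-- Logarithmic polar coordinates `(t, ω) ↦ e ^ t ω`. -/
def pol (p : ℝ × HS n) : Space n := Real.exp p.1 • hsv p.2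

lemma continuous_pol : Continuous (pol : ℝ × HS n → Space n) :=
  (Real.continuous_exp.comp continuous_fst).smul (continuous_hsv.comp continuous_snd)

lemma norm_pol (p : ℝ × HS n) : ‖pol p‖ = Real.exp p.1 := by
  simp [pol, norm_smul, norm_hsv, abs_of_pos (Real.exp_pos _)]

lemma pol_mem (p : ℝ × HS n) : pol p ∈ upperHalf n := smul_mem_upperHalf (Real.exp_pos _) (hsv_mem _)

lemma pol_injective : Function.Injective (pol : ℝ × HS n → Space n) := by
  rintro ⟨t, ω⟩ ⟨t', ω'⟩ h
  have ht : t = t' := by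
    have := congrArg norm h
    rw [norm_pol, norm_pol] at this
    exact Real.exp_injective this
  subst ht
  refine Prod.ext rfl (Subtype.ext (Subtype.ext ?_))
  exact smul_right_injective _ (Real.exp_pos t).ne' h

lemma measurableEmbedding_pol : MeasurableEmbedding (pol : ℝ × HS n → Space n) :=
  continuous_pol.measurableEmbedding pol_injective

/-- The measure `y ^ a dS` on the upper half-sphere. -/
def sphereWt (n : ℕ) (a : ℝ) : Measure (HS n) :=
  (((volume : Measure (Space n)).toSphere).comap Subtype.val).withDensity
    fun ω => ENNReal.ofReal (ht (hsv ω) ^ a)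

lemma measurable_sphere_weight (a : ℝ) :
    Measurable fun ω : HS n => ENNReal.ofReal (ht (hsv ω) ^ a) :=
  ((continuous_ht.comp continuous_hsv).measurable.pow_const a).ennreal_ofReal

lemma isFiniteMeasure_comap_toSphere :
    IsFiniteMeasure ((((volume : Measure (Space n)).toSphere).comap Subtype.val : Measure (HS n))) := by
  refine ⟨?_⟩
  rw [Measure.comap_apply _ Subtype.val_injective
    (fun s hs => (MeasurableEmbedding.subtype_coe isOpen_HS.measurableSet).measurableSet_image.2 hs)
    _ MeasurableSet.univ]
  exact measure_lt_top _ _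

instance : SFinite (sphereWt n a) := by
  have := isFiniteMeasure_comap_toSphere (n := n)
  unfold sphereWt; infer_instance

lemma lintegral_sphereWt (f : Space n → ENNReal) :
    ∫⁻ ω, f (hsv ω) ∂(sphereWt n a) =
      ∫⁻ ω : Metric.sphere (0 : Space n) 1,
        (upperHalf n).indicator (fun z => ENNReal.ofReal (ht z ^ a) * f z) ω
        ∂(volume : Measure (Space n)).toSphere := by
  unfold sphereWt
  rw [lintegral_withDensity_eq_lintegral_mul_non_measurable _ (measurable_sphere_weight a) (by simp)]
  have := lintegral_subtype_comap (μ := (volume : Measure (Space n)).toSphere)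
    (isOpen_HS (n := n)).measurableSet (fun ω => ENNReal.ofReal (ht (ω : Space n) ^ a) * f ω)
  refine this.trans ?_
  rw [← lintegral_indicator isOpen_HS.measurableSet]
  rfl

/-- The measure `e ^ {ct} dt` on the real line. -/
def expWt (c : ℝ) : Measure ℝ := volume.withDensity fun t => ENNReal.ofReal (Real.exp (c * t))

instance (c : ℝ) : SFinite (expWt c) := by unfold expWt; infer_instance

lemma measurable_expWeight (c : ℝ) : Measurable fun t : ℝ => ENNReal.ofReal (Real.exp (c * t)) :=
  (by fun_prop : Continuous fun t : ℝ => Real.exp (c * t)).measurable.ennreal_ofReal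

lemma lintegral_Ioi_zero_eq_exp (g : ℝ → ENNReal) :
    ∫⁻ r in Ioi (0 : ℝ), g r = ∫⁻ t, ENNReal.ofReal (Real.exp t) * g (Real.exp t) := by
  have := lintegral_image_eq_lintegral_abs_deriv_mul MeasurableSet.univ
    (fun x _ => (Real.hasDerivAt_exp x).hasDerivWithinAt) Real.exp_injective.injOn g
  rw [image_univ, Real.range_exp, setLIntegral_univ] at this
  simpa [abs_of_pos (Real.exp_pos _)] using this

/-- Polar coordinates have density `r^n dr`; the substitution `r = e^t` supplies one more factor
`e^t`. -/
lemma lintegral_eq_toSphere {g : Space n → ENNReal} (hg : Measurable g) :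
    ∫⁻ z, g z = ∫⁻ t : ℝ, ∫⁻ ω : Metric.sphere (0 : Space n) 1,
      ENNReal.ofReal (Real.exp ((n + 1) * t)) * g (Real.exp t • (ω : Space n))
        ∂(volume : Measure (Space n)).toSphere := by
  have hd : Module.finrank ℝ (Space n) - 1 = n := by simp
  have h1 := (volume : Measure (Space n)).measurePreserving_homeomorphUnitSphereProd
  rw [hd] at h1
  have h0 : ∫⁻ z, g z = ∫⁻ z in {0}ᶜ, g z := by rw [restrict_compl_singleton]
  rw [h0, ← lintegral_subtype_comap (measurableSet_singleton _).compl,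
    ← (h1.symm (Homeomorph.toMeasurableEquiv (homeomorphUnitSphereProd (Space n)))).lintegral_comp_emb
      (MeasurableEquiv.measurableEmbedding _)]
  have hG : Measurable fun p : Metric.sphere (0 : Space n) 1 × Ioi (0 : ℝ) =>
      g ((p.2 : ℝ) • (p.1 : Space n)) :=
    hg.comp (by fun_prop : Continuous fun p : Metric.sphere (0 : Space n) 1 × Ioi (0 : ℝ) =>
      ((p.2 : ℝ) • (p.1 : Space n))).measurable
  change ∫⁻ p : Metric.sphere (0 : Space n) 1 × Ioi (0 : ℝ),
    g ((homeomorphUnitSphereProd (Space n)).symm p : Space n) ∂_ = _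
  simp only [homeomorphUnitSphereProd_symm_apply_coe]
  rw [lintegral_prod_symm _ hG.aemeasurable, Measure.volumeIoiPow,
    lintegral_withDensity_eq_lintegral_mul_non_measurable _
      ((measurable_subtype_coe.pow_const _).ennreal_ofReal) (by simp)]
  have := lintegral_subtype_comap (μ := (volume : Measure ℝ))
    (measurableSet_Ioi (a := (0 : ℝ)))
    (fun r => ENNReal.ofReal (r ^ n) * ∫⁻ ω : Metric.sphere (0 : Space n) 1, g (r • (ω : Space n))
      ∂(volume : Measure (Space n)).toSphere)
  refine this.trans ?_
  rw [lintegral_Ioi_zero_eq_exp]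
  refine lintegral_congr fun t => ?_
  rw [← mul_assoc, ← ENNReal.ofReal_mul (Real.exp_pos _).le, lintegral_const_mul]
  · congr 2
    rw [← Real.exp_nat_mul, ← Real.exp_add]
    ring_nf
  · exact hg.comp (by fun_prop : Continuous fun ω : Metric.sphere (0 : Space n) 1 =>
      Real.exp t • (ω : Space n)).measurable

/-- Homogeneity of degree `a` of the weight adds `a` to the exponent `n + 1` of the polar Jacobian,
and leaves the weight on the unit sphere. -/
lemma measurePreserving_pol :
    MeasurePreserving (pol : ℝ × HS n → Space n) ((expWt (n + 1 + a)).prod (sphereWt n a)) (wt n a) := by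
  refine ⟨continuous_pol.measurable, Measure.ext_of_lintegral _ fun f hf => ?_⟩
  rw [measurableEmbedding_pol.lintegral_map, lintegral_wt,
    ← lintegral_indicator measurableSet_upperHalf,
    lintegral_eq_toSphere (g := (upperHalf n).indicator fun z => ENNReal.ofReal (ht z ^ a) * f z)
      (((measurable_weight a).mul hf).indicator measurableSet_upperHalf),
    lintegral_prod (fun p => f (pol p)) (hf.comp continuous_pol.measurable).aemeasurable]
  unfold expWt
  rw [lintegral_withDensity_eq_lintegral_mul_non_measurable _ (measurable_expWeight _) (by simp)]
  refine lintegral_congr fun t => ?_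
  have h1 := lintegral_sphereWt (a := a) fun z : Space n => f (Real.exp t • z)
  change _ * ∫⁻ ω, f (Real.exp t • hsv ω) ∂(sphereWt n a) = _
  rw [h1, ← lintegral_const_mul]
  · refine lintegral_congr fun ω => ?_
    by_cases hω : (ω : Space n) ∈ upperHalf n
    · rw [indicator_of_mem hω, indicator_of_mem (smul_mem_upperHalf (Real.exp_pos t) hω)]
      beta_reduce
      rw [← mul_assoc, ← mul_assoc, ← ENNReal.ofReal_mul (Real.exp_pos _).le,
        ← ENNReal.ofReal_mul (Real.exp_pos _).le, ht_smul,
        Real.mul_rpow (Real.exp_pos _).le (le_of_lt hω), ← Real.exp_mul, ← mul_assoc, ← Real.exp_add]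
      ring_nf
    · have : Real.exp t • (ω : Space n) ∉ upperHalf n := by
        simpa [upperHalf, mul_pos_iff_of_pos_left (Real.exp_pos t)] using hω
      rw [indicator_of_notMem hω, indicator_of_notMem this, mul_zero, mul_zero]
  · exact (((measurable_weight a).mul (hf.comp (measurable_const_smul _))).indicator
      measurableSet_upperHalf).comp measurable_subtype_coe

/-- The weighted unit half-ball has finite mass and is the product of `(-∞, 0]` with the
half-sphere, up to the origin. As the first factor has positive mass, the second cannot be infinite.
-/
lemma isFiniteMeasure_sphereWt (ha : -1 < a) : IsFiniteMeasure (sphereWt n a) := by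
  refine ⟨lt_of_le_of_ne le_top fun h => ?_⟩
  have h1 := wt_closedBall_lt_top (n := n) ha 1
  rw [← (measurePreserving_pol).measure_preimage Metric.isClosed_closedBall.nullMeasurableSet] at h1
  have h2 : (Iic 0 ×ˢ univ : Set (ℝ × HS n)) ⊆ pol ⁻¹' Metric.closedBall 0 1 := by
    rintro p ⟨hp, -⟩
    simpa [norm_pol] using hp
  have h3 := (measure_mono h2).trans_lt h1
  rw [Measure.prod_prod, h, ENNReal.mul_top] at h3
  · exact lt_irrefl _ h3
  · rw [expWt, withDensity_apply _ measurableSet_Iic]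
    intro h0
    rw [setLIntegral_eq_zero_iff measurableSet_Iic (measurable_expWeight _)] at h0
    have : (volume : Measure ℝ) (Iic 0) = 0 := by
      refine measure_mono_null (fun x hx => ?_) (ae_iff.1 h0)
      simpa using ⟨by simpa using hx, Real.exp_pos _⟩
    simp at this

lemma sphereWt_ne_zero : sphereWt n a ≠ 0 := by
  intro h
  have h1 := lintegral_sphereWt (a := a) fun _ : Space n => 1
  rw [h, lintegral_zero_measure, eq_comm, lintegral_eq_zero_iff] at h1
  · have h2 : ((volume : Measure (Space n)).toSphere)
        {ω : Metric.sphere (0 : Space n) 1 | 0 < ht (ω : Space n)} = 0 := by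
      refine measure_mono_null (fun ω hω => ?_) (ae_iff.1 h1)
      have hω' : (ω : Space n) ∈ upperHalf n := hω
      simpa [indicator_of_mem hω'] using ⟨hω', Real.rpow_pos_of_pos hω a⟩
    refine (isOpen_HS.measure_pos _ ?_).ne' h2
    exact ⟨⟨pt 0 1, by
      rw [mem_sphere_zero_iff_norm, ← sq_eq_sq₀ (norm_nonneg _) zero_le_one, norm_pt_sq]; simp⟩,
      by simp⟩
  · exact (((measurable_weight a).mul measurable_const).indicator
      measurableSet_upperHalf).comp measurable_subtype_coe

end

/-! ### The equation `L_a f = 0` tested against functions supported inside the half-space. -/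

section

variable {n : ℕ} {a : ℝ}

lemma inner_gradient (f : Space n → ℝ) (z w : Space n) :
    inner ℝ (gradient f z) w = fderiv ℝ f z w := by
  simp [gradient]

lemma norm_gradient (f : Space n → ℝ) (z : Space n) : ‖gradient f z‖ = ‖fderiv ℝ f z‖ := by
  simp [gradient]

lemma fderiv_gradient_self (f : Space n → ℝ) (z : Space n) :
    fderiv ℝ f z (gradient f z) = ‖gradient f z‖ ^ 2 := by
  rw [← inner_gradient, real_inner_self_eq_norm_sq]

lemma fderiv_gradient_comm (f k : Space n → ℝ) (z : Space n) :
    fderiv ℝ f z (gradient k z) = fderiv ℝ k z (gradient f z) := by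
  rw [← inner_gradient, ← inner_gradient, real_inner_comm]

lemma divergence_eq_sum (F : Space n → Space n) (z : Space n) :
    divergence F z = ∑ i, (fderiv ℝ F z (EuclideanSpace.single i 1)) i := by
  unfold divergence
  rw [LinearMap.trace_eq_sum_inner _ (EuclideanSpace.basisFun (Fin (n + 1)) ℝ)]
  simp [EuclideanSpace.inner_single_left]

lemma contDiffOn_gradient {f : Space n → ℝ} {m : ℕ} (hf : ContDiffOn ℝ (m + 1) f (upperHalf n)) :
    ContDiffOn ℝ m (gradient f) (upperHalf n) :=
  (InnerProductSpace.toDual ℝ (Space n)).symm.contDiff.comp_contDiffOn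
    (hf.fderiv_of_isOpen isOpen_upperHalf le_rfl)

lemma contDiffOn_ht_rpow (a : ℝ) : ContDiffOn ℝ 1 (fun z : Space n => ht z ^ a) (upperHalf n) :=
  ((htL n).contDiff.contDiffOn).rpow_const_of_ne fun _ hz => ne_of_gt hz

/-- A function that is continuous on the upper half-space and vanishes off a compact subset of it
is integrable. -/
lemma integrable_of_continuousOn_of_compact {ψ : Space n → ℝ} {K : Set (Space n)}
    (hψ : ContinuousOn ψ (upperHalf n)) (hK : IsCompact K) (hKu : K ⊆ upperHalf n)
    (h0 : ∀ z ∉ K, ψ z = 0) : Integrable ψ := by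
  rw [← integrableOn_iff_integrable_of_support_subset (s := K)
    (fun z hz => by_contra fun h => hz (h0 z h))]
  exact (hψ.mono hKu).integrableOn_compact hK

lemma eventuallyEq_zero_of_notMem {ψ : Space n → ℝ} {K : Set (Space n)} (hK : IsCompact K)
    (h0 : ∀ z ∉ K, ψ z = 0) {z : Space n} (hz : z ∉ K) : ψ =ᶠ[𝓝 z] fun _ => 0 := by
  filter_upwards [hK.isClosed.isOpen_compl.mem_nhds hz] with w hw using h0 w hw

lemma fderiv_eq_zero_of_notMem {ψ : Space n → ℝ} {K : Set (Space n)} (hK : IsCompact K)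
    (h0 : ∀ z ∉ K, ψ z = 0) {z : Space n} (hz : z ∉ K) : fderiv ℝ ψ z = 0 := by
  rw [(eventuallyEq_zero_of_notMem hK h0 hz).fderiv_eq]
  simp

/-- Integration by parts, one coordinate at a time. On the compact set `K` the weight is smooth, so
`y^a ∇f` is of class `C¹` there, and no boundary term appears because `φ` vanishes off `K`. -/
lemma integral_wt_fderiv_gradient_eq_zero {f φ : Space n → ℝ} {K : Set (Space n)}
    (hf : ContDiffOn ℝ 2 f (upperHalf n)) (hLa : ∀ z ∈ upperHalf n, La a f z = 0)
    (hφ : ContDiffOn ℝ 1 φ (upperHalf n)) (hK : IsCompact K) (hKu : K ⊆ upperHalf n)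
    (h0 : ∀ z ∉ K, φ z = 0) : ∫ z, fderiv ℝ φ z (gradient f z) ∂(wt n a) = 0 := by
  set X : Space n → Space n := fun z => ht z ^ a • gradient f z with hX
  have hXc : ContDiffOn ℝ 1 X (upperHalf n) :=
    (contDiffOn_ht_rpow a).smul (contDiffOn_gradient (m := 1) (by exact_mod_cast hf))
  have hts : tsupport φ ⊆ K := closure_minimal (fun z hz => by_contra fun h => hz (h0 z h)) hK.isClosed
  have hφd : ∀ z, DifferentiableAt ℝ φ z := fun z => by
    by_cases hz : z ∈ upperHalf n
    · exact (hφ.differentiableOn one_ne_zero).differentiableAt (isOpen_upperHalf.mem_nhds hz)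
    · exact (differentiableAt_const (0 : ℝ)).congr_of_eventuallyEq
        (eventuallyEq_zero_of_notMem hK h0 fun h => hz (hKu h))
  have hXd : ∀ z ∈ upperHalf n, DifferentiableAt ℝ X z := fun z hz =>
    (hXc.differentiableOn one_ne_zero).differentiableAt (isOpen_upperHalf.mem_nhds hz)
  have hφ' : ContinuousOn (fderiv ℝ φ) (upperHalf n) :=
    hφ.continuousOn_fderiv_of_isOpen isOpen_upperHalf le_rfl
  have hX' : ContinuousOn (fderiv ℝ X) (upperHalf n) :=
    hXc.continuousOn_fderiv_of_isOpen isOpen_upperHalf le_rfl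
  have hproj : ∀ (i : Fin (n + 1)), ∀ z ∈ upperHalf n, HasFDerivAt (fun w => X w i)
      ((EuclideanSpace.proj i : Space n →L[ℝ] ℝ).comp (fderiv ℝ X z)) z := fun i z hz =>
    ((EuclideanSpace.proj i : Space n →L[ℝ] ℝ).hasFDerivAt).comp z (hXd z hz).hasFDerivAt
  have hXi : ∀ i : Fin (n + 1), ContinuousOn (fun z => X z i) (upperHalf n) := fun i =>
    (EuclideanSpace.proj i : Space n →L[ℝ] ℝ).continuous.comp_continuousOn hXc.continuousOn
  have key : ∀ i : Fin (n + 1),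
      Integrable (fun z => φ z * (fderiv ℝ X z (EuclideanSpace.single i 1)) i) ∧
      Integrable (fun z => fderiv ℝ φ z (EuclideanSpace.single i 1) * X z i) ∧
      ∫ z, φ z * (fderiv ℝ X z (EuclideanSpace.single i 1)) i =
        -∫ z, fderiv ℝ φ z (EuclideanSpace.single i 1) * X z i := by
    intro i
    have i1 : Integrable (fun z => φ z * (fderiv ℝ X z (EuclideanSpace.single i 1)) i) := by
      refine integrable_of_continuousOn_of_compact ?_ hK hKu fun z hz => by simp [h0 z hz]
      exact hφ.continuousOn.mul ((EuclideanSpace.proj i : Space n →L[ℝ] ℝ).continuous.comp_continuousOn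
        (hX'.clm_apply continuousOn_const))
    have i2 : Integrable (fun z => fderiv ℝ φ z (EuclideanSpace.single i 1) * X z i) := by
      refine integrable_of_continuousOn_of_compact ?_ hK hKu fun z hz => by
        simp [fderiv_eq_zero_of_notMem hK h0 hz]
      exact (hφ'.clm_apply continuousOn_const).mul (hXi i)
    have i3 : Integrable (fun z => φ z * X z i) :=
      integrable_of_continuousOn_of_compact (hφ.continuousOn.mul (hXi i)) hK hKu
        fun z hz => by simp [h0 z hz]
    have e : ∀ z, φ z * fderiv ℝ (fun w => X w i) z (EuclideanSpace.single i 1) =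
        φ z * (fderiv ℝ X z (EuclideanSpace.single i 1)) i := fun z => by
      by_cases hz : z ∈ upperHalf n
      · rw [(hproj i z hz).fderiv]; simp
      · simp [h0 z fun h => hz (hKu h)]
    refine ⟨i1, i2, ?_⟩
    have := integral_mul_fderiv_eq_neg_fderiv_mul_of_integrable (μ := (volume : Measure (Space n)))
      (v := EuclideanSpace.single i 1) (f := φ) (g := fun w => X w i) i2
      (by simpa only [e] using i1) i3 (fun z _ => hφd z)
      (fun z hz => (hproj i z (hKu (hts hz))).differentiableAt)
    simpa only [e] using this
  have hsum1 : ∫ z, ∑ i, φ z * (fderiv ℝ X z (EuclideanSpace.single i 1)) i = 0 := by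
    rw [← integral_zero (Space n) ℝ]
    refine integral_congr_ae (Eventually.of_forall fun z => ?_)
    by_cases hz : z ∈ upperHalf n
    · have := hLa z hz
      unfold La at this
      rw [divergence_eq_sum] at this
      simp only [← Finset.mul_sum]
      rw [this, mul_zero]
    · simp [h0 z fun h => hz (hKu h)]
  have hsum2 : ∀ z, ∑ i, fderiv ℝ φ z (EuclideanSpace.single i 1) * X z i =
      fderiv ℝ φ z (X z) := fun z => by
    conv_rhs => rw [← (EuclideanSpace.basisFun (Fin (n + 1)) ℝ).sum_repr (X z)]
    simp [mul_comm]
  rw [integral_finsetSum _ fun i _ => (key i).1, Finset.sum_congr rfl fun i _ => (key i).2.2,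
    Finset.sum_neg_distrib, ← integral_finsetSum _ fun i _ => (key i).2.1, neg_eq_zero] at hsum1
  simp only [hsum2] at hsum1
  rw [integral_wt, ← hsum1, ← integral_indicator measurableSet_upperHalf]
  refine integral_congr_ae (Eventually.of_forall fun z => ?_)
  by_cases hz : z ∈ upperHalf n
  · simp [hz, hX]
  · simp [hz, fderiv_eq_zero_of_notMem hK h0 fun h => hz (hKu h)]

end

/-! ### Neumann problems: height cutoffs and the boundary term. -/

section

variable {n : ℕ} {a : ℝ}

/-- Classical solutions of `L_a f = 0` in the upper half-space with `∂_y^a f = g` on its boundary. -/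
structure IsNeumann (a : ℝ) (f : Space n → ℝ) (g : EuclideanSpace ℝ (Fin n) → ℝ) : Prop where
  contDiffOn : ContDiffOn ℝ 2 f (upperHalf n)
  continuousOn : ContinuousOn f (closedUpperHalf n)
  eq_zero : ∀ z ∈ upperHalf n, La a f z = 0
  boundary : HasWeightedNormalDeriv a f g
  continuous_boundary : Continuous g

/-- A smooth cutoff of the height variable: it vanishes for `y ≤ ε` and equals `1` for `y ≥ 2 ε`. -/
def lift (ε : ℝ) (y : ℝ) : ℝ := Real.smoothTransition (ε⁻¹ * y - 1)

/-- The derivative of the height cutoff. -/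
def lift' (ε : ℝ) (y : ℝ) : ℝ := ε⁻¹ * deriv Real.smoothTransition (ε⁻¹ * y - 1)

lemma hasDerivAt_lift (ε y : ℝ) : HasDerivAt (lift ε) (lift' ε y) y := by
  have h1 : HasDerivAt Real.smoothTransition (deriv Real.smoothTransition (ε⁻¹ * y - 1))
      (ε⁻¹ * y - 1) :=
    ((Real.smoothTransition.contDiff (n := 1)).differentiable one_ne_zero _).hasDerivAt
  have h2 : HasDerivAt (fun y : ℝ => ε⁻¹ * y - 1) ε⁻¹ y := by
    simpa using ((hasDerivAt_id y).const_mul ε⁻¹).sub_const 1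
  exact (h1.comp y h2).congr_deriv (mul_comm _ _)

lemma contDiff_lift (ε : ℝ) : ContDiff ℝ 1 (lift ε) :=
  Real.smoothTransition.contDiff.comp ((contDiff_const.mul contDiff_id).sub contDiff_const)

lemma continuous_deriv_smoothTransition : Continuous (deriv Real.smoothTransition) :=
  (Real.smoothTransition.contDiff (n := 1)).continuous_deriv le_rfl

lemma continuous_lift' (ε : ℝ) : Continuous (lift' ε) :=
  continuous_const.mul (continuous_deriv_smoothTransition.comp (by fun_prop))

lemma lift_nonneg (ε y : ℝ) : 0 ≤ lift ε y := Real.smoothTransition.nonneg _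

lemma lift_le_one (ε y : ℝ) : lift ε y ≤ 1 := Real.smoothTransition.le_one _

lemma lift_eq_zero {ε y : ℝ} (hε : 0 < ε) (hy : y ≤ ε) : lift ε y = 0 := by
  refine Real.smoothTransition.zero_of_nonpos ?_
  have : ε⁻¹ * y ≤ ε⁻¹ * ε := by gcongr
  rw [inv_mul_cancel₀ hε.ne'] at this
  linarith

lemma lift_eq_one {ε y : ℝ} (hε : 0 < ε) (hy : 2 * ε ≤ y) : lift ε y = 1 := by
  refine Real.smoothTransition.one_of_one_le ?_
  have : ε⁻¹ * (2 * ε) ≤ ε⁻¹ * y := by gcongr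
  rw [mul_comm 2, ← mul_assoc, inv_mul_cancel₀ hε.ne'] at this
  linarith

lemma tendsto_lift {y : ℝ} (hy : 0 < y) : Tendsto (fun ε => lift ε y) (𝓝[>] 0) (𝓝 1) := by
  refine tendsto_const_nhds.congr' ?_
  filter_upwards [Ioo_mem_nhdsGT (half_pos hy)] with ε hε
  exact (lift_eq_one hε.1 (by linarith [hε.2])).symm

lemma deriv_smoothTransition_eq_zero {x : ℝ} (hx : x ∉ Icc (0 : ℝ) 1) :
    deriv Real.smoothTransition x = 0 := by
  rw [mem_Icc, not_and_or, not_le, not_le] at hx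
  rcases hx with hx | hx
  · have : Real.smoothTransition =ᶠ[𝓝 x] fun _ => 0 := by
      filter_upwards [gt_mem_nhds hx] with w hw using Real.smoothTransition.zero_of_nonpos hw.le
    rw [this.deriv_eq, deriv_const]
  · have : Real.smoothTransition =ᶠ[𝓝 x] fun _ => 1 := by
      filter_upwards [lt_mem_nhds hx] with w hw using Real.smoothTransition.one_of_one_le hw.le
    rw [this.deriv_eq, deriv_const]

lemma lift'_eq_zero {ε y : ℝ} (hε : 0 < ε) (hy : y ∉ Icc ε (2 * ε)) : lift' ε y = 0 := by
  unfold lift'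
  rw [deriv_smoothTransition_eq_zero, mul_zero]
  contrapose! hy
  rw [mem_Icc, sub_nonneg, sub_le_iff_le_add, ← div_eq_inv_mul, le_div_iff₀ hε, div_le_iff₀ hε] at hy
  constructor <;> linarith [hy.1, hy.2]

/-- The derivatives of the cutoffs are rescalings of one profile, so their `L¹` norm does not depend
on `ε`. With the total mass `1` and the support in `[ε, 2ε]`, this makes them an approximate
identity at `0+`. -/
lemma integral_abs_lift' {ε : ℝ} (hε : 0 < ε) :
    ∫ y, |lift' ε y| = ∫ x, |deriv Real.smoothTransition x| := by
  have h1 := Measure.integral_comp_mul_left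
    (fun x => |deriv Real.smoothTransition (x - 1)|) ε⁻¹
  rw [integral_sub_right_eq_self (fun x => |deriv Real.smoothTransition x|) 1] at h1
  simp only [lift', abs_mul, abs_of_pos (inv_pos.2 hε), integral_const_mul]
  rw [h1, inv_inv, abs_of_pos hε, smul_eq_mul, ← mul_assoc, inv_mul_cancel₀ hε.ne', one_mul]

lemma integrable_lift' {ε : ℝ} (hε : 0 < ε) : Integrable (lift' ε) := by
  refine (continuous_lift' ε).integrable_of_hasCompactSupport ?_
  exact HasCompactSupport.of_support_subset_isCompact isCompact_Icc
    fun y hy => by_contra fun h => hy (lift'_eq_zero hε h)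

lemma setIntegral_lift' {ε : ℝ} (hε : 0 < ε) : ∫ y in Ioi 0, lift' ε y = 1 := by
  have h1 : ∫ y in Ioi 0, lift' ε y = ∫ y in Icc 0 (2 * ε), lift' ε y := by
    rw [integral_Icc_eq_integral_Ioc]
    refine setIntegral_eq_of_subset_of_forall_sdiff_eq_zero measurableSet_Ioi (fun y hy => hy.1)
      fun y hy => lift'_eq_zero hε fun h => hy.2 ⟨hy.1, h.2⟩
  rw [h1, integral_Icc_eq_integral_Ioc, ← intervalIntegral.integral_of_le (by linarith),
    intervalIntegral.integral_eq_sub_of_hasDerivAt (fun y _ => hasDerivAt_lift ε y)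
      ((continuous_lift' ε).intervalIntegrable _ _), lift_eq_one hε le_rfl, lift_eq_zero hε hε.le,
    sub_zero]

lemma integrable_wt_of_compact {ψ : Space n → ℝ} {K : Set (Space n)}
    (hψ : ContinuousOn ψ (upperHalf n)) (hK : IsCompact K) (hKu : K ⊆ upperHalf n)
    (h0 : ∀ z ∉ K, ψ z = 0) : Integrable ψ (wt n a) := by
  rw [integrable_wt_iff]
  exact (integrable_of_continuousOn_of_compact ((contDiffOn_ht_rpow a).continuousOn.mul hψ) hK hKu
    fun z hz => by simp [h0 z hz]).integrableOn

lemma isCompact_tsupport_inter {η : Space n → ℝ} (hη : HasCompactSupport η) (ε : ℝ) :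
    IsCompact (tsupport η ∩ {z | ε ≤ ht z}) :=
  hη.inter_right (isClosed_le continuous_const continuous_ht)

lemma tsupport_inter_subset {η : Space n → ℝ} {ε : ℝ} (hε : 0 < ε) :
    tsupport η ∩ {z | ε ≤ ht z} ⊆ upperHalf n := fun _ hz => lt_of_lt_of_le hε hz.2

lemma ht_gradient (f : Space n → ℝ) (z : Space n) : ht (gradient f z) = dy f z := by
  have h : (pt 0 1 : Space n) = EuclideanSpace.single (Fin.last n) 1 := by
    ext i
    refine Fin.lastCases ?_ (fun i => ?_) i <;> simp
  rw [dy, ← inner_gradient, h, EuclideanSpace.inner_single_right]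
  simp [ht]

lemma IsNeumann.continuousOn_gradient {f : Space n → ℝ} {g} (hf : IsNeumann a f g) :
    ContinuousOn (gradient f) (upperHalf n) :=
  (contDiffOn_gradient (m := 1) (by exact_mod_cast hf.contDiffOn)).continuousOn

lemma IsNeumann.continuousOn_dy {f : Space n → ℝ} {g} (hf : IsNeumann a f g) :
    ContinuousOn (dy f) (upperHalf n) := by
  have : dy f = fun z => ht (gradient f z) := funext fun z => (ht_gradient f z).symm
  rw [this]
  exact continuous_ht.comp_continuousOn hf.continuousOn_gradient

/-- The weak formulation, tested against functions that vanish near the boundary. -/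
lemma IsNeumann.integral_lift {f k η : Space n → ℝ} {g} (hf : IsNeumann a f g)
    (hk : ContDiffOn ℝ 1 k (upperHalf n)) (hη : ContDiff ℝ 1 η) (hηc : HasCompactSupport η)
    {ε : ℝ} (hε : 0 < ε) :
    ∫ z, lift ε (ht z) * (η z * fderiv ℝ k z (gradient f z) + k z * fderiv ℝ η z (gradient f z))
      ∂(wt n a) = - ∫ z, η z * k z * lift' ε (ht z) * dy f z ∂(wt n a) := by
  set K := tsupport η ∩ {z | ε ≤ ht z} with hKdef
  have hK : IsCompact K := isCompact_tsupport_inter hηc ε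
  have hKu : K ⊆ upperHalf n := tsupport_inter_subset hε
  have hl : ContDiff ℝ 1 fun z : Space n => lift ε (ht z) := (contDiff_lift ε).comp (htL n).contDiff
  have hz0 : ∀ z ∉ K, lift ε (ht z) * η z = 0 := fun z hz => by
    by_cases h1 : z ∈ tsupport η
    · rw [lift_eq_zero hε (le_of_not_ge fun h => hz ⟨h1, h⟩), zero_mul]
    · rw [image_eq_zero_of_notMem_tsupport h1, mul_zero]
  have hz1 : ∀ z ∉ K, lift ε (ht z) * ‖fderiv ℝ η z‖ = 0 := fun z hz => by
    by_cases h1 : z ∈ tsupport η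
    · rw [lift_eq_zero hε (le_of_not_ge fun h => hz ⟨h1, h⟩), zero_mul]
    · rw [image_eq_zero_of_notMem_tsupport (fun h => h1 (tsupport_fderiv_subset ℝ h)), norm_zero, mul_zero]
  have hz2 : ∀ z ∉ K, η z * lift' ε (ht z) = 0 := fun z hz => by
    by_cases h1 : z ∈ tsupport η
    · rw [lift'_eq_zero hε fun h => hz ⟨h1, h.1⟩, mul_zero]
    · rw [image_eq_zero_of_notMem_tsupport h1, zero_mul]
  have hG := hf.continuousOn_gradient
  have hkf : ContinuousOn (fun z => fderiv ℝ k z (gradient f z)) (upperHalf n) :=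
    (hk.continuousOn_fderiv_of_isOpen isOpen_upperHalf le_rfl).clm_apply hG
  have hηf : ContinuousOn (fun z => fderiv ℝ η z (gradient f z)) (upperHalf n) :=
    (hη.continuous_fderiv one_ne_zero).continuousOn.clm_apply hG
  -- The three-factor test function `lift · η · k` is supported at height at least `ε`. The gradient
  -- of its first factor produces the term with `lift'` and `∂_y f`.
  have main := integral_wt_fderiv_gradient_eq_zero (a := a) (φ := fun z => lift ε (ht z) * η z * k z)
    hf.contDiffOn hf.eq_zero ((hl.mul hη).contDiffOn.mul hk) hK hKu fun z hz => by simp [hz0 z hz]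
  have hexp : ∀ z ∈ upperHalf n, fderiv ℝ (fun z => lift ε (ht z) * η z * k z) z (gradient f z) =
      lift ε (ht z) * (η z * fderiv ℝ k z (gradient f z) + k z * fderiv ℝ η z (gradient f z)) +
        η z * k z * lift' ε (ht z) * dy f z := fun z hz => by
    have d1 : HasFDerivAt (fun z : Space n => lift ε (ht z)) (lift' ε (ht z) • htL n) z :=
      HasDerivAt.comp_hasFDerivAt (h₂ := lift ε) (f := ht) z (hasDerivAt_lift ε (ht z)) (htL n).hasFDerivAt
    have d2 := (hη.differentiable one_ne_zero z).hasFDerivAt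
    have d3 := ((hk.differentiableOn one_ne_zero).differentiableAt
      (isOpen_upperHalf.mem_nhds hz)).hasFDerivAt
    have d4 : HasFDerivAt (fun z => lift ε (ht z) * η z * k z) _ z := (d1.mul d2).mul d3
    rw [d4.fderiv]
    simp [ht_gradient]
    ring
  rw [integral_congr_ae (ae_mem_upperHalf.mono hexp), integral_add] at main
  · linarith
  · refine integrable_wt_of_compact (hl.continuous.continuousOn.mul
      ((hη.continuous.continuousOn.mul hkf).add (hk.continuousOn.mul hηf))) hK hKu fun z hz => ?_
    have h2 : lift ε (ht z) * fderiv ℝ η z (gradient f z) = 0 := by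
      rcases mul_eq_zero.1 (hz1 z hz) with h | h
      · simp [h]
      · simp [norm_eq_zero.1 h]
    rw [mul_add, ← mul_assoc, hz0 z hz, mul_left_comm, h2]
    simp
  · refine integrable_wt_of_compact (((hη.continuous.continuousOn.mul hk.continuousOn).mul
      ((continuous_lift' ε).comp continuous_ht).continuousOn).mul hf.continuousOn_dy) hK hKu
      fun z hz => ?_
    rw [mul_right_comm (η z), hz2 z hz]
    simp

lemma integral_wt_eq_prod {F : Space n → ℝ} :
    ∫ z, F z ∂(wt n a) = ∫ p : EuclideanSpace ℝ (Fin n) × ℝ, F (pt p.1 p.2) ∂(volume.prod (wt1 a)) :=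
  (measurePreserving_pt_wt.integral_comp measurableEmbedding_pt F).symm

lemma integral_wt1 {f : ℝ → ℝ} : ∫ y, f y ∂(wt1 a) = ∫ y in Ioi 0, y ^ a * f y := by
  unfold wt1
  rw [integral_withDensity_eq_integral_toReal_smul (measurable_weight1 a) (by simp)]
  refine setIntegral_congr_fun measurableSet_Ioi fun y hy => ?_
  simp [ENNReal.toReal_ofReal (Real.rpow_nonneg (le_of_lt hy) a)]

lemma continuous_pt_left (y : ℝ) :
    Continuous fun x : EuclideanSpace ℝ (Fin n) => (pt x y : Space n) :=
  continuous_pt.comp (continuous_id.prodMk continuous_const)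

lemma continuous_pt_right (x : EuclideanSpace ℝ (Fin n)) :
    Continuous fun y : ℝ => (pt x y : Space n) :=
  continuous_pt.comp (continuous_const.prodMk continuous_id)

lemma continuousOn_comp_pt {q : Space n → ℝ} (hq : ContinuousOn q (closedUpperHalf n)) :
    Continuous fun x : EuclideanSpace ℝ (Fin n) => q (pt x 0) :=
  hq.comp_continuous (continuous_pt_left 0) fun x => pt_mem_closedUpperHalf le_rfl

/-- Dominated convergence. Local uniformity of the Neumann limit gives uniform closeness to `g` on a
compact ball containing the support, and hence a bound on `y^a ∂_y f` there for small `y`. -/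
lemma IsNeumann.tendsto_integral_slice {f q : Space n → ℝ} {g} (hf : IsNeumann a f g)
    (hq : ContinuousOn q (closedUpperHalf n)) {R : ℝ} (hR : ∀ z, R < ‖z‖ → q z = 0) :
    Tendsto (fun y => ∫ x, q (pt x y) * (y ^ a * dy f (pt x y))) (𝓝[>] 0)
      (𝓝 (∫ x, q (pt x 0) * g x)) := by
  have hB : IsCompact (Metric.closedBall (0 : EuclideanSpace ℝ (Fin n)) R) := isCompact_closedBall _ _
  have hU := (tendstoLocallyUniformlyOn_iff_tendstoUniformlyOn_of_compact hB).1
    (hf.boundary.tendstoLocallyUniformlyOn (s := Metric.closedBall 0 R))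
  obtain ⟨Cg, hCg⟩ := hB.exists_bound_of_continuousOn hf.continuous_boundary.continuousOn
  have hKc : IsCompact (closedUpperHalf n ∩ Metric.closedBall 0 R) :=
    (isCompact_closedBall _ _).inter_left isClosed_closedUpperHalf
  obtain ⟨Cq, hCq⟩ := hKc.exists_bound_of_continuousOn (hq.mono inter_subset_left)
  have hq0 : ∀ x y, x ∉ Metric.closedBall (0 : EuclideanSpace ℝ (Fin n)) R → q (pt x y) = 0 := by
    intro x y hx
    rw [mem_closedBall_zero_iff, not_le] at hx
    exact hR _ (hx.trans_le (norm_le_norm_pt x y))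
  have hCq' : ∀ x y, 0 ≤ y → ‖q (pt x y)‖ ≤ |Cq| := by
    intro x y hy
    by_cases h : ‖pt x y‖ ≤ R
    · exact (hCq _ ⟨pt_mem_closedUpperHalf hy, by simpa using h⟩).trans (le_abs_self _)
    · rw [hR _ (not_le.1 h)]; simp
  refine tendsto_integral_filter_of_dominated_convergence
    ((Metric.closedBall 0 R).indicator fun _ => |Cq| * (|Cg| + 1)) ?_ ?_ ?_ ?_
  · filter_upwards [self_mem_nhdsWithin] with y (hy : 0 < y)
    refine Continuous.aestronglyMeasurable ?_
    have hc := continuous_pt_left (n := n) y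
    exact ((hq.comp_continuous hc fun x => pt_mem_closedUpperHalf hy.le)).mul
      (continuous_const.mul (hf.continuousOn_dy.comp_continuous hc fun x => pt_mem_upperHalf hy))
  · filter_upwards [self_mem_nhdsWithin, Metric.tendstoUniformlyOn_iff.1 hU 1 one_pos] with y
      (hy : 0 < y) h1
    refine Eventually.of_forall fun x => ?_
    by_cases hx : x ∈ Metric.closedBall (0 : EuclideanSpace ℝ (Fin n)) R
    · rw [indicator_of_mem hx, norm_mul]
      have h2 := h1 x hx
      rw [dist_comm, dist_eq_norm] at h2
      have h3 : ‖y ^ a * dy f (pt x y)‖ ≤ |Cg| + 1 := by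
        have := norm_le_norm_add_norm_sub (g x) (y ^ a * dy f (pt x y))
        rw [norm_sub_rev] at this
        linarith [hCg x hx, le_abs_self Cg]
      exact mul_le_mul (hCq' x y hy.le) h3 (norm_nonneg _) (abs_nonneg _)
    · rw [indicator_of_notMem hx, hq0 x y hx]; simp
  · exact (integrable_indicator_iff measurableSet_closedBall).2
      (integrableOn_const measure_closedBall_lt_top.ne)
  · refine Eventually.of_forall fun x => ?_
    by_cases hx : x ∈ Metric.closedBall (0 : EuclideanSpace ℝ (Fin n)) R
    · refine Tendsto.mul ?_ (hU.tendsto_at hx)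
      have hc : ContinuousWithinAt (fun y : ℝ => q (pt x y)) (Ioi 0) 0 := by
        refine ContinuousWithinAt.comp (t := closedUpperHalf n)
          (hq (pt x 0) (pt_mem_closedUpperHalf le_rfl)) ?_ fun y hy => pt_mem_closedUpperHalf (le_of_lt hy)
        exact (continuous_pt_right x).continuousWithinAt
      exact hc
    · simp only [hq0 x _ hx, zero_mul]
      exact tendsto_const_nhds

/-- By Fubini the integral is an average of the slice integrals over heights in `[ε, 2ε]`, with
signed weight of total mass one and bounded `L¹` norm. It therefore has the same limit as the
slices. -/
lemma IsNeumann.tendsto_integral_lift' {f q : Space n → ℝ} {g} (hf : IsNeumann a f g)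
    (hq : ContinuousOn q (closedUpperHalf n)) {R : ℝ} (hR : ∀ z, R < ‖z‖ → q z = 0) :
    Tendsto (fun ε => ∫ z, q z * lift' ε (ht z) * dy f z ∂(wt n a)) (𝓝[>] 0)
      (𝓝 (∫ x, q (pt x 0) * g x)) := by
  set Q : ℝ → ℝ := fun y => ∫ x, q (pt x y) * (y ^ a * dy f (pt x y)) with hQ
  set Q0 := ∫ x, q (pt x 0) * g x
  have hlim : Tendsto Q (𝓝[>] 0) (𝓝 Q0) := hf.tendsto_integral_slice hq hR
  set C := ∫ x, |deriv Real.smoothTransition x| with hC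
  have hC0 : 0 ≤ C := integral_nonneg fun x => abs_nonneg _
  rw [Metric.tendsto_nhds]
  intro δ hδ
  -- The average is off by at most `C` times the error of the slices; `C + 1` avoids a division by
  -- zero and makes the final inequality strict.
  have hev := Metric.tendsto_nhds.1 hlim (δ / (C + 1)) (by positivity)
  rw [eventually_nhdsWithin_iff, Metric.eventually_nhds_iff] at hev
  obtain ⟨r, hr, hev⟩ := hev
  filter_upwards [Ioo_mem_nhdsGT (half_pos hr)] with ε hε
  have hε0 : 0 < ε := hε.1
  have hint : Integrable (fun z => q z * lift' ε (ht z) * dy f z) (wt n a) := by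
    refine integrable_wt_of_compact (K := Metric.closedBall 0 R ∩ {z | ε ≤ ht z})
      (((hq.mono upperHalf_subset_closedUpperHalf).mul
      ((continuous_lift' ε).comp continuous_ht).continuousOn).mul hf.continuousOn_dy)
      ((isCompact_closedBall _ _).inter_right (isClosed_le continuous_const continuous_ht))
      (fun _ hz => lt_of_lt_of_le hε0 hz.2) fun z hz => ?_
    by_cases h1 : ‖z‖ ≤ R
    · rw [lift'_eq_zero hε0 fun h => hz ⟨by simpa using h1, h.1⟩]; simp
    · rw [hR z (not_le.1 h1)]; simp
  have hint' := (measurePreserving_pt_wt.integrable_comp_emb measurableEmbedding_pt).2 hint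
  have e1 : ∫ z, q z * lift' ε (ht z) * dy f z ∂(wt n a) = ∫ y in Ioi 0, lift' ε y * Q y := by
    rw [integral_wt_eq_prod]
    refine (integral_prod_symm _ hint').trans ?_
    rw [integral_wt1]
    refine setIntegral_congr_fun measurableSet_Ioi fun y _ => ?_
    simp only [hQ, Function.comp, ht_pt]
    rw [← integral_const_mul, ← integral_const_mul]
    congr 1
    funext x
    ring
  have hi2 : IntegrableOn (fun y => lift' ε y * Q y) (Ioi 0) := by
    have := hint'.integral_prod_right
    unfold wt1 at this
    rw [integrable_withDensity_iff_integrable_smul' (measurable_weight1 a) (by simp)] at this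
    refine this.congr ?_
    filter_upwards [ae_restrict_mem measurableSet_Ioi] with y hy
    simp only [hQ, Function.comp, ht_pt, smul_eq_mul]
    rw [ENNReal.toReal_ofReal (Real.rpow_nonneg (le_of_lt hy) a), ← integral_const_mul,
      ← integral_const_mul]
    congr 1
    funext x
    ring
  have hi1 : IntegrableOn (fun y => lift' ε y * Q0) (Ioi 0) :=
    ((integrable_lift' hε0).mul_const Q0).integrableOn
  -- The weight has integral one, so the limit value can be moved inside.
  have e2 : (∫ y in Ioi 0, lift' ε y * Q y) - Q0 = ∫ y in Ioi 0, lift' ε y * (Q y - Q0) := by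
    simp only [mul_sub]
    rw [integral_sub hi2 hi1, integral_mul_const, setIntegral_lift' hε0, one_mul]
  rw [dist_eq_norm, e1, e2]
  have hb : ‖∫ y in Ioi 0, lift' ε y * (Q y - Q0)‖ ≤ ∫ y in Ioi 0, |lift' ε y| * (δ / (C + 1)) := by
    refine norm_integral_le_of_norm_le ((integrable_lift' hε0).abs.mul_const _).integrableOn ?_
    filter_upwards [ae_restrict_mem measurableSet_Ioi] with y hy
    rw [norm_mul, Real.norm_eq_abs]
    by_cases h : y ∈ Icc ε (2 * ε)
    · refine mul_le_mul_of_nonneg_left ?_ (abs_nonneg _)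
      have hy0 : (0 : ℝ) < y := hy
      rw [← dist_eq_norm]
      exact (hev (by rw [Real.dist_eq, sub_zero, abs_of_pos hy0]; linarith [h.2, hε.2]) hy).le
    · rw [lift'_eq_zero hε0 h]; simp
  have hb2 : ∫ y in Ioi 0, |lift' ε y| * (δ / (C + 1)) ≤ C * (δ / (C + 1)) := by
    rw [integral_mul_const]
    refine mul_le_mul_of_nonneg_right ?_ (by positivity)
    rw [hC, ← integral_abs_lift' hε0]
    exact setIntegral_le_integral (integrable_lift' hε0).abs (Eventually.of_forall fun _ => abs_nonneg _)
  have hb3 : C * (δ / (C + 1)) < δ := by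
    rw [mul_div_assoc', div_lt_iff₀ (by positivity)]
    nlinarith
  linarith

end

/-! ### Finite local energy (Caccioppoli) and the weak formulation up to the boundary. -/

section

variable {n : ℕ} {a : ℝ}

/-- The Cauchy–Schwarz inequality for integrals. -/
lemma sq_integral_mul_le {α : Type*} [MeasurableSpace α] {μ : Measure α} {f g : α → ℝ}
    (hf : Integrable (fun x => f x ^ 2) μ) (hg : Integrable (fun x => g x ^ 2) μ)
    (hfg : Integrable (fun x => f x * g x) μ) :
    (∫ x, f x * g x ∂μ) ^ 2 ≤ (∫ x, f x ^ 2 ∂μ) * ∫ x, g x ^ 2 ∂μ := by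
  -- The quadratic `t ↦ ∫ (t g + f)²` is nonnegative, so its discriminant is not positive.
  have h : ∀ t : ℝ, 0 ≤ (∫ x, g x ^ 2 ∂μ) * (t * t) + (2 * ∫ x, f x * g x ∂μ) * t +
      ∫ x, f x ^ 2 ∂μ := by
    intro t
    have e : (∫ x, g x ^ 2 ∂μ) * (t * t) + (2 * ∫ x, f x * g x ∂μ) * t + ∫ x, f x ^ 2 ∂μ =
        ∫ x, (t * g x + f x) ^ 2 ∂μ := by
      rw [← integral_mul_const, ← integral_const_mul, ← integral_mul_const, ← integral_add,
        ← integral_add]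
      · congr 1; funext x; ring
      · exact (hg.mul_const _).add ((hfg.const_mul _).mul_const _)
      · exact hf
      · exact hg.mul_const _
      · exact (hfg.const_mul _).mul_const _
    rw [e]
    exact integral_nonneg fun x => sq_nonneg _
  have := discrim_le_zero h
  unfold discrim at this
  nlinarith

lemma integrable_mul_of_sq {α : Type*} [MeasurableSpace α] {μ : Measure α} {f g : α → ℝ}
    (hfm : AEStronglyMeasurable f μ) (hgm : AEStronglyMeasurable g μ)
    (hf : Integrable (fun x => f x ^ 2) μ) (hg : Integrable (fun x => g x ^ 2) μ) :
    Integrable (fun x => f x * g x) μ := by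
  refine (hf.add hg).mono' (hfm.mul hgm) (Eventually.of_forall fun x => ?_)
  simp only [Pi.add_apply, Real.norm_eq_abs, abs_mul]
  nlinarith [sq_nonneg (|f x| - |g x|), sq_abs (f x), sq_abs (g x), abs_nonneg (f x), abs_nonneg (g x)]

/-- Fatou's lemma for nonnegative functions whose integrals stay below a convergent sequence. -/
lemma integrable_and_integral_le_of_tendsto {α : Type*} [MeasurableSpace α] {μ : Measure α}
    {F : ℕ → α → ℝ} {G : α → ℝ} {c : ℕ → ℝ} {C : ℝ} (hF : ∀ m, Integrable (F m) μ)
    (hF0 : ∀ m, 0 ≤ᵐ[μ] F m) (hG : AEStronglyMeasurable G μ)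
    (hlim : ∀ᵐ x ∂μ, Tendsto (fun m => F m x) atTop (𝓝 (G x)))
    (hc : ∀ m, ∫ x, F m x ∂μ ≤ c m) (hC : Tendsto c atTop (𝓝 C)) :
    Integrable G μ ∧ ∫ x, G x ∂μ ≤ C := by
  have hG0 : 0 ≤ᵐ[μ] G := by
    filter_upwards [hlim, ae_all_iff.2 hF0] with x hx h0
    exact ge_of_tendsto' hx h0
  have hle : ∫⁻ x, ENNReal.ofReal (G x) ∂μ ≤ ENNReal.ofReal C := by
    calc ∫⁻ x, ENNReal.ofReal (G x) ∂μ
        = ∫⁻ x, liminf (fun m => ENNReal.ofReal (F m x)) atTop ∂μ := by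
          refine lintegral_congr_ae ?_
          filter_upwards [hlim] with x hx
          exact ((ENNReal.continuous_ofReal.tendsto _).comp hx).liminf_eq.symm
      _ ≤ liminf (fun m => ∫⁻ x, ENNReal.ofReal (F m x) ∂μ) atTop :=
          lintegral_liminf_le' fun m => (hF m).1.aemeasurable.ennreal_ofReal
      _ ≤ liminf (fun m => ENNReal.ofReal (c m)) atTop := by
          refine liminf_le_liminf (Eventually.of_forall fun m => ?_)
          rw [← ofReal_integral_eq_lintegral_ofReal (hF m) (hF0 m)]
          exact ENNReal.ofReal_le_ofReal (hc m)
      _ = ENNReal.ofReal C := ((ENNReal.continuous_ofReal.tendsto _).comp hC).liminf_eq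
  have hC0 : 0 ≤ C := ge_of_tendsto' hC fun m => (integral_nonneg_of_ae (hF0 m)).trans (hc m)
  have hint : Integrable G μ :=
    ⟨hG, by
      rw [hasFiniteIntegral_iff_ofReal hG0]
      exact hle.trans_lt ENNReal.ofReal_lt_top⟩
  refine ⟨hint, ?_⟩
  rw [← ofReal_integral_eq_lintegral_ofReal hint hG0] at hle
  exact (ENNReal.ofReal_le_ofReal_iff hC0).1 hle

/-- The weighted Dirichlet energy of `k` is finite on bounded sets. -/
def LocEnergy (a : ℝ) (k : Space n → ℝ) : Prop :=
  ∀ R, IntegrableOn (fun z => ‖gradient k z‖ ^ 2) (Metric.closedBall 0 R) (wt n a)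

lemma integrableOn_wt_of_continuousOn (ha : -1 < a) {q : Space n → ℝ}
    (hq : ContinuousOn q (closedUpperHalf n)) (R : ℝ) :
    IntegrableOn q (Metric.closedBall 0 R) (wt n a) := by
  have := isLocallyFiniteMeasure_wt (n := n) ha
  have hK : IsCompact (closedUpperHalf n ∩ Metric.closedBall 0 R) :=
    (isCompact_closedBall _ _).inter_left isClosed_closedUpperHalf
  refine IntegrableOn.congr_set_ae ((hq.mono inter_subset_left).integrableOn_compact hK) ?_
  filter_upwards [ae_mem_upperHalf] with z hz
  exact propext ⟨fun h => ⟨upperHalf_subset_closedUpperHalf hz, h⟩, fun h => h.2⟩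

lemma integrable_of_integrableOn_closedBall {q : Space n → ℝ} {μ : Measure (Space n)} {R : ℝ}
    (h : IntegrableOn q (Metric.closedBall 0 R) μ) (hR : ∀ z, R < ‖z‖ → q z = 0) :
    Integrable q μ := by
  rwa [← integrableOn_iff_integrable_of_support_subset (s := Metric.closedBall 0 R)]
  intro z hz
  by_contra h'
  exact hz (hR z (by simpa using h'))

lemma exists_radius {η : Space n → ℝ} (hηc : HasCompactSupport η) :
    ∃ R, (∀ z, R < ‖z‖ → η z = 0) ∧ ∀ z, R < ‖z‖ → fderiv ℝ η z = 0 := by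
  obtain ⟨R, hR⟩ := hηc.isBounded.subset_closedBall (0 : Space n)
  have h : ∀ z, R < ‖z‖ → z ∉ tsupport η := fun z hz h => by
    have := hR h
    rw [mem_closedBall_zero_iff] at this
    linarith
  exact ⟨R, fun z hz => image_eq_zero_of_notMem_tsupport (h z hz),
    fun z hz => image_eq_zero_of_notMem_tsupport fun h' => h z hz (tsupport_fderiv_subset ℝ h')⟩

/-- A sequence of heights decreasing to zero. -/
def hseq (m : ℕ) : ℝ := 1 / ((m : ℝ) + 1)

lemma hseq_pos (m : ℕ) : 0 < hseq m := by unfold hseq; positivity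

lemma tendsto_hseq : Tendsto hseq atTop (𝓝[>] 0) :=
  tendsto_nhdsWithin_iff.2 ⟨tendsto_one_div_add_atTop_nhds_zero_nat,
    Eventually.of_forall fun m => hseq_pos m⟩

/-- The Caccioppoli inequality. -/
lemma IsNeumann.caccioppoli (ha : -1 < a) {f η : Space n → ℝ} {g} (hf : IsNeumann a f g)
    (hη : ContDiff ℝ 1 η) (hηc : HasCompactSupport η) :
    Integrable (fun z => η z ^ 2 * ‖gradient f z‖ ^ 2) (wt n a) ∧
    ∫ z, η z ^ 2 * ‖gradient f z‖ ^ 2 ∂(wt n a) ≤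
      4 * ∫ z, f z ^ 2 * ‖fderiv ℝ η z‖ ^ 2 ∂(wt n a) +
        2 * |∫ x, η (pt x 0) ^ 2 * f (pt x 0) * g x| := by
  obtain ⟨R, hR, hR'⟩ := exists_radius hηc
  have hη' : Continuous (fderiv ℝ η) := hη.continuous_fderiv one_ne_zero
  have hfu : ContinuousOn f (upperHalf n) := hf.continuousOn.mono upperHalf_subset_closedUpperHalf
  have hM : Integrable (fun z => f z ^ 2 * ‖fderiv ℝ η z‖ ^ 2) (wt n a) :=
    integrable_of_integrableOn_closedBall (integrableOn_wt_of_continuousOn ha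
      ((hf.continuousOn.pow 2).mul (hη'.norm.pow 2).continuousOn) R) fun z hz => by simp [hR' z hz]
  set M := ∫ z, f z ^ 2 * ‖fderiv ℝ η z‖ ^ 2 ∂(wt n a) with hMdef
  set B : ℝ → ℝ := fun ε => ∫ z, η z ^ 2 * f z * lift' ε (ht z) * dy f z ∂(wt n a) with hB
  have hBlim : Tendsto B (𝓝[>] 0) (𝓝 (∫ x, η (pt x 0) ^ 2 * f (pt x 0) * g x)) :=
    hf.tendsto_integral_lift' (q := fun z => η z ^ 2 * f z)
      ((hη.continuous.pow 2).continuousOn.mul hf.continuousOn) (R := R) fun z hz => by simp [hR z hz]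
  have hKint : ∀ ε, 0 < ε → ∀ {ψ : Space n → ℝ}, ContinuousOn ψ (upperHalf n) →
      (∀ z, R < ‖z‖ → ψ z = 0) → Integrable (fun z => lift ε (ht z) * ψ z) (wt n a) := by
    intro ε hε ψ hψ h0
    refine integrable_wt_of_compact (K := Metric.closedBall 0 R ∩ {z | ε ≤ ht z})
      (((contDiff_lift ε).continuous.comp continuous_ht).continuousOn.mul hψ)
      ((isCompact_closedBall _ _).inter_right (isClosed_le continuous_const continuous_ht))
      (fun _ hz => lt_of_lt_of_le hε hz.2) fun z hz => ?_
    by_cases h1 : ‖z‖ ≤ R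
    · rw [lift_eq_zero hε (le_of_not_ge fun h => hz ⟨by simpa using h1, h⟩), zero_mul]
    · rw [h0 z (not_le.1 h1), mul_zero]
  -- The inequality is first shown with the height cutoff in place. All integrals are then finite,
  -- so half of the energy may be absorbed into the left-hand side.
  have hA : ∀ ε, 0 < ε → ∫ z, lift ε (ht z) * (η z ^ 2 * ‖gradient f z‖ ^ 2) ∂(wt n a) ≤
      4 * M + 2 * |B ε| := by
    intro ε hε
    have h1 := hf.integral_lift (k := f) (η := fun z => η z ^ 2)
      (hf.contDiffOn.of_le (by norm_num)) (hη.pow 2) (by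
        rw [show (fun z => η z ^ 2) = η * η from funext fun z => sq (η z)]
        exact hηc.mul_left) hε
    have h2 : ∀ z, fderiv ℝ (fun z => η z ^ 2) z (gradient f z) =
        2 * η z * fderiv ℝ η z (gradient f z) := fun z => by
      rw [((hη.differentiable one_ne_zero z).hasFDerivAt.pow 2).fderiv]
      simp
    simp only [h2, fderiv_gradient_self] at h1
    have i1 : Integrable (fun z => lift ε (ht z) * (η z ^ 2 * ‖gradient f z‖ ^ 2)) (wt n a) :=
      hKint ε hε ((hη.continuous.pow 2).continuousOn.mul (hf.continuousOn_gradient.norm.pow 2))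
        fun z hz => by simp [hR z hz]
    have i2 : Integrable (fun z => lift ε (ht z) * (f z * (2 * η z * fderiv ℝ η z (gradient f z))))
        (wt n a) :=
      hKint ε hε (hfu.mul ((continuousOn_const.mul hη.continuous.continuousOn).mul
        (hη'.continuousOn.clm_apply hf.continuousOn_gradient))) fun z hz => by simp [hR z hz]
    simp only [mul_add] at h1
    rw [integral_add i1 i2] at h1
    -- Young's inequality `2xy ≤ x²/2 + 2y²` with `x = |η||∇f|` and `y = |f||∇η|`. Absorbing the
    -- half doubles the remaining constants, to `4` and `2`.
    have h3 : -∫ z, lift ε (ht z) * (f z * (2 * η z * fderiv ℝ η z (gradient f z))) ∂(wt n a) ≤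
        ∫ z, (1 / 2) * (lift ε (ht z) * (η z ^ 2 * ‖gradient f z‖ ^ 2)) +
          2 * (f z ^ 2 * ‖fderiv ℝ η z‖ ^ 2) ∂(wt n a) := by
      rw [← integral_neg]
      refine integral_mono i2.neg ((i1.const_mul _).add (hM.const_mul _)) fun z => ?_
      have l0 := lift_nonneg ε (ht z)
      have l1 := lift_le_one ε (ht z)
      have c1 : |fderiv ℝ η z (gradient f z)| ≤ ‖fderiv ℝ η z‖ * ‖gradient f z‖ :=
        (fderiv ℝ η z).le_opNorm _
      have c2 : -(f z * (2 * η z * fderiv ℝ η z (gradient f z))) ≤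
          (1 / 2) * (η z ^ 2 * ‖gradient f z‖ ^ 2) + 2 * (f z ^ 2 * ‖fderiv ℝ η z‖ ^ 2) := by
        have c3 : -(f z * (2 * η z * fderiv ℝ η z (gradient f z))) ≤
            2 * (|η z| * ‖gradient f z‖) * (|f z| * ‖fderiv ℝ η z‖) := by
          refine (neg_le_abs _).trans ?_
          rw [abs_mul, abs_mul, abs_mul, abs_two]
          calc |f z| * (2 * |η z| * |fderiv ℝ η z (gradient f z)|)
              ≤ |f z| * (2 * |η z| * (‖fderiv ℝ η z‖ * ‖gradient f z‖)) := by gcongr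
            _ = _ := by ring
        have := sq_nonneg (|η z| * ‖gradient f z‖ - 2 * (|f z| * ‖fderiv ℝ η z‖))
        rw [← sq_abs (η z), ← sq_abs (f z)]
        nlinarith
      have c4 : 0 ≤ f z ^ 2 * ‖fderiv ℝ η z‖ ^ 2 := by positivity
      have := mul_le_mul_of_nonneg_left c2 l0
      nlinarith
    rw [integral_add (i1.const_mul _) (hM.const_mul _), integral_const_mul, integral_const_mul] at h3
    have h4 : -B ε ≤ |B ε| := neg_le_abs _
    simp only [hB] at h4 ⊢
    linarith
  -- Fatou as the height cutoff is removed: finiteness of the energy and the inequality come out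
  -- together.
  refine integrable_and_integral_le_of_tendsto
    (F := fun m z => lift (hseq m) (ht z) * (η z ^ 2 * ‖gradient f z‖ ^ 2))
    (c := fun m => 4 * M + 2 * |B (hseq m)|) ?_ ?_ ?_ ?_ (fun m => hA _ (hseq_pos m)) ?_
  · exact fun m => hKint _ (hseq_pos m) ((hη.continuous.pow 2).continuousOn.mul
      (hf.continuousOn_gradient.norm.pow 2)) fun z hz => by simp [hR z hz]
  · exact fun m => Eventually.of_forall fun z => mul_nonneg (lift_nonneg _ _) (by positivity)
  · exact aestronglyMeasurable_wt ((hη.continuous.pow 2).continuousOn.mul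
      (hf.continuousOn_gradient.norm.pow 2))
  · filter_upwards [ae_mem_upperHalf] with z hz
    simpa using ((tendsto_lift hz).comp tendsto_hseq).mul_const (η z ^ 2 * ‖gradient f z‖ ^ 2)
  · exact ((hBlim.comp tendsto_hseq).abs.const_mul 2).const_add _

/-- A smooth cutoff that equals `1` on the ball of radius `R`. -/
lemma exists_cutoff (n : ℕ) {R : ℝ} (hR : 0 < R) : ∃ η : Space n → ℝ, ContDiff ℝ 1 η ∧
    HasCompactSupport η ∧ (∀ z, ‖z‖ ≤ R → η z = 1) ∧ (∀ z, 2 * R < ‖z‖ → η z = 0) ∧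
    ∀ z, 0 ≤ η z ∧ η z ≤ 1 := by
  let b : ContDiffBump (0 : Space n) := ⟨R, 2 * R, hR, by linarith⟩
  refine ⟨b, b.contDiff, b.hasCompactSupport, fun z hz => ?_, fun z hz => ?_,
    fun z => ⟨b.nonneg, b.le_one⟩⟩
  · exact b.one_of_mem_closedBall (by simpa using hz)
  · exact b.zero_of_le_dist (by simpa using hz.le)

lemma IsNeumann.locEnergy (ha : -1 < a) {f : Space n → ℝ} {g} (hf : IsNeumann a f g) :
    LocEnergy a f := by
  intro R
  -- The radius `|R| + 1` is positive whatever the sign of `R`, and at least `R`.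
  obtain ⟨η, h1, h2, h3, -, -⟩ := exists_cutoff n (R := |R| + 1) (by positivity)
  refine ((hf.caccioppoli ha h1 h2).1.integrableOn (s := Metric.closedBall 0 R)).congr_fun
    (fun z hz => ?_) measurableSet_closedBall
  rw [mem_closedBall_zero_iff] at hz
  simp [h3 z (by linarith [le_abs_self R])]

lemma integrableOn_fderiv_gradient {f k : Space n → ℝ} (hf : ContDiffOn ℝ 1 f (upperHalf n))
    (hk : ContDiffOn ℝ 1 k (upperHalf n)) (hfE : LocEnergy a f) (hkE : LocEnergy a k) (R : ℝ) :
    IntegrableOn (fun z => fderiv ℝ k z (gradient f z)) (Metric.closedBall 0 R) (wt n a) := by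
  have hfg := (contDiffOn_gradient (m := 0) (by simpa using hf)).continuousOn
  refine ((hfE R).add (hkE R)).mono' (aestronglyMeasurable_wt
    ((hk.continuousOn_fderiv_of_isOpen isOpen_upperHalf le_rfl).clm_apply hfg)).restrict
    (Eventually.of_forall fun z => ?_)
  have h1 := (fderiv ℝ k z).le_opNorm (gradient f z)
  rw [← norm_gradient] at h1
  simp only [Pi.add_apply]
  nlinarith [sq_nonneg (‖gradient f z‖ - ‖gradient k z‖), sq_nonneg (‖gradient f z‖),
    sq_nonneg (‖gradient k z‖)]

lemma integrableOn_norm_gradient (ha : -1 < a) {f : Space n → ℝ} (hf : ContDiffOn ℝ 1 f (upperHalf n))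
    (hfE : LocEnergy a f) (R : ℝ) :
    IntegrableOn (fun z => ‖gradient f z‖) (Metric.closedBall 0 R) (wt n a) := by
  have hfg := (contDiffOn_gradient (m := 0) (by simpa using hf)).continuousOn
  refine ((hfE R).add (integrableOn_const (C := (1 : ℝ)) (wt_closedBall_lt_top ha R).ne)).mono'
    (aestronglyMeasurable_wt hfg.norm).restrict (Eventually.of_forall fun z => ?_)
  simp only [Pi.add_apply, norm_norm]
  nlinarith [sq_nonneg (‖gradient f z‖ - 1)]

lemma exists_bound_closedUpperHalf {q : Space n → ℝ} (hq : ContinuousOn q (closedUpperHalf n)) (R : ℝ) :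
    ∃ C, 0 ≤ C ∧ ∀ z ∈ closedUpperHalf n, ‖z‖ ≤ R → |q z| ≤ C := by
  have hK : IsCompact (closedUpperHalf n ∩ Metric.closedBall 0 R) :=
    (isCompact_closedBall _ _).inter_left isClosed_closedUpperHalf
  obtain ⟨C, hC⟩ := hK.exists_bound_of_continuousOn (hq.mono inter_subset_left)
  exact ⟨|C|, abs_nonneg _, fun z hz hzR =>
    (hC z ⟨hz, by simpa using hzR⟩).trans (le_abs_self _)⟩

lemma integrableOn_mul_fderiv_gradient (ha : -1 < a) {f k η : Space n → ℝ}
    (hf : ContDiffOn ℝ 1 f (upperHalf n)) (hfE : LocEnergy a f)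
    (hk : ContinuousOn k (closedUpperHalf n)) (hη : ContDiff ℝ 1 η) (R : ℝ) :
    IntegrableOn (fun z => k z * fderiv ℝ η z (gradient f z)) (Metric.closedBall 0 R) (wt n a) := by
  have hfg := (contDiffOn_gradient (m := 0) (by simpa using hf)).continuousOn
  have hη' : Continuous (fderiv ℝ η) := hη.continuous_fderiv one_ne_zero
  obtain ⟨C, hC0, hC⟩ := exists_bound_closedUpperHalf (hk.mul hη'.norm.continuousOn) R
  refine ((integrableOn_norm_gradient ha hf hfE R).const_mul C).mono' (aestronglyMeasurable_wt
    ((hk.mono upperHalf_subset_closedUpperHalf).mul (hη'.continuousOn.clm_apply hfg))).restrict ?_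
  filter_upwards [ae_restrict_mem measurableSet_closedBall, ae_restrict_of_ae ae_mem_upperHalf]
    with z hzR hz
  have h1 := hC z (upperHalf_subset_closedUpperHalf hz) (by simpa using hzR)
  rw [Pi.mul_apply, abs_mul, abs_norm] at h1
  rw [norm_mul, Real.norm_eq_abs]
  calc |k z| * ‖fderiv ℝ η z (gradient f z)‖ ≤ |k z| * (‖fderiv ℝ η z‖ * ‖gradient f z‖) := by
        gcongr; exact (fderiv ℝ η z).le_opNorm _
    _ ≤ C * ‖gradient f z‖ := by rw [← mul_assoc]; gcongr

/-- The weak formulation of the Neumann problem. -/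
lemma IsNeumann.weak (ha : -1 < a) {f k η : Space n → ℝ} {g} (hf : IsNeumann a f g)
    (hk : ContDiffOn ℝ 1 k (upperHalf n)) (hkc : ContinuousOn k (closedUpperHalf n))
    (hkE : LocEnergy a k) (hη : ContDiff ℝ 1 η) (hηc : HasCompactSupport η) :
    ∫ z, (η z * fderiv ℝ k z (gradient f z) + k z * fderiv ℝ η z (gradient f z)) ∂(wt n a) =
      - ∫ x, η (pt x 0) * k (pt x 0) * g x := by
  obtain ⟨R, hR, hR'⟩ := exists_radius hηc
  have hf1 : ContDiffOn ℝ 1 f (upperHalf n) := hf.contDiffOn.of_le (by norm_num)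
  have hη' : Continuous (fderiv ℝ η) := hη.continuous_fderiv one_ne_zero
  have hfE := hf.locEnergy ha
  have hlim := (hf.tendsto_integral_lift' (q := fun z => η z * k z) (hη.continuous.continuousOn.mul hkc)
    (R := R) fun z hz => by simp [hR z hz]).neg
  have hint : Integrable (fun z => η z * fderiv ℝ k z (gradient f z) +
      k z * fderiv ℝ η z (gradient f z)) (wt n a) := by
    refine integrable_of_integrableOn_closedBall (R := R) (Integrable.add ?_
      (integrableOn_mul_fderiv_gradient ha hf1 hfE hkc hη R)) fun z hz => by simp [hR z hz, hR' z hz]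
    exact (integrableOn_fderiv_gradient hf1 hk hfE hkE R).continuousOn_mul_of_subset
      hη.continuous.continuousOn (isCompact_closedBall _ _) measurableSet_closedBall subset_rfl
  refine tendsto_nhds_unique ?_ hlim
  -- Finiteness of both energies makes the integrand itself a dominating function, since `0 ≤ lift ≤
  -- 1`.
  have : Tendsto (fun ε => ∫ z, lift ε (ht z) * (η z * fderiv ℝ k z (gradient f z) +
      k z * fderiv ℝ η z (gradient f z)) ∂(wt n a)) (𝓝[>] 0)
      (𝓝 (∫ z, (η z * fderiv ℝ k z (gradient f z) + k z * fderiv ℝ η z (gradient f z)) ∂(wt n a))) := by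
    refine tendsto_integral_filter_of_dominated_convergence _ ?_ ?_ hint.norm ?_
    · exact Eventually.of_forall fun ε =>
        ((contDiff_lift ε).continuous.comp continuous_ht).aestronglyMeasurable.mul hint.1
    · refine Eventually.of_forall fun ε => Eventually.of_forall fun z => ?_
      rw [norm_mul, Real.norm_of_nonneg (lift_nonneg _ _)]
      exact mul_le_of_le_one_left (norm_nonneg _) (lift_le_one _ _)
    · filter_upwards [ae_mem_upperHalf] with z hz
      simpa using (tendsto_lift hz).mul_const _
  refine this.congr' ?_
  filter_upwards [self_mem_nhdsWithin] with ε hε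
  exact hf.integral_lift hk hη hηc hε

end

/-! ### The weighted trace inequality; differences and dilates of Neumann solutions. -/

section

variable {n : ℕ} {a : ℝ}

lemma integrable_wt1_iff {f : ℝ → ℝ} :
    Integrable f (wt1 a) ↔ IntegrableOn (fun y => y ^ a * f y) (Ioi 0) := by
  unfold wt1
  rw [integrable_withDensity_iff_integrable_smul' (measurable_weight1 a) (by simp), IntegrableOn]
  refine integrable_congr ?_
  filter_upwards [ae_restrict_mem measurableSet_Ioi] with y hy
  simp [ENNReal.toReal_ofReal (Real.rpow_nonneg (le_of_lt hy) a)]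

/-- Fundamental theorem of calculus and Cauchy–Schwarz for `g' = τ^{-a/2} · (τ^{a/2} g')`. The first
factor has squared integral `y^{1-a} / (1 - a)`, finite because `a < 1`. -/
lemma sq_sub_le_rpow_mul_integral (ha1 : a < 1) {g g' : ℝ → ℝ} (hg : ContinuousOn g (Ici 0))
    (hd : ∀ y, 0 < y → HasDerivAt g (g' y) y) (hg' : ContinuousOn g' (Ioi 0))
    (hi : Integrable (fun y => g' y ^ 2) (wt1 a)) {y : ℝ} (hy : 0 < y) :
    (g y - g 0) ^ 2 ≤ y ^ (1 - a) / (1 - a) * ∫ τ, g' τ ^ 2 ∂(wt1 a) := by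
  have hA : IntegrableOn (fun τ : ℝ => τ ^ (-a)) (Ioc 0 y) := integrableOn_rpow_Ioc (by linarith) y
  have hB := integrable_wt1_iff.1 hi
  have hB' := hB.mono_set (Ioc_subset_Ioi_self : Ioc 0 y ⊆ Ioi 0)
  have e1 : EqOn (fun τ : ℝ => τ ^ (-a)) (fun τ => (τ ^ (-a / 2)) ^ 2) (Ioc 0 y) := fun τ hτ => by
    simp only
    rw [← Real.rpow_natCast, ← Real.rpow_mul hτ.1.le]
    norm_num
  have e2 : EqOn (fun τ : ℝ => τ ^ a * g' τ ^ 2) (fun τ => (τ ^ (a / 2) * g' τ) ^ 2) (Ioc 0 y) :=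
    fun τ hτ => by
      simp only
      rw [mul_pow, ← Real.rpow_natCast (τ ^ (a / 2)), ← Real.rpow_mul hτ.1.le]
      norm_num
  have e3 : EqOn (fun τ : ℝ => τ ^ (-a / 2) * (τ ^ (a / 2) * g' τ)) g' (Ioc 0 y) := fun τ hτ => by
    simp only
    rw [← mul_assoc, ← Real.rpow_add hτ.1, show -a / 2 + a / 2 = 0 by ring, Real.rpow_zero, one_mul]
  have c1 : ∀ b : ℝ, ContinuousOn (fun τ : ℝ => τ ^ b) (Ioc 0 y) := fun b τ hτ =>
    (Real.continuousAt_rpow_const τ b (Or.inl hτ.1.ne')).continuousWithinAt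
  have hA2 := hA.congr_fun e1 measurableSet_Ioc
  have hB2 := hB'.congr_fun e2 measurableSet_Ioc
  have hAB := integrable_mul_of_sq ((c1 (-a / 2)).aestronglyMeasurable measurableSet_Ioc)
    (((c1 (a / 2)).mul (hg'.mono Ioc_subset_Ioi_self)).aestronglyMeasurable measurableSet_Ioc) hA2 hB2
  have hcs := sq_integral_mul_le hA2 hB2 hAB
  have hg'i : IntegrableOn g' (Ioc 0 y) := IntegrableOn.congr_fun hAB e3 measurableSet_Ioc
  rw [setIntegral_congr_fun measurableSet_Ioc e3, ← setIntegral_congr_fun measurableSet_Ioc e1,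
    ← setIntegral_congr_fun measurableSet_Ioc e2, ← intervalIntegral.integral_of_le hy.le,
    ← intervalIntegral.integral_of_le hy.le,
    intervalIntegral.integral_eq_sub_of_hasDerivAt_of_le hy.le (hg.mono Icc_subset_Ici_self)
      (fun τ hτ => hd τ hτ.1) ((intervalIntegrable_iff_integrableOn_Ioc_of_le hy.le).2 hg'i),
    integral_rpow (Or.inl (by linarith)), Real.zero_rpow (by linarith), sub_zero,
    show -a + 1 = 1 - a by ring] at hcs
  refine hcs.trans (mul_le_mul_of_nonneg_left ?_ ?_)
  · rw [integral_wt1]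
    refine setIntegral_mono_set hB ?_ (Eventually.of_forall fun τ hτ => hτ.1)
    filter_upwards [ae_restrict_mem measurableSet_Ioi] with τ hτ
    exact mul_nonneg (Real.rpow_nonneg (le_of_lt hτ) _) (sq_nonneg _)
  · exact div_nonneg (Real.rpow_nonneg hy.le _) (by linarith)

lemma wt1_Iic_pos {δ : ℝ} (hδ : 0 < δ) : 0 < wt1 a (Iic δ) := by
  rw [pos_iff_ne_zero, wt1, withDensity_apply _ measurableSet_Iic,
    Measure.restrict_restrict measurableSet_Iic]
  intro h0
  rw [setLIntegral_eq_zero_iff (measurableSet_Iic.inter measurableSet_Ioi) (measurable_weight1 _)] at h0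
  have : (volume : Measure ℝ) (Iic δ ∩ Ioi 0) = 0 := by
    refine measure_mono_null (fun x hx => ?_) (ae_iff.1 h0)
    exact fun h => (ENNReal.ofReal_pos.2 (Real.rpow_pos_of_pos hx.2 a)).ne' (h hx)
  rw [inter_comm, Ioi_inter_Iic, Real.volume_Ioc] at this
  simp only [sub_zero, ENNReal.ofReal_eq_zero] at this
  linarith

lemma hasDerivAt_comp_pt {ξ : Space n → ℝ} (hξ : ContDiffOn ℝ 1 ξ (upperHalf n))
    (x : EuclideanSpace ℝ (Fin n)) {y : ℝ} (hy : 0 < y) :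
    HasDerivAt (fun y => ξ (pt x y)) (dy ξ (pt x y)) y := by
  have h1 : HasDerivAt (fun y : ℝ => (pt x y : Space n)) (pt 0 1) y := by
    have : (fun y : ℝ => (pt x y : Space n)) = fun y => pt x 0 + y • pt 0 1 :=
      funext fun y => pt_eq_add x y
    rw [this]
    simpa using ((hasDerivAt_id y).smul_const (pt 0 1 : Space n)).const_add (pt x 0)
  exact ((hξ.differentiableOn one_ne_zero).differentiableAt
    (isOpen_upperHalf.mem_nhds (pt_mem_upperHalf hy))).hasFDerivAt.comp_hasDerivAt y h1

lemma sq_dy_le (ξ : Space n → ℝ) (z : Space n) : dy ξ z ^ 2 ≤ ‖gradient ξ z‖ ^ 2 := by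
  rw [← sq_abs, norm_gradient]
  have h : ‖(pt 0 1 : Space n)‖ = 1 := by
    rw [← sq_eq_sq₀ (norm_nonneg _) zero_le_one, norm_pt_sq]; simp
  have := (fderiv ℝ ξ z).le_opNorm (pt 0 1)
  rw [h, mul_one] at this
  exact pow_le_pow_left₀ (abs_nonneg _) this 2

/-- On each vertical line `ξ(x,0)² ≤ 2 ξ(x,y)² + 2 (ξ(x,y) - ξ(x,0))²`. The last term is bounded by
the vertical energy, and the inequality is averaged over `0 < y ≤ δ` with weight `y^a`. -/
lemma integral_trace_sq_le (ha : -1 < a) (ha1 : a < 1) {δ : ℝ} (hδ : 0 < δ) {ξ : Space n → ℝ} {R : ℝ}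
    (hξ : ContDiffOn ℝ 1 ξ (upperHalf n)) (hξc : ContinuousOn ξ (closedUpperHalf n))
    (hR : ∀ z, R < ‖z‖ → ξ z = 0) (hE : Integrable (fun z => ‖gradient ξ z‖ ^ 2) (wt n a)) :
    ∫ x, ξ (pt x 0) ^ 2 ≤ 2 / (wt1 a).real (Iic δ) * ∫ z, ξ z ^ 2 ∂(wt n a) +
      2 * (δ ^ (1 - a) / (1 - a)) * ∫ z, ‖gradient ξ z‖ ^ 2 ∂(wt n a) := by
  set m := (wt1 a).real (Iic δ) with hm
  set c := δ ^ (1 - a) / (1 - a) with hc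
  have hc0 : 0 ≤ c := div_nonneg (Real.rpow_nonneg hδ.le _) (by linarith)
  have hm0 : 0 < m := ENNReal.toReal_pos (wt1_Iic_pos hδ).ne' (wt1_Iic_lt_top ha δ).ne
  have hξ2 : Integrable (fun z => ξ z ^ 2) (wt n a) := integrable_of_integrableOn_closedBall
    (integrableOn_wt_of_continuousOn ha (hξc.pow 2) R) fun z hz => by simp [hR z hz]
  have hdyc : ContinuousOn (dy ξ) (upperHalf n) :=
    (hξ.continuousOn_fderiv_of_isOpen isOpen_upperHalf le_rfl).clm_apply continuousOn_const
  have hdy : Integrable (fun z => dy ξ z ^ 2) (wt n a) := by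
    refine hE.mono' (aestronglyMeasurable_wt (hdyc.pow 2)) (Eventually.of_forall fun z => ?_)
    rw [Real.norm_of_nonneg (sq_nonneg _)]
    exact sq_dy_le ξ z
  have p1 : Integrable (fun p : EuclideanSpace ℝ (Fin n) × ℝ => ξ (pt p.1 p.2) ^ 2)
      (volume.prod (wt1 a)) := (measurePreserving_pt_wt.integrable_comp_emb measurableEmbedding_pt).2 hξ2
  have p2 : Integrable (fun p : EuclideanSpace ℝ (Fin n) × ℝ => dy ξ (pt p.1 p.2) ^ 2)
      (volume.prod (wt1 a)) := (measurePreserving_pt_wt.integrable_comp_emb measurableEmbedding_pt).2 hdy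
  have pw : ∀ᵐ x, ξ (pt x 0) ^ 2 ≤ 2 / m * ∫ y, ξ (pt x y) ^ 2 ∂(wt1 a) +
      2 * c * ∫ y, dy ξ (pt x y) ^ 2 ∂(wt1 a) := by
    filter_upwards [p1.prod_right_ae, p2.prod_right_ae] with x h1 h2
    set B := ∫ y, dy ξ (pt x y) ^ 2 ∂(wt1 a) with hB
    have hB0 : 0 ≤ B := integral_nonneg fun y => sq_nonneg _
    have h3 : ∀ y, 0 < y → y ≤ δ → ξ (pt x 0) ^ 2 ≤ 2 * ξ (pt x y) ^ 2 + 2 * c * B := by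
      intro y hy hyδ
      have := sq_sub_le_rpow_mul_integral ha1 (g := fun y => ξ (pt x y)) (g' := fun y => dy ξ (pt x y))
        (hξc.comp (continuous_pt_right x).continuousOn fun y hy => pt_mem_closedUpperHalf hy)
        (fun y hy => hasDerivAt_comp_pt hξ x hy)
        (hdyc.comp (continuous_pt_right x).continuousOn fun y hy => pt_mem_upperHalf hy) h2 hy
      have h4 : y ^ (1 - a) / (1 - a) * B ≤ c * B := by
        refine mul_le_mul_of_nonneg_right ?_ hB0
        exact div_le_div_of_nonneg_right (Real.rpow_le_rpow hy.le hyδ (by linarith)) (by linarith)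
      nlinarith [sq_nonneg (2 * ξ (pt x y) - ξ (pt x 0))]
    have h5 : ∫ y in Iic δ, ξ (pt x 0) ^ 2 ∂(wt1 a) ≤
        ∫ y in Iic δ, (2 * ξ (pt x y) ^ 2 + 2 * c * B) ∂(wt1 a) := by
      refine integral_mono_ae (integrableOn_const (wt1_Iic_lt_top ha δ).ne)
        ((h1.const_mul 2).integrableOn.add (integrableOn_const (wt1_Iic_lt_top ha δ).ne)) ?_
      filter_upwards [ae_restrict_mem measurableSet_Iic, ae_restrict_of_ae ae_wt1_pos] with y hy hy0
      exact h3 y hy0 hy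
    rw [integral_add (h1.const_mul 2).integrableOn (integrableOn_const (wt1_Iic_lt_top ha δ).ne),
      setIntegral_const, setIntegral_const, integral_const_mul, smul_eq_mul, smul_eq_mul, ← hm] at h5
    have h6 : ∫ y in Iic δ, ξ (pt x y) ^ 2 ∂(wt1 a) ≤ ∫ y, ξ (pt x y) ^ 2 ∂(wt1 a) :=
      setIntegral_le_integral h1 (Eventually.of_forall fun y => sq_nonneg _)
    have h7 : 2 / m * ∫ y, ξ (pt x y) ^ 2 ∂(wt1 a) =
        (2 * ∫ y, ξ (pt x y) ^ 2 ∂(wt1 a)) / m := by ring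
    rw [h7, ← sub_le_iff_le_add, le_div_iff₀ hm0]
    nlinarith
  have q1 := p1.integral_prod_left
  have q2 := p2.integral_prod_left
  have hbd : Integrable (fun x => ξ (pt x 0) ^ 2) := by
    refine Continuous.integrable_of_hasCompactSupport ((continuousOn_comp_pt hξc).pow 2) ?_
    refine HasCompactSupport.of_support_subset_isCompact (isCompact_closedBall 0 R) fun x hx => ?_
    by_contra h
    rw [mem_closedBall_zero_iff, not_le, ← norm_pt_zero_right] at h
    exact hx (by simp [hR _ h])
  have hi : Integrable (fun x => 2 / m * ∫ y, ξ (pt x y) ^ 2 ∂(wt1 a) +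
      2 * c * ∫ y, dy ξ (pt x y) ^ 2 ∂(wt1 a)) := (q1.const_mul (2 / m)).add (q2.const_mul (2 * c))
  have := integral_mono_ae hbd hi pw
  rw [integral_add (q1.const_mul (2 / m)) (q2.const_mul (2 * c)), integral_const_mul,
    integral_const_mul] at this
  have r1 : ∫ x, ∫ y, ξ (pt x y) ^ 2 ∂(wt1 a) = ∫ z, ξ z ^ 2 ∂(wt n a) := by
    rw [integral_wt_eq_prod]; exact (integral_prod _ p1).symm
  have r2 : ∫ x, ∫ y, dy ξ (pt x y) ^ 2 ∂(wt1 a) = ∫ z, dy ξ z ^ 2 ∂(wt n a) := by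
    rw [integral_wt_eq_prod]; exact (integral_prod _ p2).symm
  have r3 : ∫ z, dy ξ z ^ 2 ∂(wt n a) ≤ ∫ z, ‖gradient ξ z‖ ^ 2 ∂(wt n a) :=
    integral_mono hdy hE fun z => sq_dy_le ξ z
  rw [r1, r2] at this
  exact this.trans (by gcongr)

/-- The trace inequality with a small constant in front of the energy. -/
lemma exists_trace_const (n : ℕ) (ha : -1 < a) (ha1 : a < 1) {ε : ℝ} (hε : 0 < ε) :
    ∃ C, 0 ≤ C ∧ ∀ (ξ : Space n → ℝ) (R : ℝ), ContDiffOn ℝ 1 ξ (upperHalf n) →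
      ContinuousOn ξ (closedUpperHalf n) → (∀ z, R < ‖z‖ → ξ z = 0) →
      Integrable (fun z => ‖gradient ξ z‖ ^ 2) (wt n a) →
      ∫ x, ξ (pt x 0) ^ 2 ≤ C * ∫ z, ξ z ^ 2 ∂(wt n a) + ε * ∫ z, ‖gradient ξ z‖ ^ 2 ∂(wt n a) := by
  have h1 : 0 < 1 - a := by linarith
  -- With `δ = b^{1/(1-a)}` the energy constant `2 δ^{1-a} / (1 - a)` is exactly `ε`.
  set b := ε * (1 - a) / 2 with hb
  have hb0 : 0 < b := by positivity
  have hδ : 0 < b ^ (1 / (1 - a)) := Real.rpow_pos_of_pos hb0 _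
  refine ⟨2 / (wt1 a).real (Iic (b ^ (1 / (1 - a)))), by positivity, fun ξ R h2 h3 h4 h5 => ?_⟩
  have := integral_trace_sq_le ha ha1 hδ h2 h3 h4 h5
  rw [← Real.rpow_mul hb0.le, one_div_mul_cancel h1.ne', Real.rpow_one] at this
  have e : 2 * (b / (1 - a)) = ε := by rw [hb]; field_simp
  rwa [e] at this

lemma gradient_sub_of_mem {f k : Space n → ℝ} (hf : ContDiffOn ℝ 1 f (upperHalf n))
    (hk : ContDiffOn ℝ 1 k (upperHalf n)) {z : Space n} (hz : z ∈ upperHalf n) :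
    gradient (fun w => f w - k w) z = gradient f z - gradient k z := by
  have h1 := (hf.differentiableOn one_ne_zero).differentiableAt (isOpen_upperHalf.mem_nhds hz)
  have h2 := (hk.differentiableOn one_ne_zero).differentiableAt (isOpen_upperHalf.mem_nhds hz)
  unfold gradient
  rw [fderiv_fun_sub h1 h2, map_sub]

lemma dy_sub_of_mem {f k : Space n → ℝ} (hf : ContDiffOn ℝ 1 f (upperHalf n))
    (hk : ContDiffOn ℝ 1 k (upperHalf n)) {z : Space n} (hz : z ∈ upperHalf n) :
    dy (fun w => f w - k w) z = dy f z - dy k z := by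
  rw [← ht_gradient, gradient_sub_of_mem hf hk hz, ← ht_gradient, ← ht_gradient]
  simp [ht]

lemma IsNeumann.sub {f₁ f₂ : Space n → ℝ} {g₁ g₂} (h₁ : IsNeumann a f₁ g₁) (h₂ : IsNeumann a f₂ g₂) :
    IsNeumann a (fun z => f₁ z - f₂ z) (fun x => g₁ x - g₂ x) where
  contDiffOn := h₁.contDiffOn.sub h₂.contDiffOn
  continuousOn := h₁.continuousOn.sub h₂.continuousOn
  eq_zero z hz := by
    have c₁ : ContDiffOn ℝ 1 f₁ (upperHalf n) := h₁.contDiffOn.of_le (by norm_num)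
    have c₂ : ContDiffOn ℝ 1 f₂ (upperHalf n) := h₂.contDiffOn.of_le (by norm_num)
    have hX : ∀ {f : Space n → ℝ} {g}, IsNeumann a f g →
        DifferentiableAt ℝ (fun w => ht w ^ a • gradient f w) z := fun h =>
      (((contDiffOn_ht_rpow a).smul (contDiffOn_gradient (m := 1)
        (by exact_mod_cast h.contDiffOn))).differentiableOn one_ne_zero).differentiableAt
        (isOpen_upperHalf.mem_nhds hz)
    have e : (fun w => ht w ^ a • gradient (fun z => f₁ z - f₂ z) w) =ᶠ[𝓝 z]
        fun w => ht w ^ a • gradient f₁ w - ht w ^ a • gradient f₂ w := by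
      filter_upwards [isOpen_upperHalf.mem_nhds hz] with w hw
      rw [gradient_sub_of_mem c₁ c₂ hw, smul_sub]
    have e₁ := h₁.eq_zero z hz
    have e₂ := h₂.eq_zero z hz
    unfold La divergence at e₁ e₂ ⊢
    rw [e.fderiv_eq, fderiv_fun_sub (hX h₁) (hX h₂)]
    simp [e₁, e₂]
  boundary := by
    have c₁ : ContDiffOn ℝ 1 f₁ (upperHalf n) := h₁.contDiffOn.of_le (by norm_num)
    have c₂ : ContDiffOn ℝ 1 f₂ (upperHalf n) := h₂.contDiffOn.of_le (by norm_num)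
    have b₁ := h₁.boundary
    have b₂ := h₂.boundary
    unfold HasWeightedNormalDeriv at *
    rw [Metric.tendstoLocallyUniformly_iff] at *
    intro ε hε x
    obtain ⟨t₁, ht₁, e₁⟩ := b₁ (ε / 2) (half_pos hε) x
    obtain ⟨t₂, ht₂, e₂⟩ := b₂ (ε / 2) (half_pos hε) x
    refine ⟨t₁ ∩ t₂, inter_mem ht₁ ht₂, ?_⟩
    filter_upwards [e₁, e₂, self_mem_nhdsWithin] with y hy₁ hy₂ hy w hw
    have i₁ := hy₁ w hw.1
    have i₂ := hy₂ w hw.2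
    rw [dy_sub_of_mem c₁ c₂ (pt_mem_upperHalf hy), mul_sub]
    exact (dist_sub_sub_le _ _ _ _).trans_lt (by linarith)
  continuous_boundary := h₁.continuous_boundary.sub h₂.continuous_boundary

lemma gradient_comp_smul (f : Space n → ℝ) (c : ℝ) (z : Space n) :
    gradient (fun w => f (c • w)) z = c • gradient f (c • z) := by
  unfold gradient
  rw [fderiv_comp_smul]
  simp

lemma contDiffOn_comp_smul {m : WithTop ℕ∞} {f : Space n → ℝ} (hf : ContDiffOn ℝ m f (upperHalf n))
    {c : ℝ} (hc : 0 < c) : ContDiffOn ℝ m (fun w => f (c • w)) (upperHalf n) :=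
  hf.comp (contDiff_const_smul c).contDiffOn fun _ hz => smul_mem_upperHalf hc hz

lemma continuousOn_comp_smul {f : Space n → ℝ} (hf : ContinuousOn f (closedUpperHalf n))
    {c : ℝ} (hc : 0 < c) : ContinuousOn (fun w => f (c • w)) (closedUpperHalf n) :=
  hf.comp (continuous_const_smul c).continuousOn fun _ hz => smul_mem_closedUpperHalf hc.le hz

/-- In `y^a ∂_y`, the chain rule gives a factor `c` and rewriting `y^a` as `c^{-a} (cy)^a` a factor
`c^{-a}`; hence the power `1 - a` in the Neumann datum. -/
lemma IsNeumann.dilate {f : Space n → ℝ} {g} (h : IsNeumann a f g) {c : ℝ} (hc : 0 < c) :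
    IsNeumann a (fun z => f (c • z)) (fun x => c ^ (1 - a) * g (c • x)) where
  contDiffOn := contDiffOn_comp_smul h.contDiffOn hc
  continuousOn := continuousOn_comp_smul h.continuousOn hc
  eq_zero z hz := by
    have e : (fun w => ht w ^ a • gradient (fun z => f (c • z)) w) =ᶠ[𝓝 z]
        fun w => c ^ (1 - a) • (fun w => ht w ^ a • gradient f w) (c • w) := by
      filter_upwards [isOpen_upperHalf.mem_nhds hz] with w hw
      rw [gradient_comp_smul, ht_smul, Real.mul_rpow hc.le (le_of_lt hw), smul_smul, smul_smul,
        ← mul_assoc, ← Real.rpow_add hc]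
      simp [mul_comm]
    have hX : DifferentiableAt ℝ (fun w => ht w ^ a • gradient f w) (c • z) :=
      (((contDiffOn_ht_rpow a).smul (contDiffOn_gradient (m := 1)
        (by exact_mod_cast h.contDiffOn))).differentiableOn one_ne_zero).differentiableAt
        (isOpen_upperHalf.mem_nhds (smul_mem_upperHalf hc hz))
    have e₁ := h.eq_zero (c • z) (smul_mem_upperHalf hc hz)
    have hX' : DifferentiableAt ℝ (fun w => (fun w => ht w ^ a • gradient f w) (c • w)) z :=
      hX.comp z (differentiable_id.const_smul c).differentiableAt
    unfold La divergence at e₁ ⊢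
    rw [e.fderiv_eq, fderiv_fun_const_smul hX',
      fderiv_comp_smul (f := fun w => ht w ^ a • gradient f w)]
    simp [e₁]
  boundary := by
    have b := h.boundary
    unfold HasWeightedNormalDeriv at *
    rw [Metric.tendstoLocallyUniformly_iff] at *
    intro ε hε x
    have hp : 0 < c ^ (1 - a) := Real.rpow_pos_of_pos hc _
    obtain ⟨t, ht', e⟩ := b (ε / c ^ (1 - a)) (by positivity) (c • x)
    refine ⟨(c • ·) ⁻¹' t, (continuous_const_smul c).continuousAt.preimage_mem_nhds ht', ?_⟩
    have hφ : Tendsto (fun y : ℝ => c * y) (𝓝[>] 0) (𝓝[>] 0) := by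
      refine tendsto_nhdsWithin_iff.2 ⟨?_, ?_⟩
      · exact ((continuous_const.mul continuous_id).tendsto' 0 0 (by simp)).mono_left nhdsWithin_le_nhds
      · filter_upwards [self_mem_nhdsWithin] with y hy using mul_pos hc hy
    filter_upwards [hφ.eventually e, self_mem_nhdsWithin] with y hy (hy0 : 0 < y) w hw
    have e1 : y ^ a * dy (fun z => f (c • z)) (pt w y) =
        c ^ (1 - a) * ((c * y) ^ a * dy f (pt (c • w) (c * y))) := by
      rw [← ht_gradient, gradient_comp_smul, ht_smul, ht_gradient, smul_pt, Real.mul_rpow hc.le hy0.le]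
      have : c ^ (1 - a) * c ^ a = c := by rw [← Real.rpow_add hc]; simp
      calc _ = c * (y ^ a * dy f (pt (c • w) (c * y))) := by ring
        _ = (c ^ (1 - a) * c ^ a) * (y ^ a * dy f (pt (c • w) (c * y))) := by rw [this]
        _ = _ := by ring
    rw [e1, dist_eq_norm, ← mul_sub, norm_mul, Real.norm_of_nonneg hp.le, ← dist_eq_norm,
      ← lt_div_iff₀' hp]
    exact hy _ hw
  continuous_boundary := continuous_const.mul (h.continuous_boundary.comp (continuous_const_smul c))

end

/-! ### Increments under dilation: the bulk estimate and the trace estimate. -/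

section

variable {n : ℕ} {a : ℝ}

/-- The change of variables costs the factor `c^{-(n+1+a)}`, which is at most `1` because `c ≥ 1`
and `n + 1 + a > 0`. -/
lemma lintegral_wt_comp_smul_le (ha : -1 < a) {c : ℝ} (hc : 1 ≤ c) (F : Space n → ENNReal) :
    ∫⁻ z, F (c • z) ∂(wt n a) ≤ ∫⁻ z, F z ∂(wt n a) := by
  have hc0 : 0 < c := by linarith
  set Φ : Space n → ENNReal := (upperHalf n).indicator fun z => ENNReal.ofReal (ht z ^ a) * F z with hΦ
  have e1 : ∀ z, Φ (c • z) = ENNReal.ofReal (c ^ a) *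
      (upperHalf n).indicator (fun z => ENNReal.ofReal (ht z ^ a) * F (c • z)) z := fun z => by
    by_cases hz : z ∈ upperHalf n
    · rw [hΦ, indicator_of_mem (smul_mem_upperHalf hc0 hz), indicator_of_mem hz, ht_smul,
        Real.mul_rpow hc0.le (le_of_lt hz), ENNReal.ofReal_mul (Real.rpow_nonneg hc0.le _), mul_assoc]
    · have : c • z ∉ upperHalf n := by
        simpa [upperHalf, mul_pos_iff_of_pos_left hc0] using hz
      rw [hΦ, indicator_of_notMem this, indicator_of_notMem hz, mul_zero]
  have e2 : ∫⁻ z, Φ (c • z) = ENNReal.ofReal ((c ^ (n + 1))⁻¹) * ∫⁻ z, Φ z := by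
    have h1 := (Homeomorph.smulOfNeZero c hc0.ne').measurableEmbedding.lintegral_map
      (μ := (volume : Measure (Space n))) Φ
    have h2 := Measure.map_addHaar_smul (volume : Measure (Space n)) hc0.ne'
    rw [finrank_euclideanSpace_fin, abs_of_pos (by positivity)] at h2
    change ∫⁻ z, Φ z ∂(Measure.map (c • ·) volume) = ∫⁻ z, Φ (c • z) at h1
    rw [h2, lintegral_smul_measure, smul_eq_mul] at h1
    exact h1.symm
  have e3 : ENNReal.ofReal (c ^ a) * ∫⁻ z, F (c • z) ∂(wt n a) =
      ENNReal.ofReal ((c ^ (n + 1))⁻¹) * ∫⁻ z, F z ∂(wt n a) := by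
    rw [lintegral_wt, lintegral_wt, ← lintegral_indicator measurableSet_upperHalf,
      ← lintegral_indicator measurableSet_upperHalf, ← e2, ← lintegral_const_mul' _ _ ENNReal.ofReal_ne_top]
    exact lintegral_congr fun z => (e1 z).symm
  have e4 : c ^ (-a) * c ^ a = 1 := by rw [← Real.rpow_add hc0]; simp
  calc ∫⁻ z, F (c • z) ∂(wt n a)
      = ENNReal.ofReal (c ^ (-a)) * (ENNReal.ofReal (c ^ a) * ∫⁻ z, F (c • z) ∂(wt n a)) := by
        rw [← mul_assoc, ← ENNReal.ofReal_mul (Real.rpow_nonneg hc0.le _), e4, ENNReal.ofReal_one, one_mul]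
    _ = ENNReal.ofReal (c ^ (-a) * (c ^ (n + 1))⁻¹) * ∫⁻ z, F z ∂(wt n a) := by
        rw [e3, ← mul_assoc, ← ENNReal.ofReal_mul (Real.rpow_nonneg hc0.le _)]
    _ ≤ 1 * ∫⁻ z, F z ∂(wt n a) := by
        gcongr
        rw [ENNReal.ofReal_le_one, ← div_eq_mul_inv, div_le_one (by positivity), ← Real.rpow_natCast]
        refine Real.rpow_le_rpow_of_exponent_le hc ?_
        push_cast
        have : (0 : ℝ) ≤ n := n.cast_nonneg
        linarith
    _ = _ := one_mul _

/-- The radial derivative `z · ∇f(z)`. -/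
def rad (f : Space n → ℝ) (z : Space n) : ℝ := fderiv ℝ f z z

lemma continuousOn_rad {f : Space n → ℝ} (hf : ContDiffOn ℝ 1 f (upperHalf n)) :
    ContinuousOn (rad f) (upperHalf n) :=
  (hf.continuousOn_fderiv_of_isOpen isOpen_upperHalf le_rfl).clm_apply continuousOn_id

lemma sq_rad_le (f : Space n → ℝ) (z : Space n) : rad f z ^ 2 ≤ ‖z‖ ^ 2 * ‖gradient f z‖ ^ 2 := by
  rw [← sq_abs, norm_gradient, ← mul_pow, mul_comm]
  exact pow_le_pow_left₀ (abs_nonneg _) ((fderiv ℝ f z).le_opNorm z) 2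

lemma hasDerivAt_exp_smul {f : Space n → ℝ} (hf : ContDiffOn ℝ 1 f (upperHalf n)) {z : Space n}
    (hz : z ∈ upperHalf n) (t : ℝ) :
    HasDerivAt (fun t => f (Real.exp t • z)) (rad f (Real.exp t • z)) t := by
  have h1 : HasDerivAt (fun t => Real.exp t • z) (Real.exp t • z) t :=
    (Real.hasDerivAt_exp t).smul_const z
  exact ((hf.differentiableOn one_ne_zero).differentiableAt (isOpen_upperHalf.mem_nhds
    (smul_mem_upperHalf (Real.exp_pos t) hz))).hasFDerivAt.comp_hasDerivAt t h1

lemma sq_sub_le_mul_integral {F F' : ℝ → ℝ} (hF : ∀ t, HasDerivAt F (F' t) t) (hF' : Continuous F')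
    {s t : ℝ} (hst : s ≤ t) :
    (F t - F s) ^ 2 ≤ (t - s) * ∫ τ in Ioc s t, F' τ ^ 2 := by
  have i1 : IntegrableOn (fun τ => F' τ ^ 2) (Ioc s t) := (hF'.pow 2).integrableOn_Ioc
  have i2 : IntegrableOn (fun _ : ℝ => (1 : ℝ) ^ 2) (Ioc s t) := continuous_const.integrableOn_Ioc
  have i3 : IntegrableOn (fun τ => 1 * F' τ) (Ioc s t) := (continuous_const.mul hF').integrableOn_Ioc
  have := sq_integral_mul_le i2 i1 i3
  simp only [one_mul, one_pow] at this
  rw [setIntegral_const, smul_eq_mul, mul_one, Real.volume_real_Ioc_of_le hst,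
    ← intervalIntegral.integral_of_le hst,
    intervalIntegral.integral_eq_sub_of_hasDerivAt (fun τ _ => hF τ) (hF'.intervalIntegrable _ _)] at this
  exact this

/-- Differences of dilates are controlled in the weighted `L²` norm by the local energy. -/
lemma exists_bulk_difference (ha : -1 < a) {f : Space n → ℝ} (hf : ContDiffOn ℝ 1 f (upperHalf n))
    (hfE : LocEnergy a f) {R : ℝ} (hR : 0 < R) :
    ∃ C, 0 ≤ C ∧ ∀ h : ℝ, 0 < h → h ≤ 1 →
      ∫ z in Metric.closedBall 0 R, (f (Real.exp h • z) - f z) ^ 2 ∂(wt n a) ≤ C * h ^ 2 := by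
  classical
  -- The larger ball contains all dilates by `e^τ`, `0 ≤ τ ≤ 1`, of the ball of radius `R`.
  set R' := Real.exp 1 * R with hR'
  have hR'0 : 0 < R' := by positivity
  -- Nothing is known about `f` below `{y = 0}`; extending by zero gives a function measurable on
  -- the whole space, as Tonelli requires.
  set G : Space n → ENNReal := (upperHalf n).indicator fun z => ENNReal.ofReal (rad f z ^ 2) with hG
  have hGm : Measurable G := by
    have : G = (upperHalf n).piecewise (fun z => ENNReal.ofReal (rad f z ^ 2)) (fun _ => 0) :=
      (piecewise_eq_indicator).symm
    rw [this]
    exact ContinuousOn.measurable_piecewise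
      (ENNReal.continuous_ofReal.comp_continuousOn ((continuousOn_rad hf).pow 2)) continuousOn_const
      measurableSet_upperHalf
  set M := ∫⁻ z in Metric.closedBall 0 R', G z ∂(wt n a) with hM
  have hMfin : M < ⊤ := by
    have h1 : M ≤ ∫⁻ z in Metric.closedBall 0 R', ENNReal.ofReal (R' ^ 2 * ‖gradient f z‖ ^ 2) ∂(wt n a) := by
      refine lintegral_mono_ae ?_
      filter_upwards [ae_restrict_mem measurableSet_closedBall] with z hz
      rw [mem_closedBall_zero_iff] at hz
      refine (indicator_le_self' (fun _ _ => zero_le) z).trans (ENNReal.ofReal_le_ofReal ?_)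
      exact (sq_rad_le f z).trans (by gcongr)
    refine h1.trans_lt ?_
    rw [← ofReal_integral_eq_lintegral_ofReal ((hfE R').const_mul _)
      (Eventually.of_forall fun z => by positivity)]
    exact ENNReal.ofReal_lt_top
  refine ⟨M.toReal, ENNReal.toReal_nonneg, fun h h0 h1 => ?_⟩
  have pw : ∀ z ∈ upperHalf n, ENNReal.ofReal ((f (Real.exp h • z) - f z) ^ 2) ≤
      ENNReal.ofReal h * ∫⁻ τ in Ioc 0 h, G (Real.exp τ • z) := by
    intro z hz
    have hc : Continuous fun t => rad f (Real.exp t • z) :=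
      (continuousOn_rad hf).comp_continuous (by fun_prop) fun t => smul_mem_upperHalf (Real.exp_pos t) hz
    have := sq_sub_le_mul_integral (hasDerivAt_exp_smul hf hz) hc h0.le
    rw [Real.exp_zero, one_smul, sub_zero] at this
    refine (ENNReal.ofReal_le_ofReal this).trans ?_
    rw [ENNReal.ofReal_mul h0.le]
    gcongr
    have hi : IntegrableOn (fun τ => rad f (Real.exp τ • z) ^ 2) (Ioc 0 h) := (hc.pow 2).integrableOn_Ioc
    rw [ofReal_integral_eq_lintegral_ofReal hi
      (Eventually.of_forall fun τ => sq_nonneg _)]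
    refine le_of_eq (lintegral_congr fun τ => ?_)
    rw [hG, indicator_of_mem (smul_mem_upperHalf (Real.exp_pos τ) hz)]
  have hGj : Measurable fun p : Space n × ℝ => G (Real.exp p.2 • p.1) :=
    hGm.comp (by fun_prop : Continuous fun p : Space n × ℝ => Real.exp p.2 • p.1).measurable
  -- One factor `h` comes from Cauchy–Schwarz along the ray, the other from the length of the
  -- interval of dilations after exchanging the integrals.
  have key : ∫⁻ z in Metric.closedBall 0 R, ENNReal.ofReal ((f (Real.exp h • z) - f z) ^ 2) ∂(wt n a) ≤
      ENNReal.ofReal h * (ENNReal.ofReal h * M) := by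
    calc ∫⁻ z in Metric.closedBall 0 R, ENNReal.ofReal ((f (Real.exp h • z) - f z) ^ 2) ∂(wt n a)
        ≤ ∫⁻ z in Metric.closedBall 0 R, ENNReal.ofReal h *
            (∫⁻ τ in Ioc 0 h, G (Real.exp τ • z)) ∂(wt n a) := by
          refine lintegral_mono_ae ?_
          filter_upwards [ae_restrict_of_ae ae_mem_upperHalf] with z hz using pw z hz
      _ = ENNReal.ofReal h * ∫⁻ τ in Ioc 0 h, ∫⁻ z in Metric.closedBall 0 R,
            G (Real.exp τ • z) ∂(wt n a) := by
          rw [lintegral_const_mul' _ _ ENNReal.ofReal_ne_top, lintegral_lintegral_swap hGj.aemeasurable]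
      _ ≤ ENNReal.ofReal h * ∫⁻ _ in Ioc 0 h, M := by
          refine mul_le_mul_right (lintegral_mono_ae ?_) _
          filter_upwards [ae_restrict_mem measurableSet_Ioc] with τ hτ
          have hτ1 : (1 : ℝ) ≤ Real.exp τ := Real.one_le_exp hτ.1.le
          have hsc := lintegral_wt_comp_smul_le ha hτ1 ((Metric.closedBall (0 : Space n) R').indicator G)
          rw [lintegral_indicator measurableSet_closedBall] at hsc
          refine le_trans ?_ hsc
          rw [← lintegral_indicator measurableSet_closedBall]
          refine lintegral_mono fun z => ?_
          by_cases hz : z ∈ Metric.closedBall (0 : Space n) R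
          · rw [indicator_of_mem hz, indicator_of_mem]
            rw [mem_closedBall_zero_iff] at hz ⊢
            rw [norm_smul, Real.norm_of_nonneg (Real.exp_pos τ).le]
            exact mul_le_mul (Real.exp_le_exp.2 (hτ.2.trans h1)) hz (norm_nonneg _) (Real.exp_pos _).le
          · rw [indicator_of_notMem hz]; exact zero_le
      _ = ENNReal.ofReal h * (ENNReal.ofReal h * M) := by
          rw [setLIntegral_const, Real.volume_Ioc, sub_zero, mul_comm M]
  have hcont : ContinuousOn (fun z => (f (Real.exp h • z) - f z) ^ 2) (upperHalf n) :=
    ((contDiffOn_comp_smul hf (Real.exp_pos h)).continuousOn.sub hf.continuousOn).pow 2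
  rw [integral_eq_lintegral_of_nonneg_ae (Eventually.of_forall fun z => sq_nonneg _)
    (aestronglyMeasurable_wt hcont).restrict]
  refine (ENNReal.toReal_mono ?_ key).trans ?_
  · exact ENNReal.mul_ne_top ENNReal.ofReal_ne_top (ENNReal.mul_ne_top ENNReal.ofReal_ne_top hMfin.ne)
  · rw [ENNReal.toReal_mul, ENNReal.toReal_mul, ENNReal.toReal_ofReal h0.le]
    exact le_of_eq (by ring)

/-- The trace and Caccioppoli inequalities combined, for solutions of the Neumann problem. -/
lemma IsNeumann.integral_trace_sq_le (ha : -1 < a) {D η : Space n → ℝ} {g} (hD : IsNeumann a D g)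
    (hη : ContDiff ℝ 1 η) (hηc : HasCompactSupport η) {R S C ε : ℝ} (hε : 0 ≤ ε) (hC : 0 ≤ C)
    (hηR : ∀ z, R < ‖z‖ → η z = 0) (hη1 : ∀ z, 0 ≤ η z ∧ η z ≤ 1)
    (hηR' : ∀ z, R < ‖z‖ → fderiv ℝ η z = 0)
    (hS : ∀ z, ‖fderiv ℝ η z‖ ^ 2 ≤ S)
    (htr : ∀ (ξ : Space n → ℝ) (R : ℝ), ContDiffOn ℝ 1 ξ (upperHalf n) →
      ContinuousOn ξ (closedUpperHalf n) → (∀ z, R < ‖z‖ → ξ z = 0) →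
      Integrable (fun z => ‖gradient ξ z‖ ^ 2) (wt n a) →
      ∫ x, ξ (pt x 0) ^ 2 ≤ C * ∫ z, ξ z ^ 2 ∂(wt n a) + ε * ∫ z, ‖gradient ξ z‖ ^ 2 ∂(wt n a)) :
    ∫ x, (η (pt x 0) * D (pt x 0)) ^ 2 ≤
      (C + 10 * ε * S) * ∫ z in Metric.closedBall 0 R, D z ^ 2 ∂(wt n a) +
        4 * ε * |∫ x, η (pt x 0) ^ 2 * D (pt x 0) * g x| := by
  have hD1 : ContDiffOn ℝ 1 D (upperHalf n) := hD.contDiffOn.of_le (by norm_num)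
  have hη' : Continuous (fderiv ℝ η) := hη.continuous_fderiv one_ne_zero
  obtain ⟨hX, hXle⟩ := hD.caccioppoli ha hη hηc
  set Y := ∫ z in Metric.closedBall 0 R, D z ^ 2 ∂(wt n a) with hY
  have hYi : IntegrableOn (fun z => D z ^ 2) (Metric.closedBall 0 R) (wt n a) :=
    integrableOn_wt_of_continuousOn ha (hD.continuousOn.pow 2) R
  have hM : Integrable (fun z => D z ^ 2 * ‖fderiv ℝ η z‖ ^ 2) (wt n a) :=
    integrable_of_integrableOn_closedBall (integrableOn_wt_of_continuousOn ha
      ((hD.continuousOn.pow 2).mul (hη'.norm.pow 2).continuousOn) R) fun z hz => by simp [hηR' z hz]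
  have hξ2 : Integrable (fun z => (η z * D z) ^ 2) (wt n a) :=
    integrable_of_integrableOn_closedBall (integrableOn_wt_of_continuousOn ha
      ((hη.continuous.continuousOn.mul hD.continuousOn).pow 2) R) fun z hz => by simp [hηR z hz]
  have hMle : ∫ z, D z ^ 2 * ‖fderiv ℝ η z‖ ^ 2 ∂(wt n a) ≤ S * Y := by
    rw [hY, ← integral_const_mul, ← integral_indicator measurableSet_closedBall]
    refine integral_mono hM ((integrable_indicator_iff measurableSet_closedBall).2
      (hYi.const_mul S)) fun z => ?_
    by_cases hz : z ∈ Metric.closedBall (0 : Space n) R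
    · rw [indicator_of_mem hz]; nlinarith [hS z, sq_nonneg (D z)]
    · rw [indicator_of_notMem hz, hηR' z (by simpa using hz)]; simp
  have hξle : ∫ z, (η z * D z) ^ 2 ∂(wt n a) ≤ Y := by
    rw [hY, ← integral_indicator measurableSet_closedBall]
    refine integral_mono hξ2 ((integrable_indicator_iff measurableSet_closedBall).2 hYi) fun z => ?_
    by_cases hz : z ∈ Metric.closedBall (0 : Space n) R
    · rw [indicator_of_mem hz]
      have := pow_le_one₀ (n := 2) (hη1 z).1 (hη1 z).2
      nlinarith [sq_nonneg (D z)]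
    · rw [indicator_of_notMem hz, hηR z (by simpa using hz)]; simp
  have hgle : ∀ z ∈ upperHalf n, ‖gradient (fun z => η z * D z) z‖ ^ 2 ≤
      2 * (η z ^ 2 * ‖gradient D z‖ ^ 2) + 2 * (D z ^ 2 * ‖fderiv ℝ η z‖ ^ 2) := fun z hz => by
    rw [norm_gradient, norm_gradient, fderiv_fun_mul (hη.differentiable one_ne_zero z)
      ((hD1.differentiableOn one_ne_zero).differentiableAt (isOpen_upperHalf.mem_nhds hz))]
    have h1 := norm_add_le (η z • fderiv ℝ D z) (D z • fderiv ℝ η z)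
    rw [norm_smul, norm_smul, Real.norm_eq_abs, Real.norm_eq_abs] at h1
    have h2 := pow_le_pow_left₀ (norm_nonneg _) h1 2
    rw [← sq_abs (η z), ← sq_abs (D z)]
    nlinarith [sq_nonneg (|η z| * ‖fderiv ℝ D z‖ - |D z| * ‖fderiv ℝ η z‖)]
  have hξ1 : ContDiffOn ℝ 1 (fun z => η z * D z) (upperHalf n) := hη.contDiffOn.mul hD1
  have hGi : Integrable (fun z => ‖gradient (fun z => η z * D z) z‖ ^ 2) (wt n a) := by
    refine ((hX.const_mul 2).add (hM.const_mul 2)).mono' (aestronglyMeasurable_wt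
      ((contDiffOn_gradient (m := 0) (by simpa using hξ1)).continuousOn.norm.pow 2)) ?_
    filter_upwards [ae_mem_upperHalf] with z hz
    rw [Real.norm_of_nonneg (sq_nonneg _)]
    exact hgle z hz
  have hGle : ∫ z, ‖gradient (fun z => η z * D z) z‖ ^ 2 ∂(wt n a) ≤
      2 * ∫ z, η z ^ 2 * ‖gradient D z‖ ^ 2 ∂(wt n a) +
        2 * ∫ z, D z ^ 2 * ‖fderiv ℝ η z‖ ^ 2 ∂(wt n a) := by
    rw [← integral_const_mul, ← integral_const_mul, ← integral_add (hX.const_mul 2) (hM.const_mul 2)]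
    exact integral_mono_ae hGi ((hX.const_mul 2).add (hM.const_mul 2)) (ae_mem_upperHalf.mono hgle)
  have h1 := htr (fun z => η z * D z) R hξ1 (hη.continuous.continuousOn.mul hD.continuousOn)
    (fun z hz => by simp [hηR z hz]) hGi
  set B := |∫ x, η (pt x 0) ^ 2 * D (pt x 0) * g x|
  -- Caccioppoli inside the product rule: `2 (4SY + 2B) + 2SY`.
  have h2 : ∫ z, ‖gradient (fun z => η z * D z) z‖ ^ 2 ∂(wt n a) ≤ 10 * S * Y + 4 * B := by linarith
  calc _ ≤ _ := h1
    _ ≤ C * Y + ε * (10 * S * Y + 4 * B) := by gcongr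
    _ = _ := by ring

end

/-! ### Lipschitz dependence of the boundary traces on the dilation. -/

section

variable {n : ℕ} {a : ℝ} {u v : Space n → ℝ}

lemma IsSolution.isNeumann_left (h : IsSolution a u v) :
    IsNeumann a u (fun x => u (pt x 0) * v (pt x 0) ^ 2) :=
  ⟨h.contDiffOn_u, h.continuousOn_u, h.eq_u, h.boundary_u,
    (continuousOn_comp_pt h.continuousOn_u).mul ((continuousOn_comp_pt h.continuousOn_v).pow 2)⟩

lemma IsSolution.symm (h : IsSolution a u v) : IsSolution a v u :=
  ⟨h.contDiffOn_v, h.contDiffOn_u, h.continuousOn_v, h.continuousOn_u, h.pos_v, h.pos_u, h.eq_v,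
    h.eq_u, h.boundary_v, h.boundary_u⟩

/-- The nonlinearity `u v²` is locally Lipschitz: the difference telescopes through changes in `p`,
in `w` and in the scaling factor `L`, which is within `O(h)` of `1`. -/
lemma abs_cubic_difference_le {p P w W M L L₁ h : ℝ} (hp : |p| ≤ M) (hw : |w| ≤ M)
    (hW : |W| ≤ M) (hL0 : 0 ≤ L) (hL : L ≤ L₁) (hL1 : |L - 1| ≤ L₁ * h) :
    |L * (P * W ^ 2) - p * w ^ 2| ≤
      L₁ * (2 * M ^ 2 + M ^ 3) * (|P - p| + |W - w| + h) := by
  have hM : 0 ≤ M := (abs_nonneg p).trans hp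
  have e : L * (P * W ^ 2) - p * w ^ 2 =
      L * ((P - p) * W ^ 2) + L * (p * ((W + w) * (W - w))) + (L - 1) * (p * w ^ 2) := by ring
  have hL0' : 0 ≤ L₁ := hL0.trans hL
  have b1 : |L * ((P - p) * W ^ 2)| ≤ L₁ * (|P - p| * M ^ 2) := by
    rw [abs_mul, abs_mul, abs_of_nonneg hL0, abs_pow]
    gcongr
  have b2 : |L * (p * ((W + w) * (W - w)))| ≤ L₁ * (M * ((M + M) * |W - w|)) := by
    rw [abs_mul, abs_mul, abs_mul, abs_of_nonneg hL0]
    have : |W + w| ≤ M + M := (abs_add_le _ _).trans (add_le_add hW hw)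
    gcongr
  have b3 : |(L - 1) * (p * w ^ 2)| ≤ L₁ * h * (M * M ^ 2) := by
    rw [abs_mul, abs_mul, abs_pow]
    have : 0 ≤ L₁ * h := (abs_nonneg _).trans hL1
    gcongr
  have hLh : 0 ≤ L₁ * h := (abs_nonneg _).trans hL1
  have n1 : 0 ≤ L₁ * (|P - p| * (M ^ 2 + M ^ 3)) := by positivity
  have n2 : 0 ≤ L₁ * (|W - w| * M ^ 3) := by positivity
  have n3 : 0 ≤ L₁ * h * (2 * M ^ 2) := by positivity
  rw [e]
  refine (abs_add_three _ _ _).trans ?_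
  nlinarith

lemma exists_abs_exp_sub_one_le (κ : ℝ) : ∃ L₁, 0 ≤ L₁ ∧ ∀ h, 0 < h → h ≤ 1 →
    Real.exp (κ * h) ≤ L₁ ∧ |Real.exp (κ * h) - 1| ≤ L₁ * h := by
  refine ⟨(|κ| + 1) * Real.exp |κ|, by positivity, fun h h0 h1 => ?_⟩
  have hk : |κ * h| ≤ |κ| := by
    rw [abs_mul, abs_of_pos h0]; exact mul_le_of_le_one_right (abs_nonneg _) h1
  have e1 : Real.exp (κ * h) ≤ Real.exp |κ| := Real.exp_le_exp.2 ((le_abs_self _).trans hk)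
  have e2 : 0 < Real.exp |κ| := Real.exp_pos _
  have e3 : 1 ≤ Real.exp |κ| := Real.one_le_exp (abs_nonneg _)
  refine ⟨by nlinarith [abs_nonneg κ, mul_nonneg (abs_nonneg κ) e2.le], ?_⟩
  have l1 : κ * h + 1 ≤ Real.exp (κ * h) := Real.add_one_le_exp _
  have l2 : -(κ * h) + 1 ≤ Real.exp (-(κ * h)) := Real.add_one_le_exp _
  have l3 : Real.exp (κ * h) * Real.exp (-(κ * h)) = 1 := by rw [← Real.exp_add]; simp
  have l4 : Real.exp (κ * h) - 1 ≤ κ * h * Real.exp (κ * h) := by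
    nlinarith [Real.exp_pos (κ * h)]
  have l5 : κ * h * Real.exp (κ * h) ≤ |κ| * h * Real.exp |κ| := by
    have : κ * h ≤ |κ| * h := mul_le_mul_of_nonneg_right (le_abs_self _) h0.le
    calc κ * h * Real.exp (κ * h) ≤ |κ| * h * Real.exp (κ * h) := by gcongr
      _ ≤ _ := by gcongr
  have l6 : -(|κ| * h) ≤ κ * h := by nlinarith [neg_abs_le κ]
  have l7 : |κ| * h ≤ |κ| * h * Real.exp |κ| := le_mul_of_one_le_right (by positivity) e3
  have l8 : 0 ≤ Real.exp |κ| * h := by positivity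
  rw [abs_le]
  constructor <;> nlinarith

lemma integrable_sq_cutoff_mul {η : Space n → ℝ} (hη : Continuous η) {R : ℝ}
    (hR : ∀ z, R < ‖z‖ → η z = 0) {q : EuclideanSpace ℝ (Fin n) → ℝ} (hq : Continuous q) :
    Integrable fun x => η (pt x 0) ^ 2 * q x := by
  refine (((hη.comp (continuous_pt_left 0)).pow 2).mul hq).integrable_of_hasCompactSupport ?_
  refine HasCompactSupport.of_support_subset_isCompact (isCompact_closedBall 0 R) fun x hx => ?_
  by_contra h
  rw [mem_closedBall_zero_iff, not_le, ← norm_pt_zero_right] at h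
  exact hx (by simp [hR _ h])

/-- This is the boundary term of Caccioppoli for the increment `D₁`. Its Neumann datum is bounded by
`|D₁| + |D₂| + h`, so the product with `D₁` is quadratic in the quantities to be estimated and can
be absorbed when multiplied by a small constant. -/
lemma abs_integral_flux_difference_le {η w₁ w₂ : Space n → ℝ} (hη : Continuous η) {R M L L₁ h : ℝ}
    (hR : ∀ z, R < ‖z‖ → η z = 0) {D₁ D₂ : EuclideanSpace ℝ (Fin n) → ℝ}
    (e₁ : ∀ x, D₁ x = w₁ (Real.exp h • pt x 0) - w₁ (pt x 0))
    (e₂ : ∀ x, D₂ x = w₂ (Real.exp h • pt x 0) - w₂ (pt x 0))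
    (c₁ : Continuous D₁) (c₂ : Continuous D₂)
    (hb : ∀ x : EuclideanSpace ℝ (Fin n), ‖x‖ ≤ R → |w₁ (pt x 0)| ≤ M ∧ |w₂ (pt x 0)| ≤ M ∧
        |w₂ (Real.exp h • pt x 0)| ≤ M)
    (hM : 0 ≤ M) (hL0 : 0 ≤ L) (hL : L ≤ L₁) (hL1 : |L - 1| ≤ L₁ * h) :
    |∫ x : EuclideanSpace ℝ (Fin n), η (pt x 0) ^ 2 * D₁ x *
        (L * (w₁ (pt (Real.exp h • x) 0) * w₂ (pt (Real.exp h • x) 0) ^ 2) -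
          w₁ (pt x 0) * w₂ (pt x 0) ^ 2)| ≤
      L₁ * (2 * M ^ 2 + M ^ 3) * (2 * (∫ x : EuclideanSpace ℝ (Fin n), (η (pt x 0) * D₁ x) ^ 2) +
        (∫ x : EuclideanSpace ℝ (Fin n), (η (pt x 0) * D₂ x) ^ 2) +
        h ^ 2 * ∫ x : EuclideanSpace ℝ (Fin n), η (pt x 0) ^ 2) := by
  set K := L₁ * (2 * M ^ 2 + M ^ 3) with hK
  have hL0' : 0 ≤ L₁ := hL0.trans hL
  have hK0 : 0 ≤ K := by positivity
  have i1 : Integrable fun x : EuclideanSpace ℝ (Fin n) => (η (pt x 0) * D₁ x) ^ 2 := by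
    simpa only [mul_pow, Pi.pow_apply] using integrable_sq_cutoff_mul hη hR (c₁.pow 2)
  have i2 : Integrable fun x : EuclideanSpace ℝ (Fin n) => (η (pt x 0) * D₂ x) ^ 2 := by
    simpa only [mul_pow, Pi.pow_apply] using integrable_sq_cutoff_mul hη hR (c₂.pow 2)
  have i3 : Integrable fun x : EuclideanSpace ℝ (Fin n) => η (pt x 0) ^ 2 := by
    simpa using integrable_sq_cutoff_mul hη hR (q := fun _ => 1) continuous_const
  have i12 := (i1.const_mul 2).add i2
  have i123 : Integrable fun x : EuclideanSpace ℝ (Fin n) => 2 * (η (pt x 0) * D₁ x) ^ 2 +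
      (η (pt x 0) * D₂ x) ^ 2 + h ^ 2 * η (pt x 0) ^ 2 := i12.add (i3.const_mul (h ^ 2))
  have e : K * (2 * (∫ x : EuclideanSpace ℝ (Fin n), (η (pt x 0) * D₁ x) ^ 2) +
        (∫ x : EuclideanSpace ℝ (Fin n), (η (pt x 0) * D₂ x) ^ 2) +
        h ^ 2 * ∫ x : EuclideanSpace ℝ (Fin n), η (pt x 0) ^ 2) =
      ∫ x : EuclideanSpace ℝ (Fin n), K * (2 * (η (pt x 0) * D₁ x) ^ 2 + (η (pt x 0) * D₂ x) ^ 2 +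
        h ^ 2 * η (pt x 0) ^ 2) := by
    have e1 := integral_add i12 (i3.const_mul (h ^ 2))
    have e2 := integral_add (i1.const_mul 2) i2
    simp only [Pi.add_apply] at e1 e2
    rw [integral_const_mul, e1, e2, integral_const_mul, integral_const_mul]
  rw [e, ← Real.norm_eq_abs]
  refine norm_integral_le_of_norm_le (i123.const_mul K) (Eventually.of_forall fun x => ?_)
  by_cases hx : ‖x‖ ≤ R
  · obtain ⟨b1, b2, b3⟩ := hb x hx
    have := abs_cubic_difference_le (P := w₁ (Real.exp h • pt x 0)) b1 b2 b3 hL0 hL hL1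
    rw [← e₁, ← e₂, ← hK] at this
    rw [show (pt (Real.exp h • x) 0 : Space n) = Real.exp h • pt x 0 by rw [smul_pt, mul_zero],
      norm_mul, norm_mul, Real.norm_of_nonneg (sq_nonneg _), Real.norm_eq_abs, Real.norm_eq_abs]
    refine (mul_le_mul_of_nonneg_left this (by positivity)).trans ?_
    have t2 : |D₁ x| * (|D₁ x| + |D₂ x| + h) ≤ 2 * D₁ x ^ 2 + D₂ x ^ 2 + h ^ 2 := by
      rw [← sq_abs (D₁ x), ← sq_abs (D₂ x)]
      nlinarith [sq_nonneg (|D₁ x| - |D₂ x|), sq_nonneg (|D₁ x| - h), sq_nonneg (|D₂ x|), sq_nonneg h]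
    have t3 : 0 ≤ K * η (pt x 0) ^ 2 := by positivity
    nlinarith [mul_le_mul_of_nonneg_left t2 t3]
  · rw [hR _ (by rw [norm_pt_zero_right]; exact not_le.1 hx)]
    simp

/-- The traces of dilates of a solution depend on the dilation in a Lipschitz way, in `L²`. -/
lemma IsSolution.exists_boundary_difference (hs : IsSolution a u v) (ha : -1 < a) (ha1 : a < 1)
    {R : ℝ} (hR : 0 < R) :
    ∃ C, 0 ≤ C ∧ ∀ h : ℝ, 0 < h → h ≤ 1 →
      ∫ x in Metric.closedBall (0 : EuclideanSpace ℝ (Fin n)) R,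
        ((u (Real.exp h • pt x 0) - u (pt x 0)) ^ 2 + (v (Real.exp h • pt x 0) - v (pt x 0)) ^ 2) ≤
      C * h ^ 2 := by
  obtain ⟨η, hη, hηc, hηone, hηR, hη1⟩ := exists_cutoff n hR
  have hη' : Continuous (fderiv ℝ η) := hη.continuous_fderiv one_ne_zero
  have hηR' : ∀ z, 2 * R < ‖z‖ → fderiv ℝ η z = 0 := fun z hz => by
    have : η =ᶠ[𝓝 z] fun _ => 0 := by
      filter_upwards [continuous_norm.continuousAt.eventually (lt_mem_nhds hz)] with w hw using hηR w hw
    rw [this.fderiv_eq]; simp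
  obtain ⟨S, hS0, hS⟩ : ∃ S, 0 ≤ S ∧ ∀ z, ‖fderiv ℝ η z‖ ^ 2 ≤ S := by
    obtain ⟨S, hS⟩ := (hηc.fderiv (𝕜 := ℝ)).exists_bound_of_continuous hη'
    exact ⟨S ^ 2, sq_nonneg _, fun z => pow_le_pow_left₀ (norm_nonneg _) (hS z) 2⟩
  have hu := hs.isNeumann_left
  have hv := hs.symm.isNeumann_left
  obtain ⟨Cu, hCu0, hCu⟩ := exists_bulk_difference ha (hu.contDiffOn.of_le (by norm_num))
    (hu.locEnergy ha) (R := 2 * R) (by positivity)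
  obtain ⟨Cv, hCv0, hCv⟩ := exists_bulk_difference ha (hv.contDiffOn.of_le (by norm_num))
    (hv.locEnergy ha) (R := 2 * R) (by positivity)
  obtain ⟨Mu, hMu0, hMu⟩ := exists_bound_closedUpperHalf hu.continuousOn (Real.exp 1 * (2 * R))
  obtain ⟨Mv, hMv0, hMv⟩ := exists_bound_closedUpperHalf hv.continuousOn (Real.exp 1 * (2 * R))
  obtain ⟨L₁, hL₁0, hL₁⟩ := exists_abs_exp_sub_one_le (1 - a)
  set M := Mu + Mv with hM
  have hM0 : 0 ≤ M := by positivity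
  set K := L₁ * (2 * M ^ 2 + M ^ 3) with hK
  have hK0 : 0 ≤ K := by positivity
  -- Adding the estimates for `u` and `v`, the traces reappear on the right with coefficient `4ε ·
  -- 3K = 12εK`; this choice keeps it at most `1/2`.
  set ε := 1 / (24 * K + 24) with hε
  have hε0 : 0 < ε := by positivity
  have hεK : 12 * ε * K ≤ 1 / 2 := by
    rw [hε, mul_one_div, div_mul_eq_mul_div, div_le_iff₀ (by positivity)]
    linarith
  obtain ⟨Ct, hCt0, hCt⟩ := exists_trace_const n ha ha1 hε0
  have hη2i := fun {q : EuclideanSpace ℝ (Fin n) → ℝ} (hq : Continuous q) =>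
    integrable_sq_cutoff_mul hη.continuous hηR hq
  set V := ∫ x : EuclideanSpace ℝ (Fin n), η (pt x 0) ^ 2 with hV
  have hV0 : 0 ≤ V := integral_nonneg fun x => sq_nonneg _
  have hVi : Integrable fun x : EuclideanSpace ℝ (Fin n) => η (pt x 0) ^ 2 := by
    simpa using hη2i (q := fun _ => 1) continuous_const
  refine ⟨2 * ((Ct + 10 * ε * S) * (Cu + Cv) + 8 * ε * K * V), by positivity, fun h h0 h1 => ?_⟩
  set Du : Space n → ℝ := fun z => u (Real.exp h • z) - u z with hDu
  set Dv : Space n → ℝ := fun z => v (Real.exp h • z) - v z with hDv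
  have hNu := (hu.dilate (Real.exp_pos h)).sub hu
  have hNv := (hv.dilate (Real.exp_pos h)).sub hv
  have hDuc : Continuous fun x : EuclideanSpace ℝ (Fin n) => Du (pt x 0) :=
    continuousOn_comp_pt hNu.continuousOn
  have hDvc : Continuous fun x : EuclideanSpace ℝ (Fin n) => Dv (pt x 0) :=
    continuousOn_comp_pt hNv.continuousOn
  set Tu := ∫ x : EuclideanSpace ℝ (Fin n), (η (pt x 0) * Du (pt x 0)) ^ 2 with hTu
  set Tv := ∫ x : EuclideanSpace ℝ (Fin n), (η (pt x 0) * Dv (pt x 0)) ^ 2 with hTv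
  have hTui : Integrable fun x : EuclideanSpace ℝ (Fin n) => (η (pt x 0) * Du (pt x 0)) ^ 2 := by
    simpa only [mul_pow, Pi.pow_apply] using hη2i (hDuc.pow 2)
  have hTvi : Integrable fun x : EuclideanSpace ℝ (Fin n) => (η (pt x 0) * Dv (pt x 0)) ^ 2 := by
    simpa only [mul_pow, Pi.pow_apply] using hη2i (hDvc.pow 2)
  have hexp : Real.exp h ≤ Real.exp 1 := Real.exp_le_exp.2 h1
  have hexp1 : 1 ≤ Real.exp 1 := Real.one_le_exp zero_le_one
  have hbound : ∀ x : EuclideanSpace ℝ (Fin n), ‖x‖ ≤ 2 * R →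
      |u (pt x 0)| ≤ M ∧ |v (pt x 0)| ≤ M ∧ |u (Real.exp h • pt x 0)| ≤ M ∧
      |v (Real.exp h • pt x 0)| ≤ M := fun x hx => by
    have m1 : (pt x 0 : Space n) ∈ closedUpperHalf n := pt_mem_closedUpperHalf le_rfl
    have m2 := smul_mem_closedUpperHalf (Real.exp_pos h).le m1
    have n1 : ‖(pt x 0 : Space n)‖ ≤ Real.exp 1 * (2 * R) := by
      rw [norm_pt_zero_right]; nlinarith
    have n2 : ‖Real.exp h • (pt x 0 : Space n)‖ ≤ Real.exp 1 * (2 * R) := by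
      rw [norm_smul, norm_pt_zero_right, Real.norm_of_nonneg (Real.exp_pos h).le]
      gcongr
    exact ⟨(hMu _ m1 n1).trans (by linarith), (hMv _ m1 n1).trans (by linarith),
      (hMu _ m2 n2).trans (by linarith), (hMv _ m2 n2).trans (by linarith)⟩
  have hpow : Real.exp h ^ (1 - a) = Real.exp ((1 - a) * h) := by rw [← Real.exp_mul, mul_comm]
  obtain ⟨hL, hL'⟩ := hL₁ h h0 h1
  have hBu := abs_integral_flux_difference_le (w₁ := u) (w₂ := v) hη.continuous hηR (fun _ => rfl)
    (fun _ => rfl) hDuc hDvc (fun x hx => ⟨(hbound x hx).1, (hbound x hx).2.1, (hbound x hx).2.2.2⟩)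
    hM0 (Real.exp_pos _).le hL hL'
  have hBv := abs_integral_flux_difference_le (w₁ := v) (w₂ := u) hη.continuous hηR (fun _ => rfl)
    (fun _ => rfl) hDvc hDuc (fun x hx => ⟨(hbound x hx).2.1, (hbound x hx).1, (hbound x hx).2.2.1⟩)
    hM0 (Real.exp_pos _).le hL hL'
  rw [← hpow] at hBu hBv
  have hTu' := hNu.integral_trace_sq_le ha hη hηc hε0.le hCt0 hηR hη1 hηR' hS hCt
  have hTv' := hNv.integral_trace_sq_le ha hη hηc hε0.le hCt0 hηR hη1 hηR' hS hCt
  have hYu := hCu h h0 h1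
  have hYv := hCv h h0 h1
  set A := Ct + 10 * ε * S with hA
  have hA0 : 0 ≤ A := by positivity
  -- The two inequalities are coupled through `Tu` and `Tv`; neither closes alone, their sum does.
  have s1 : Tu ≤ A * (Cu * h ^ 2) + 4 * ε * (K * (2 * Tu + Tv + h ^ 2 * V)) :=
    hTu'.trans (add_le_add (mul_le_mul_of_nonneg_left hYu hA0)
      (mul_le_mul_of_nonneg_left hBu (by positivity)))
  have s2 : Tv ≤ A * (Cv * h ^ 2) + 4 * ε * (K * (2 * Tv + Tu + h ^ 2 * V)) :=
    hTv'.trans (add_le_add (mul_le_mul_of_nonneg_left hYv hA0)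
      (mul_le_mul_of_nonneg_left hBv (by positivity)))
  have hT0 : 0 ≤ Tu + Tv := add_nonneg (integral_nonneg fun x => sq_nonneg _)
    (integral_nonneg fun x => sq_nonneg _)
  have s3 : Tu + Tv ≤ 2 * (A * (Cu + Cv) + 8 * ε * K * V) * h ^ 2 := by
    have s4 := mul_le_mul_of_nonneg_right hεK hT0
    have s6 : Tu + Tv ≤ A * (Cu + Cv) * h ^ 2 + 12 * ε * K * (Tu + Tv) + 8 * ε * K * V * h ^ 2 :=
      (add_le_add s1 s2).trans (le_of_eq (by ring))
    have s7 : 2 * (A * (Cu + Cv) + 8 * ε * K * V) * h ^ 2 =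
      2 * (A * (Cu + Cv) * h ^ 2 + 8 * ε * K * V * h ^ 2) := by ring
    rw [s7]
    linarith
  have s5 : ∫ x in Metric.closedBall (0 : EuclideanSpace ℝ (Fin n)) R,
      (Du (pt x 0) ^ 2 + Dv (pt x 0) ^ 2) ≤ Tu + Tv := by
    rw [hTu, hTv, ← integral_add hTui hTvi]
    refine le_trans (le_of_eq (setIntegral_congr_fun measurableSet_closedBall fun x hx => ?_))
      (setIntegral_le_integral (s := Metric.closedBall 0 R) (hTui.add hTvi)
        (Eventually.of_forall fun x => ?_))
    · rw [mem_closedBall_zero_iff, ← norm_pt_zero_right] at hx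
      simp [hηone _ hx]
    · exact add_nonneg (sq_nonneg _) (sq_nonneg _)
  exact s5.trans s3

end

/-! ### Radial test functions, integrals over balls, and integration in polar coordinates. -/

section

variable {n : ℕ} {a : ℝ}

/-- The radial profile `r ↦ ∫_T^{log r} ψ`, made constant near `r = 0`. -/
def profile (ψ : ℝ → ℝ) (T r : ℝ) : ℝ := ∫ s in T..Real.log (max r (Real.exp (-T - 1))), ψ s

section Profile

variable {ψ : ℝ → ℝ} {T : ℝ}

lemma integrable_of_eq_zero (hψ : Continuous ψ) (h0 : ∀ t, T < |t| → ψ t = 0) : Integrable ψ := by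
  refine hψ.integrable_of_hasCompactSupport
    (HasCompactSupport.of_support_subset_isCompact (isCompact_Icc (a := -T) (b := T)) fun t ht => ?_)
  exact abs_le.1 (not_lt.1 fun h => ht (h0 t h))

/-- Layer-cake form: the radial profile is a superposition of indicators of balls. It is what
converts an integral against the profile into integrals over balls. -/
lemma profile_eq (hψ : Continuous ψ) (h0 : ∀ t, T < |t| → ψ t = 0) (r : ℝ) :
    profile ψ T r = -∫ t, if r < Real.exp t then ψ t else 0 := by
  have hi := integrable_of_eq_zero hψ h0
  set τ := Real.log (max r (Real.exp (-T - 1))) with hτ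
  have hpos : 0 < max r (Real.exp (-T - 1)) := lt_max_of_lt_right (Real.exp_pos _)
  have e1 : ∫ t in Iic T, ψ t = ∫ t, ψ t := by
    refine setIntegral_eq_integral_of_forall_compl_eq_zero fun t ht => h0 t ?_
    exact lt_of_lt_of_le (not_le.1 ht) (le_abs_self t)
  have e2 : (fun t => if r < Real.exp t then ψ t else 0) = (Ioi τ).indicator ψ := by
    funext t
    by_cases ht : T < |t|
    · simp [h0 t ht, indicator]
    · have h1 := (abs_le.1 (not_lt.1 ht)).1
      have h2 : r < Real.exp t ↔ τ < t := by
        rw [hτ, Real.log_lt_iff_lt_exp hpos, max_lt_iff]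
        exact ⟨fun h => ⟨h, Real.exp_lt_exp.2 (by linarith)⟩, fun h => h.1⟩
      simp [indicator, h2]
  rw [profile, ← hτ, e2, integral_indicator measurableSet_Ioi,
    ← intervalIntegral.integral_Iic_sub_Iic hi.integrableOn hi.integrableOn, e1,
    ← intervalIntegral.integral_Iic_add_Ioi (b := τ) hi.integrableOn hi.integrableOn]
  ring

lemma profile_eq_zero (h0 : ∀ t, T < |t| → ψ t = 0) {r : ℝ} (hr : Real.exp T < r) :
    profile ψ T r = 0 := by
  unfold profile
  have h1 : T ≤ Real.log (max r (Real.exp (-T - 1))) := by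
    rw [Real.le_log_iff_exp_le (lt_max_of_lt_right (Real.exp_pos _))]
    exact hr.le.trans (le_max_left _ _)
  rw [intervalIntegral.integral_of_le h1]
  exact setIntegral_eq_zero_of_forall_eq_zero fun t ht => h0 t (ht.1.trans_le (le_abs_self t))

lemma profile_eq_of_lt {r : ℝ} (hr : Real.exp (-T - 1) < r) :
    profile ψ T r = ∫ s in T..Real.log r, ψ s := by
  rw [profile, max_eq_left hr.le]

lemma profile_eq_const (hψ : Continuous ψ) (h0 : ∀ t, T < |t| → ψ t = 0) {r : ℝ}
    (hr : r < Real.exp (-T)) : profile ψ T r = ∫ s in T..(-T), ψ s := by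
  unfold profile
  rw [← intervalIntegral.integral_add_adjacent_intervals (hψ.intervalIntegrable T (-T))
    (hψ.intervalIntegrable _ _), add_eq_left]
  have h1 : Real.log (max r (Real.exp (-T - 1))) ≤ -T := by
    rw [Real.log_le_iff_le_exp (lt_max_of_lt_right (Real.exp_pos _))]
    exact max_le hr.le (Real.exp_le_exp.2 (by linarith))
  rw [intervalIntegral.integral_symm, intervalIntegral.integral_of_le h1, neg_eq_zero,
    integral_Ioc_eq_integral_Ioo]
  exact setIntegral_eq_zero_of_forall_eq_zero fun t ht => h0 t (by
    have := neg_le_abs t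
    linarith [ht.2])

lemma contDiff_primitive (hψ : Continuous ψ) : ContDiff ℝ 1 fun τ => ∫ s in T..τ, ψ s := by
  have h : ∀ τ, HasDerivAt (fun τ => ∫ s in T..τ, ψ s) (ψ τ) τ := fun τ =>
    (hψ.integral_hasStrictDerivAt T τ).hasDerivAt
  refine contDiff_one_iff_deriv.2 ⟨fun τ => (h τ).differentiableAt, ?_⟩
  rwa [show deriv (fun τ => ∫ s in T..τ, ψ s) = ψ from funext fun τ => (h τ).deriv]

lemma contDiff_profile (hψ : Continuous ψ) (h0 : ∀ t, T < |t| → ψ t = 0) :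
    ContDiff ℝ 1 fun z : Space n => profile ψ T ‖z‖ := by
  rw [contDiff_iff_contDiffAt]
  intro z
  rcases lt_or_ge ‖z‖ (Real.exp (-T)) with h | h
  · refine (contDiffAt_const (c := ∫ s in T..(-T), ψ s)).congr_of_eventuallyEq ?_
    filter_upwards [continuous_norm.continuousAt.eventually (gt_mem_nhds h)] with w hw
    exact profile_eq_const hψ h0 hw
  · have h1 : Real.exp (-T - 1) < ‖z‖ := (Real.exp_lt_exp.2 (by linarith)).trans_le h
    have hz : z ≠ 0 := norm_pos_iff.1 ((Real.exp_pos _).trans h1)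
    have h2 : ContDiffAt ℝ 1 (fun w : Space n => ∫ s in T..Real.log ‖w‖, ψ s) z :=
      (contDiff_primitive hψ).contDiffAt.comp z ((contDiffAt_norm ℝ hz).log (norm_ne_zero_iff.2 hz))
    refine h2.congr_of_eventuallyEq ?_
    filter_upwards [continuous_norm.continuousAt.eventually (lt_mem_nhds h1)] with w hw
    exact profile_eq_of_lt hw

lemma hasCompactSupport_profile (h0 : ∀ t, T < |t| → ψ t = 0) :
    HasCompactSupport fun z : Space n => profile ψ T ‖z‖ := by
  refine HasCompactSupport.of_support_subset_isCompact (isCompact_closedBall 0 (Real.exp T))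
    fun z hz => ?_
  rw [mem_closedBall_zero_iff]
  exact not_lt.1 fun h => hz (profile_eq_zero h0 h)

/-- The radial derivative of `∫^{log r} ψ` is `ψ(log r) / r`, so the gradient is `ψ(log |z|) z /
|z|²`. The factor `|z|^{-2}` is written as an exponential of `log |z|`, ready for polar coordinates.
-/
lemma fderiv_profile (hψ : Continuous ψ) (h0 : ∀ t, T < |t| → ψ t = 0) {z : Space n} (hz : z ≠ 0)
    (w : Space n) : fderiv ℝ (fun z : Space n => profile ψ T ‖z‖) z w =
      ψ (Real.log ‖z‖) * Real.exp (-2 * Real.log ‖z‖) * inner ℝ z w := by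
  have hz' : 0 < ‖z‖ := norm_pos_iff.2 hz
  have e : Real.exp (-2 * Real.log ‖z‖) = (‖z‖ ^ 2)⁻¹ := by
    rw [neg_mul, Real.exp_neg, mul_comm, Real.exp_mul, Real.exp_log hz']
    norm_num
  rcases lt_or_ge ‖z‖ (Real.exp (-T)) with h | h
  · have h1 : (fun z : Space n => profile ψ T ‖z‖) =ᶠ[𝓝 z] fun _ => ∫ s in T..(-T), ψ s := by
      filter_upwards [continuous_norm.continuousAt.eventually (gt_mem_nhds h)] with w hw
      exact profile_eq_const hψ h0 hw
    rw [h1.fderiv_eq, h0]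
    · simp
    · have : Real.log ‖z‖ < -T := (Real.log_lt_iff_lt_exp hz').2 h
      linarith [neg_le_abs (Real.log ‖z‖)]
  · have h1 : Real.exp (-T - 1) < ‖z‖ := (Real.exp_lt_exp.2 (by linarith)).trans_le h
    -- The logarithm is taken of the squared norm, whose derivative is explicit.
    have h2 : (fun z : Space n => profile ψ T ‖z‖) =ᶠ[𝓝 z]
        fun w => ∫ s in T..(1 / 2 * Real.log (‖w‖ ^ 2)), ψ s := by
      filter_upwards [continuous_norm.continuousAt.eventually (lt_mem_nhds h1)] with w hw
      rw [profile_eq_of_lt hw, Real.log_pow]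
      congr 1
      push_cast
      ring
    have d1 : HasFDerivAt (fun w : Space n => ‖w‖ ^ 2) (2 • (innerSL ℝ z)) z :=
      (hasStrictFDerivAt_norm_sq z).hasFDerivAt
    have d2 := (d1.log (by positivity)).const_mul (1 / 2)
    have d3 := (hψ.integral_hasStrictDerivAt T (1 / 2 * Real.log (‖z‖ ^ 2))).hasDerivAt.comp_hasFDerivAt z d2
    have e2 : 1 / 2 * Real.log (‖z‖ ^ 2) = Real.log ‖z‖ := by
      rw [Real.log_pow]; push_cast; ring
    rw [e2] at d3
    rw [h2.fderiv_eq]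
    have d4 := d3.fderiv
    rw [Function.comp_def] at d4
    rw [d4, e]
    simp
    ring

end Profile

section Ball

variable {X : Type*} [NormedAddCommGroup X] [MeasurableSpace X] [BorelSpace X] {m : Measure X} {G : X → ℝ}

/-- Dominated convergence: off the limiting sphere, which is a null set, the indicators of the balls
are eventually constant. -/
lemma continuous_integral_ball (hG : ∀ R, IntegrableOn G (Metric.closedBall 0 R) m)
    (hs : ∀ r, 0 < r → m (Metric.sphere 0 r) = 0) :
    Continuous fun t => ∫ z in Metric.ball 0 (Real.exp t), G z ∂m := by
  rw [continuous_iff_continuousAt]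
  intro t₀
  simp only [← integral_indicator (Metric.isOpen_ball.measurableSet)]
  have hb := (integrable_indicator_iff Metric.isClosed_closedBall.measurableSet).2 (hG (Real.exp (t₀ + 1)))
  refine tendsto_integral_filter_of_dominated_convergence _ ?_ ?_ hb.norm ?_
  · filter_upwards with t
    exact ((integrable_indicator_iff Metric.isOpen_ball.measurableSet).2
      ((hG (Real.exp t)).mono_set Metric.ball_subset_closedBall)).1
  · filter_upwards [gt_mem_nhds (lt_add_one t₀)] with t ht
    refine Eventually.of_forall fun z => ?_
    refine norm_indicator_le_of_subset ?_ G z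
    exact Metric.ball_subset_closedBall.trans (Metric.closedBall_subset_closedBall
      (Real.exp_le_exp.2 ht.le))
  · have : ∀ᵐ z ∂m, z ∉ Metric.sphere (0 : X) (Real.exp t₀) :=
      measure_eq_zero_iff_ae_notMem.1 (hs _ (Real.exp_pos _))
    filter_upwards [this] with z hz
    rw [mem_sphere_zero_iff_norm] at hz
    refine tendsto_const_nhds.congr' ?_
    rcases lt_or_gt_of_ne hz with h | h
    · filter_upwards [Real.continuous_exp.continuousAt.eventually (lt_mem_nhds h)] with t ht
      rw [indicator_of_mem (by simpa using h), indicator_of_mem (by simpa using ht)]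
    · filter_upwards [Real.continuous_exp.continuousAt.eventually (gt_mem_nhds h)] with t ht
      rw [indicator_of_notMem (by simpa using h.le), indicator_of_notMem (by simpa using ht.le)]

lemma integral_profile_mul [SFinite m] {ψ : ℝ → ℝ} {T : ℝ} (hψ : Continuous ψ)
    (h0 : ∀ t, T < |t| → ψ t = 0) (hG : ∀ R, IntegrableOn G (Metric.closedBall 0 R) m) :
    ∫ z, profile ψ T ‖z‖ * G z ∂m =
      -∫ t, ψ t * ∫ z in Metric.ball 0 (Real.exp t), G z ∂m := by
  have hi := integrable_of_eq_zero hψ h0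
  have hb := (integrable_indicator_iff Metric.isClosed_closedBall.measurableSet).2 (hG (Real.exp T))
  set Φ : X × ℝ → ℝ := fun p => (if ‖p.1‖ < Real.exp p.2 then ψ p.2 else 0) * G p.1 with hΦ
  set Φ' : X × ℝ → ℝ := {p : X × ℝ | ‖p.1‖ < Real.exp p.2}.indicator
    fun p => (Metric.closedBall 0 (Real.exp T)).indicator G p.1 * ψ p.2 with hΦ'
  have hmeas : MeasurableSet {p : X × ℝ | ‖p.1‖ < Real.exp p.2} :=
    measurableSet_lt (measurable_norm.comp measurable_fst) (Real.measurable_exp.comp measurable_snd)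
  have hΦe : Φ = Φ' := by
    funext p
    by_cases h1 : ‖p.1‖ < Real.exp p.2
    · have h1' : p ∈ {p : X × ℝ | ‖p.1‖ < Real.exp p.2} := h1
      rw [hΦ, hΦ', indicator_of_mem h1']
      simp only [if_pos h1]
      by_cases h2 : T < |p.2|
      · simp [h0 _ h2]
      · have h3 : p.1 ∈ Metric.closedBall (0 : X) (Real.exp T) := by
          rw [mem_closedBall_zero_iff]
          exact h1.le.trans (Real.exp_le_exp.2 ((le_abs_self _).trans (not_lt.1 h2)))
        rw [indicator_of_mem h3, mul_comm]
    · have h1' : p ∉ {p : X × ℝ | ‖p.1‖ < Real.exp p.2} := h1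
      rw [hΦ, hΦ', indicator_of_notMem h1']
      simp [if_neg h1]
  have hΦi : Integrable Φ (m.prod volume) := by
    rw [hΦe]
    exact (hb.mul_prod hi).indicator hmeas
  have e1 : ∀ z, profile ψ T ‖z‖ * G z = -∫ t, Φ (z, t) := fun z => by
    rw [profile_eq hψ h0, neg_mul, ← integral_mul_const]
  simp only [e1, integral_neg]
  rw [integral_integral_swap (f := fun z t => Φ (z, t)) hΦi]
  congr 2
  funext t
  rw [← integral_indicator Metric.isOpen_ball.measurableSet, ← integral_const_mul]
  congr 1
  funext z
  by_cases h : ‖z‖ < Real.exp t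
  · rw [indicator_of_mem (by simpa using h)]; simp [hΦ, h]
  · rw [indicator_of_notMem (by simpa using h)]; simp [hΦ, h]

end Ball

lemma wt_sphere {r : ℝ} (hr : 0 < r) : wt n a (Metric.sphere 0 r) = 0 := by
  refine (withDensity_absolutelyContinuous _ _) ?_
  exact Measure.absolutelyContinuous_of_le Measure.restrict_le_self
    (Measure.addHaar_sphere_of_ne_zero _ _ hr.ne')

lemma integrableOn_mul_rad (ha : -1 < a) {f k : Space n → ℝ} (hf : ContDiffOn ℝ 1 f (upperHalf n))
    (hfE : LocEnergy a f) (hk : ContinuousOn k (closedUpperHalf n)) (R : ℝ) :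
    IntegrableOn (fun z => k z * rad f z) (Metric.closedBall 0 R) (wt n a) := by
  -- The gradient of `|z|²` is `2z`, so the derivative of `|z|²` along `∇f` is twice the radial
  -- derivative of `f`.
  have := integrableOn_mul_fderiv_gradient (η := fun z : Space n => ‖z‖ ^ 2) ha hf hfE hk
    (contDiff_norm_sq ℝ) R
  refine (this.const_mul (1 / 2)).congr (Eventually.of_forall fun z => ?_)
  have d1 : HasFDerivAt (fun w : Space n => ‖w‖ ^ 2) (2 • (innerSL ℝ z)) z :=
    (hasStrictFDerivAt_norm_sq z).hasFDerivAt
  simp only [d1.fderiv, rad]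
  rw [← inner_gradient f z z]
  simp only [nsmul_eq_mul, smul_apply, innerSL_apply_apply,
    real_inner_comm z (gradient f z), Nat.cast_ofNat]
  simp
  ring

lemma measurable_expWeight_fst (c : ℝ) :
    Measurable fun p : ℝ × HS n => ENNReal.ofReal (Real.exp (c * p.1)) :=
  (measurable_expWeight c).comp measurable_fst

lemma integrable_comp_fst_mul {Ω : Type*} [MeasurableSpace Ω] {σ : Measure Ω} [SFinite σ] {h : ℝ → ℝ}
    (hh : Continuous h) {s t : ℝ} {F : ℝ × Ω → ℝ}
    (hF : Integrable F ((volume.restrict (Icc s t)).prod σ)) :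
    Integrable (fun p => h p.1 * F p) ((volume.restrict (Icc s t)).prod σ) := by
  obtain ⟨C, hC⟩ := (isCompact_Icc (a := s) (b := t)).exists_bound_of_continuousOn hh.continuousOn
  refine Integrable.bdd_mul (c := C) hF (hh.measurable.comp measurable_fst).aestronglyMeasurable ?_
  have h1 : ∀ᵐ x ∂(volume.restrict (Icc s t)), ‖h x‖ ≤ C :=
    (ae_restrict_mem measurableSet_Icc).mono fun x hx => hC x hx
  exact Measure.quasiMeasurePreserving_fst.ae h1

/-- For `t` in a compact interval the factor `e^{(n+1+a)t}` of the polar measure is bounded below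
and can be divided out. -/
lemma integrableOn_polar {q : Space n → ℝ}
    (hq : ∀ R, IntegrableOn q (Metric.closedBall 0 R) (wt n a)) (s t : ℝ) :
    Integrable (fun p : ℝ × HS n => q (pol p)) ((volume.restrict (Icc s t)).prod (sphereWt n a)) := by
  have h1 := (measurePreserving_pol.restrict_preimage_emb measurableEmbedding_pol
    (Metric.closedBall (0 : Space n) (Real.exp t))).integrable_comp_emb measurableEmbedding_pol |>.2
    (hq (Real.exp t))
  have h2 : Integrable (q ∘ pol) (((expWt (n + 1 + a)).prod (sphereWt n a)).restrict
      (Icc s t ×ˢ univ)) := by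
    refine h1.mono_measure (Measure.restrict_mono ?_ le_rfl)
    rintro p ⟨hp, -⟩
    simpa [norm_pol] using hp.2
  rw [← Measure.prod_restrict, Measure.restrict_univ, expWt, restrict_withDensity measurableSet_Icc,
    prod_withDensity_left (measurable_expWeight _), integrable_withDensity_iff_integrable_smul'
    (measurable_expWeight_fst _) (by simp)] at h2
  have h3 : Integrable (fun p : ℝ × HS n => Real.exp (-(n + 1 + a) * p.1) *
      (Real.exp ((n + 1 + a) * p.1) * q (pol p))) ((volume.restrict (Icc s t)).prod (sphereWt n a)) := by
    exact integrable_comp_fst_mul (h := fun t => Real.exp (-(n + 1 + a) * t)) (by fun_prop)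
      (by simpa [ENNReal.toReal_ofReal (Real.exp_pos _).le] using h2)
  refine h3.congr (Eventually.of_forall fun p => ?_)
  simp only
  rw [← mul_assoc, ← Real.exp_add, show -(n + 1 + a) * p.1 + (n + 1 + a) * p.1 = 0 by ring]
  simp

lemma integral_polar {q : Space n → ℝ} {ψ : ℝ → ℝ} {T : ℝ} (hψ : Continuous ψ)
    (h0 : ∀ t, T < |t| → ψ t = 0) (hq : ∀ R, IntegrableOn q (Metric.closedBall 0 R) (wt n a)) :
    ∫ z, ψ (Real.log ‖z‖) * q z ∂(wt n a) =
      ∫ t, ψ t * (Real.exp ((n + 1 + a) * t) * ∫ ω, q (pol (t, ω)) ∂(sphereWt n a)) := by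
  have hF : ∀ p : ℝ × HS n, ψ (Real.log ‖pol p‖) * q (pol p) = ψ p.1 * q (pol p) := fun p => by
    rw [norm_pol, Real.log_exp]
  rw [← measurePreserving_pol.integral_comp measurableEmbedding_pol]
  simp only [hF]
  have hint : Integrable (fun p : ℝ × HS n => Real.exp ((n + 1 + a) * p.1) * (ψ p.1 * q (pol p)))
      (volume.prod (sphereWt n a)) := by
    have h1 := integrableOn_polar hq (-T) T
    have h2 := integrable_comp_fst_mul (h := fun t => Real.exp ((n + 1 + a) * t) * ψ t) (by fun_prop) h1
    rw [← Measure.restrict_univ (μ := sphereWt n a), Measure.prod_restrict, ← IntegrableOn,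
      integrableOn_iff_integrable_of_support_subset] at h2
    · simpa only [mul_assoc] using h2
    · intro p hp
      refine ⟨abs_le.1 (not_lt.1 fun h => hp ?_), mem_univ _⟩
      simp [h0 _ h]
  rw [expWt, prod_withDensity_left (measurable_expWeight _), integral_withDensity_eq_integral_toReal_smul
    (measurable_expWeight_fst _) (by simp)]
  have e : ∀ p : ℝ × HS n, (ENNReal.ofReal (Real.exp ((n + 1 + a) * p.1))).toReal •
      (ψ p.1 * q (pol p)) = Real.exp ((n + 1 + a) * p.1) * (ψ p.1 * q (pol p)) := fun p => by
    simp [ENNReal.toReal_ofReal (Real.exp_pos _).le]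
  rw [integral_congr_ae (Eventually.of_forall e), integral_prod _ hint]
  congr 1
  funext t
  simp only [integral_const_mul]
  ring

end

/-! ### The flux formula through almost every half-sphere. -/

section

variable {n : ℕ} {a : ℝ}

lemma integrableOn_closedBall_boundary {q : EuclideanSpace ℝ (Fin n) → ℝ} (hq : Continuous q) (R : ℝ) :
    IntegrableOn q (Metric.closedBall 0 R) :=
  hq.continuousOn.integrableOn_compact (isCompact_closedBall _ _)

lemma integrable_integral_polar {q : Space n → ℝ}
    (hq : ∀ R, IntegrableOn q (Metric.closedBall 0 R) (wt n a)) (s t : ℝ) :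
    IntegrableOn (fun t => ∫ ω, q (pol (t, ω)) ∂(sphereWt n a)) (Icc s t) :=
  (integrableOn_polar hq s t).integral_prod_left

/-- The flux of `k ∇f` through almost every half-sphere. -/
lemma IsNeumann.flux (ha : -1 < a) {f k : Space n → ℝ} {g} (hf : IsNeumann a f g)
    (hk : ContDiffOn ℝ 1 k (upperHalf n)) (hkc : ContinuousOn k (closedUpperHalf n))
    (hkE : LocEnergy a k) :
    ∀ᵐ t, Real.exp ((n - 1 + a) * t) * ∫ ω, k (pol (t, ω)) * rad f (pol (t, ω)) ∂(sphereWt n a) =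
      (∫ z in Metric.ball 0 (Real.exp t), fderiv ℝ k z (gradient f z) ∂(wt n a)) +
        ∫ x in Metric.ball 0 (Real.exp t), k (pt x 0) * g x := by
  have hf1 : ContDiffOn ℝ 1 f (upperHalf n) := hf.contDiffOn.of_le (by norm_num)
  have hfE := hf.locEnergy ha
  have hQ := integrableOn_mul_rad ha hf1 hfE hkc
  have hG := integrableOn_fderiv_gradient hf1 hk hfE hkE
  have hB : ∀ R, IntegrableOn (fun x => k (pt x 0) * g x) (Metric.closedBall 0 R) := fun R =>
    integrableOn_closedBall_boundary
    ((continuousOn_comp_pt hkc).mul hf.continuous_boundary) R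
  set b₁ : ℝ → ℝ := fun t => ∫ z in Metric.ball 0 (Real.exp t), fderiv ℝ k z (gradient f z) ∂(wt n a)
  set b₂ : ℝ → ℝ := fun t => ∫ x in Metric.ball 0 (Real.exp t), k (pt x 0) * g x
  set A : ℝ → ℝ := fun t => Real.exp ((n - 1 + a) * t) *
    ∫ ω, k (pol (t, ω)) * rad f (pol (t, ω)) ∂(sphereWt n a) with hA
  have c₁ : Continuous b₁ := continuous_integral_ball hG fun r hr => wt_sphere hr
  have c₂ : Continuous b₂ := continuous_integral_ball hB
    fun r hr => Measure.addHaar_sphere_of_ne_zero _ _ hr.ne'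
  have hAi : ∀ K, IsCompact K → IntegrableOn A K := fun K hK => by
    obtain ⟨T, hT⟩ := hK.isBounded.subset_closedBall 0
    rw [Real.closedBall_eq_Icc] at hT
    refine IntegrableOn.mono_set ?_ hT
    exact (integrable_integral_polar hQ _ _).continuousOn_mul
      (by fun_prop : Continuous fun t : ℝ => Real.exp ((n - 1 + a) * t)).continuousOn isCompact_Icc
  have hAl : LocallyIntegrable A := (locallyIntegrable_iff).2 hAi
  have hl : LocallyIntegrable fun t => A t - (b₁ t + b₂ t) :=
    hAl.sub (c₁.add c₂).locallyIntegrable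
  -- Both sides are locally integrable in `t`, so it suffices that they agree against every smooth
  -- compactly supported `ψ`. For each `ψ` this is the weak formulation tested with the radial
  -- profile of `ψ`.
  have key := ae_eq_zero_of_integral_contDiff_smul_eq_zero hl ?_
  · filter_upwards [key] with t ht
    exact sub_eq_zero.1 ht
  intro ψ hψd hψc
  have hψ : Continuous ψ := hψd.continuous
  obtain ⟨T, hT⟩ := hψc.isBounded.subset_closedBall 0
  have h0 : ∀ t, T < |t| → ψ t = 0 := fun t ht => image_eq_zero_of_notMem_tsupport fun h => by
    have := hT h
    rw [mem_closedBall_zero_iff, Real.norm_eq_abs] at this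
    linarith
  -- The factor `e^{-2t}` is the `|z|^{-2}` in the gradient of the profile; it lowers the polar
  -- exponent `n + 1 + a` to `n - 1 + a`.
  set ψ' : ℝ → ℝ := fun t => ψ t * Real.exp (-2 * t) with hψ'
  have hψ'c : Continuous ψ' := by fun_prop
  have h0' : ∀ t, T < |t| → ψ' t = 0 := fun t ht => by simp [hψ', h0 t ht]
  have hw := hf.weak ha hk hkc hkE (contDiff_profile hψ h0) (hasCompactSupport_profile h0)
  have i2 : Integrable (fun z => profile ψ T ‖z‖ * fderiv ℝ k z (gradient f z)) (wt n a) := by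
    refine integrable_of_integrableOn_closedBall (R := Real.exp T) ?_ fun z hz => by
      simp [profile_eq_zero h0 hz]
    exact (hG _).continuousOn_mul_of_subset (contDiff_profile hψ h0).continuous.continuousOn
      (isCompact_closedBall _ _) measurableSet_closedBall subset_rfl
  have i3 : Integrable (fun z => k z * fderiv ℝ (fun z : Space n => profile ψ T ‖z‖) z (gradient f z))
      (wt n a) := by
    obtain ⟨R, -, hR⟩ := exists_radius (hasCompactSupport_profile (n := n) h0)
    exact integrable_of_integrableOn_closedBall
      (integrableOn_mul_fderiv_gradient ha hf1 hfE hkc (contDiff_profile hψ h0) R)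
      fun z hz => by simp [hR z hz]
  have e3 : ∫ z, k z * fderiv ℝ (fun z : Space n => profile ψ T ‖z‖) z (gradient f z) ∂(wt n a) =
      ∫ t, ψ t * A t := by
    have e4 : ∫ z, k z * fderiv ℝ (fun z : Space n => profile ψ T ‖z‖) z (gradient f z) ∂(wt n a) =
        ∫ z, ψ' (Real.log ‖z‖) * (k z * rad f z) ∂(wt n a) := by
      refine integral_congr_ae ?_
      filter_upwards [ae_mem_upperHalf] with z hz
      have hz0 : z ≠ 0 := by
        rintro rfl
        simp [upperHalf, ht] at hz
      rw [fderiv_profile hψ h0 hz0, ← real_inner_comm, inner_gradient]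
      simp only [hψ', rad]
      ring
    rw [e4, integral_polar hψ'c h0' hQ]
    congr 1
    funext t
    simp only [hψ', hA]
    rw [← mul_assoc, ← mul_assoc, mul_assoc (ψ t), ← Real.exp_add]
    ring_nf
  rw [integral_add i2 i3, integral_profile_mul hψ h0 hG, e3] at hw
  simp only [norm_pt_zero_right, mul_assoc] at hw
  rw [integral_profile_mul hψ h0 hB, neg_neg] at hw
  have j : ∀ {c : ℝ → ℝ}, LocallyIntegrable c → Integrable fun t => ψ t * c t := fun hc =>
    hc.integrable_smul_left_of_hasCompactSupport hψ hψc
  simp only [smul_eq_mul, mul_sub, mul_add]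
  have j12 : Integrable fun t => ψ t * b₁ t + ψ t * b₂ t :=
    (j c₁.locallyIntegrable).add (j c₂.locallyIntegrable)
  rw [integral_sub (j hAl) j12, integral_add (j c₁.locallyIntegrable) (j c₂.locallyIntegrable)]
  linarith

end

/-! ### Curves in `L²` with square-integrable derivative, and their autocorrelation. -/

section

variable {Ω : Type*} [MeasurableSpace Ω] {σ : Measure Ω} {W W' : ℝ × Ω → ℝ}

/-- A locally bounded curve `t ↦ W (t, ·)` of functions, with derivative `W'` locally in `L²`. -/
structure IsL2Curve (σ : Measure Ω) (W W' : ℝ × Ω → ℝ) : Prop where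
  hasDerivAt : ∀ ω t, HasDerivAt (fun t => W (t, ω)) (W' (t, ω)) t
  continuous_deriv : ∀ ω, Continuous fun t => W' (t, ω)
  measurable : Measurable W
  measurable_deriv : Measurable W'
  bounded : ∀ s t, ∃ M, ∀ τ ∈ Icc s t, ∀ ω, |W (τ, ω)| ≤ M
  integrable_sq : ∀ s t, Integrable (fun p => W' p ^ 2) ((volume.restrict (Icc s t)).prod σ)

namespace IsL2Curve

lemma measurable_left (h : IsL2Curve σ W W') (t : ℝ) : Measurable fun ω => W (t, ω) :=
  h.measurable.comp measurable_prodMk_left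

lemma continuous_right (h : IsL2Curve σ W W') (ω : Ω) : Continuous fun t => W (t, ω) :=
  continuous_iff_continuousAt.2 fun t => (h.hasDerivAt ω t).continuousAt

lemma ae_mem_Icc_prod (s t : ℝ) [SFinite σ] : ∀ᵐ p ∂((volume.restrict (Icc s t)).prod σ), p.1 ∈ Icc s t :=
  Measure.quasiMeasurePreserving_fst.ae (ae_restrict_mem measurableSet_Icc)

/-- The autocorrelation of the curve. -/
def corr (σ : Measure Ω) (W : ℝ × Ω → ℝ) (p : ℝ × ℝ) : ℝ := ∫ ω, W (p.1, ω) * W (p.2, ω) ∂σ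

lemma corr_self_nonneg (t : ℝ) : 0 ≤ corr σ W (t, t) := integral_nonneg fun _ => mul_self_nonneg _

variable [IsFiniteMeasure σ]

lemma integrable_mul (h : IsL2Curve σ W W') (s t : ℝ) :
    Integrable (fun ω => W (s, ω) * W (t, ω)) σ := by
  obtain ⟨M, hM⟩ := h.bounded s s
  obtain ⟨N, hN⟩ := h.bounded t t
  refine Integrable.of_bound ((h.measurable_left s).mul (h.measurable_left t)).aestronglyMeasurable
    (|M| * |N|) (ae_of_all _ fun ω => ?_)
  rw [norm_mul]
  exact mul_le_mul ((hM s (by simp) ω).trans (le_abs_self _)) ((hN t (by simp) ω).trans (le_abs_self _))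
    (norm_nonneg _) (abs_nonneg _)

lemma integrable_deriv (h : IsL2Curve σ W W') (s t : ℝ) :
    Integrable W' ((volume.restrict (Icc s t)).prod σ) := by
  have : MemLp W' 2 ((volume.restrict (Icc s t)).prod σ) :=
    (memLp_two_iff_integrable_sq h.measurable_deriv.aestronglyMeasurable).2 (h.integrable_sq s t)
  exact this.integrable (by norm_num)

/-- Translation in `t` moves the interval only. The identity gives an `L¹` bound for the shifted
derivative that is uniform in bounded shifts. -/
lemma integrable_deriv_shift (h : IsL2Curve σ W W') (s t r : ℝ) :
    Integrable (fun p : ℝ × Ω => W' (p.1 + r, p.2)) ((volume.restrict (Icc s t)).prod σ) ∧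
      ∫ p, |W' (p.1 + r, p.2)| ∂((volume.restrict (Icc s t)).prod σ) =
        ∫ p, |W' p| ∂((volume.restrict (Icc (s + r) (t + r))).prod σ) := by
  have m := (measurePreserving_add_right volume r).restrict_preimage
    (measurableSet_Icc (a := s + r) (b := t + r))
  rw [preimage_add_const_Icc, add_sub_cancel_right, add_sub_cancel_right] at m
  have m2 := m.prod (MeasurePreserving.id σ)
  refine ⟨m2.integrable_comp_of_integrable (h.integrable_deriv (s + r) (t + r)), ?_⟩
  simp only [← Real.norm_eq_abs]
  rw [← m2.map_eq, integral_map m2.measurable.aemeasurable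
    (h.measurable_deriv.norm).aestronglyMeasurable]
  rfl

lemma measurable_shift {W : ℝ × Ω → ℝ} (h : Measurable W) (r : ℝ) :
    Measurable fun p : ℝ × Ω => W (p.1 + r, p.2) :=
  h.comp ((measurable_fst.add_const r).prodMk measurable_snd)

/-- Products of `W`, shifted by `r`, and integrable functions are integrable. -/
lemma integrable_shift_mul (h : IsL2Curve σ W W') {X : ℝ × Ω → ℝ} {s t : ℝ}
    (hX : Integrable X ((volume.restrict (Icc s t)).prod σ)) (r : ℝ) :
    Integrable (fun p : ℝ × Ω => W (p.1 + r, p.2) * X p) ((volume.restrict (Icc s t)).prod σ) := by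
  obtain ⟨M, hM⟩ := h.bounded (s + r) (t + r)
  refine hX.bdd_mul (c := M) (measurable_shift h.measurable r).aestronglyMeasurable ?_
  filter_upwards [ae_mem_Icc_prod s t] with p hp
  exact hM _ ⟨by linarith [hp.1], by linarith [hp.2]⟩ _

lemma continuous_corr (h : IsL2Curve σ W W') : Continuous (corr σ W) := by
  refine continuous_iff_continuousAt.2 fun p => ?_
  obtain ⟨M, hM⟩ := h.bounded (p.1 - 1) (p.1 + 1)
  obtain ⟨N, hN⟩ := h.bounded (p.2 - 1) (p.2 + 1)
  have h1 : ∀ᶠ q : ℝ × ℝ in 𝓝 p, q.1 ∈ Icc (p.1 - 1) (p.1 + 1) :=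
    continuous_fst.continuousAt.eventually (Icc_mem_nhds (by linarith) (by linarith))
  have h2 : ∀ᶠ q : ℝ × ℝ in 𝓝 p, q.2 ∈ Icc (p.2 - 1) (p.2 + 1) :=
    continuous_snd.continuousAt.eventually (Icc_mem_nhds (by linarith) (by linarith))
  refine continuousAt_of_dominated (bound := fun _ => |M| * |N|) ?_ ?_ (integrable_const _) ?_
  · exact Eventually.of_forall fun q =>
      ((h.measurable_left q.1).mul (h.measurable_left q.2)).aestronglyMeasurable
  · filter_upwards [h1, h2] with q hq1 hq2
    refine ae_of_all _ fun ω => ?_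
    rw [norm_mul]
    exact mul_le_mul ((hM _ hq1 ω).trans (le_abs_self _)) ((hN _ hq2 ω).trans (le_abs_self _))
      (norm_nonneg _) (abs_nonneg _)
  · exact ae_of_all _ fun ω => (((h.continuous_right ω).comp continuous_fst).mul
      ((h.continuous_right ω).comp continuous_snd)).continuousAt

/-- The squared `L²` distance between two points of the curve. -/
lemma integral_sq_sub (h : IsL2Curve σ W W') (s t : ℝ) :
    ∫ ω, (W (t, ω) - W (s, ω)) ^ 2 ∂σ = corr σ W (t, t) + corr σ W (s, s) - 2 * corr σ W (s, t) := by
  have : ∀ ω, (W (t, ω) - W (s, ω)) ^ 2 =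
      W (t, ω) * W (t, ω) + W (s, ω) * W (s, ω) - 2 * (W (s, ω) * W (t, ω)) := fun ω => by ring
  have i : Integrable (fun ω => W (t, ω) * W (t, ω) + W (s, ω) * W (s, ω)) σ :=
    (h.integrable_mul t t).add (h.integrable_mul s s)
  simp only [this]
  rw [integral_sub i ((h.integrable_mul s t).const_mul 2), integral_add (h.integrable_mul t t) (h.integrable_mul s s),
    integral_const_mul]
  rfl

/-- Cauchy–Schwarz for `⟨W(t) - W(s), W(s)⟩`. It stands in for `⟨W', W⟩² ≤ ‖W'‖² ‖W‖²` at the level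
of finite differences. -/
lemma sq_corr_sub_le (h : IsL2Curve σ W W') (s t : ℝ) :
    (corr σ W (s, t) - corr σ W (s, s)) ^ 2 ≤
      (corr σ W (t, t) + corr σ W (s, s) - 2 * corr σ W (s, t)) * corr σ W (s, s) := by
  have e : corr σ W (s, t) - corr σ W (s, s) = ∫ ω, (W (t, ω) - W (s, ω)) * W (s, ω) ∂σ := by
    rw [corr, corr, ← integral_sub (h.integrable_mul s t) (h.integrable_mul s s)]
    congr 1
    funext ω
    ring
  have i1 : Integrable (fun ω => (W (t, ω) - W (s, ω)) ^ 2) σ := by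
    refine (((h.integrable_mul t t).add (h.integrable_mul s s)).sub
      ((h.integrable_mul s t).const_mul 2)).congr (ae_of_all _ fun ω => ?_)
    simp only [Pi.add_apply, Pi.sub_apply]
    ring
  have i2 : Integrable (fun ω => W (s, ω) ^ 2) σ :=
    (h.integrable_mul s s).congr (ae_of_all _ fun ω => (sq _).symm)
  have i3 : Integrable (fun ω => (W (t, ω) - W (s, ω)) * W (s, ω)) σ := by
    refine ((h.integrable_mul s t).sub (h.integrable_mul s s)).congr (ae_of_all _ fun ω => ?_)
    simp only [Pi.sub_apply]
    ring
  rw [← h.integral_sq_sub, e]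
  refine (sq_integral_mul_le i1 i2 i3).trans_eq ?_
  simp only [corr, sq]

end IsL2Curve

end

/-! ### Shifted correlations and the Wronskian. -/

section

variable {Ω : Type*} [MeasurableSpace Ω] {σ : Measure Ω} {W W' : ℝ × Ω → ℝ}

namespace IsL2Curve

lemma hasDerivAt_shift (h : IsL2Curve σ W W') (r : ℝ) (ω : Ω) (t : ℝ) :
    HasDerivAt (fun t => W (t + r, ω)) (W' (t + r, ω)) t :=
  (h.hasDerivAt ω (t + r)).comp_add_const t r

lemma continuous_deriv_shift (h : IsL2Curve σ W W') (r : ℝ) (ω : Ω) :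
    Continuous fun t => W' (t + r, ω) :=
  (h.continuous_deriv ω).comp (continuous_id.add continuous_const)

variable [IsFiniteMeasure σ]

lemma integrable_mul_deriv_shift (h : IsL2Curve σ W W') (s t r : ℝ) :
    Integrable (fun p : ℝ × Ω => W p * W' (p.1 + r, p.2)) ((volume.restrict (Icc s t)).prod σ) := by
  have := h.integrable_shift_mul (h.integrable_deriv_shift s t r).1 0
  simpa using this

lemma integrable_deriv_mul_shift (h : IsL2Curve σ W W') (s t r : ℝ) :
    Integrable (fun p : ℝ × Ω => W' p * W (p.1 + r, p.2)) ((volume.restrict (Icc s t)).prod σ) := by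
  have := h.integrable_shift_mul (h.integrable_deriv s t) r
  simpa only [mul_comm] using this

/-- For fixed `ω` the integrand is the derivative of `W(τ) W(τ + r)` in `τ`. -/
lemma corr_sub_corr (h : IsL2Curve σ W W') {s t : ℝ} (hst : s ≤ t) (r : ℝ) :
    ∫ p : ℝ × Ω, (W p * W' (p.1 + r, p.2) + W' p * W (p.1 + r, p.2))
      ∂((volume.restrict (Icc s t)).prod σ) = corr σ W (t, t + r) - corr σ W (s, s + r) := by
  have hi : Integrable (fun p : ℝ × Ω => W p * W' (p.1 + r, p.2) + W' p * W (p.1 + r, p.2))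
      ((volume.restrict (Icc s t)).prod σ) :=
    (h.integrable_mul_deriv_shift s t r).add (h.integrable_deriv_mul_shift s t r)
  rw [integral_prod_symm _ hi, corr, corr,
    ← integral_sub (h.integrable_mul _ _) (h.integrable_mul _ _)]
  congr 1
  funext ω
  rw [integral_Icc_eq_integral_Ioc, ← intervalIntegral.integral_of_le hst]
  refine intervalIntegral.integral_eq_sub_of_hasDerivAt
    (f := fun t => W (t, ω) * W (t + r, ω))
    (f' := fun t => W (t, ω) * W' (t + r, ω) + W' (t, ω) * W (t + r, ω)) (fun τ _ => ?_) ?_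
  · exact ((h.hasDerivAt ω τ).mul (h.hasDerivAt_shift r ω τ)).congr_deriv (by ring)
  · have c1 : Continuous fun t => W (t + r, ω) :=
      (h.continuous_right ω).comp (continuous_id.add continuous_const)
    exact (((h.continuous_right ω).mul (h.continuous_deriv_shift r ω)).add
      ((h.continuous_deriv ω).mul c1)).intervalIntegrable _ _

lemma integrable_correlation (h : IsL2Curve σ W W') (s t k : ℝ) :
    Integrable (fun q : ℝ × (ℝ × Ω) => W q.2 * W' (q.2.1 + q.1, q.2.2))
      ((volume.restrict (Icc 0 k)).prod ((volume.restrict (Icc s t)).prod σ)) := by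
  obtain ⟨M, hM⟩ := h.bounded s t
  have hm : Measurable fun q : ℝ × (ℝ × Ω) => W q.2 * W' (q.2.1 + q.1, q.2.2) :=
    (h.measurable.comp measurable_snd).mul (h.measurable_deriv.comp (by fun_prop))
  refine (integrable_prod_iff hm.aestronglyMeasurable).2
    ⟨ae_of_all _ fun r => h.integrable_mul_deriv_shift s t r, ?_⟩
  refine Integrable.mono' (integrable_const
    (|M| * ∫ p, |W' p| ∂((volume.restrict (Icc s (t + k))).prod σ))) ?_ ?_
  · exact (hm.norm.stronglyMeasurable.integral_prod_right).aestronglyMeasurable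
  · filter_upwards [ae_restrict_mem measurableSet_Icc] with r hr
    rw [Real.norm_of_nonneg (integral_nonneg fun _ => norm_nonneg _)]
    calc ∫ p : ℝ × Ω, ‖W p * W' (p.1 + r, p.2)‖ ∂((volume.restrict (Icc s t)).prod σ)
        ≤ ∫ p : ℝ × Ω, |M| * |W' (p.1 + r, p.2)| ∂((volume.restrict (Icc s t)).prod σ) := by
          refine integral_mono_ae (h.integrable_mul_deriv_shift s t r).norm
            ((h.integrable_deriv_shift s t r).1.abs.const_mul _) ?_
          filter_upwards [ae_mem_Icc_prod s t] with p hp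
          rw [norm_mul]
          exact mul_le_mul_of_nonneg_right ((hM _ hp p.2).trans (le_abs_self M)) (abs_nonneg _)
      _ = |M| * ∫ p, |W' p| ∂((volume.restrict (Icc (s + r) (t + r))).prod σ) := by
          rw [integral_const_mul, (h.integrable_deriv_shift s t r).2]
      _ ≤ _ := by
          refine mul_le_mul_of_nonneg_left (integral_mono_measure ?_ (ae_of_all _ fun _ => abs_nonneg _)
            (h.integrable_deriv s (t + k)).abs) (abs_nonneg _)
          exact Measure.prod_mono (Measure.restrict_mono
            (Icc_subset_Icc (by linarith [hr.1]) (by linarith [hr.2])) le_rfl) le_rfl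

/-- The antisymmetric part of the correlation between `W` and `W'`. -/
def wronskian (σ : Measure Ω) (W W' : ℝ × Ω → ℝ) (r t : ℝ) : ℝ :=
  ∫ ω, (W (t, ω) * W' (t + r, ω) - W' (t, ω) * W (t + r, ω)) ∂σ

lemma integrable_wronskian (h : IsL2Curve σ W W') (s t r : ℝ) :
    IntegrableOn (wronskian σ W W' r) (Icc s t) :=
  ((h.integrable_mul_deriv_shift s t r).sub (h.integrable_deriv_mul_shift s t r)).integral_prod_left

/-- Splitting `2 W W'(· + r)` into its antisymmetric part, the Wronskian, and its symmetric part, an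
exact derivative in `τ`. -/
lemma two_mul_integral_mul_deriv_shift (h : IsL2Curve σ W W') {s t : ℝ} (hst : s ≤ t) (r : ℝ) :
    2 * ∫ p : ℝ × Ω, W p * W' (p.1 + r, p.2) ∂((volume.restrict (Icc s t)).prod σ) =
      (∫ τ in Icc s t, wronskian σ W W' r τ) + (corr σ W (t, t + r) - corr σ W (s, s + r)) := by
  have i1 := h.integrable_mul_deriv_shift s t r
  have i2 := h.integrable_deriv_mul_shift s t r
  have i12 : ∫ p : ℝ × Ω, (W p * W' (p.1 + r, p.2) + W' p * W (p.1 + r, p.2))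
      ∂((volume.restrict (Icc s t)).prod σ) = _ := integral_add i1 i2
  rw [← h.corr_sub_corr hst, i12]
  have : ∫ τ in Icc s t, wronskian σ W W' r τ =
      ∫ p : ℝ × Ω, (W p * W' (p.1 + r, p.2) - W' p * W (p.1 + r, p.2))
        ∂((volume.restrict (Icc s t)).prod σ) :=
    (integral_prod _ (i1.sub i2)).symm
  rw [this, integral_sub i1 i2]
  ring

lemma continuous_corr_shift (h : IsL2Curve σ W W') (t : ℝ) :
    Continuous fun r => corr σ W (t, t + r) :=
  h.continuous_corr.comp (by fun_prop)

lemma integrable_integral_wronskian (h : IsL2Curve σ W W') {s t : ℝ} (hst : s ≤ t) (k : ℝ) :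
    IntegrableOn (fun r => ∫ τ in Icc s t, wronskian σ W W' r τ) (Icc 0 k) := by
  have i1 := ((h.integrable_correlation s t k).integral_prod_left).const_mul 2
  have i2 : IntegrableOn (fun r => corr σ W (t, t + r) - corr σ W (s, s + r)) (Icc 0 k) :=
    ((h.continuous_corr_shift t).sub (h.continuous_corr_shift s)).integrableOn_Icc
  refine (i1.sub i2).congr (ae_of_all _ fun r => ?_)
  simp only [Pi.sub_apply]
  rw [h.two_mul_integral_mul_deriv_shift hst]
  ring

/-- The preceding identity integrated over shifts `r ∈ [0, k]`: since `W'(τ + r)` is also a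
derivative in `r`, the left-hand side becomes an increment of the correlation. Second-order
information on the curve is thus read off the Wronskian without a second derivative. -/
lemma integral_corr_shift (h : IsL2Curve σ W W') {s t k : ℝ} (hst : s ≤ t) (hk : 0 ≤ k) :
    2 * ∫ τ in Icc s t, (corr σ W (τ, τ + k) - corr σ W (τ, τ)) =
      (∫ r in Icc 0 k, ∫ τ in Icc s t, wronskian σ W W' r τ) +
        ∫ r in Icc 0 k, (corr σ W (t, t + r) - corr σ W (s, s + r)) := by
  have i2 : IntegrableOn (fun r => corr σ W (t, t + r) - corr σ W (s, s + r)) (Icc 0 k) :=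
    ((h.continuous_corr_shift t).sub (h.continuous_corr_shift s)).integrableOn_Icc
  rw [← integral_add (h.integrable_integral_wronskian hst k) i2]
  simp only [← h.two_mul_integral_mul_deriv_shift hst]
  rw [integral_const_mul]
  congr 1
  have hc := h.integrable_correlation s t k
  rw [integral_integral_swap (f := fun r p => W p * W' (p.1 + r, p.2)) hc]
  have e : ∀ p : ℝ × Ω, ∫ r in Icc 0 k, W p * W' (p.1 + r, p.2) =
      W p * W (p.1 + k, p.2) - W p * W p := fun p => by
    rw [integral_const_mul, integral_Icc_eq_integral_Ioc, ← intervalIntegral.integral_of_le hk,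
      intervalIntegral.integral_eq_sub_of_hasDerivAt (f := fun r => W (p.1 + r, p.2))
        (fun r _ => (h.hasDerivAt p.2 (p.1 + r)).comp_const_add p.1 r)
        (((h.continuous_deriv p.2).comp (continuous_const.add continuous_id)).intervalIntegrable _ _)]
    simp [mul_sub]
  have i3 : Integrable (fun p : ℝ × Ω => W p * W (p.1 + k, p.2) - W p * W p)
      ((volume.restrict (Icc s t)).prod σ) := by
    simpa only [e] using hc.integral_prod_right
  simp only [e]
  rw [integral_prod _ i3]
  refine setIntegral_congr_fun measurableSet_Icc fun τ _ => ?_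
  exact (integral_sub (h.integrable_mul τ (τ + k)) (h.integrable_mul τ τ)).symm

lemma integrable_integral_sq_deriv (h : IsL2Curve σ W W') (s t : ℝ) :
    IntegrableOn (fun τ => ∫ ω, W' (τ, ω) ^ 2 ∂σ) (Icc s t) :=
  (h.integrable_sq s t).integral_prod_left

lemma sq_dist_le (h : IsL2Curve σ W W') {s t : ℝ} (hst : s ≤ t) :
    corr σ W (t, t) + corr σ W (s, s) - 2 * corr σ W (s, t) ≤
      (t - s) * ∫ τ in Icc s t, ∫ ω, W' (τ, ω) ^ 2 ∂σ := by
  rw [← h.integral_sq_sub]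
  have hi := h.integrable_sq s t
  rw [show ∫ τ in Icc s t, ∫ ω, W' (τ, ω) ^ 2 ∂σ = ∫ ω, (∫ τ in Icc s t, W' (τ, ω) ^ 2) ∂σ from
    integral_integral_swap (f := fun τ ω => W' (τ, ω) ^ 2) hi, ← integral_const_mul]
  refine integral_mono ?_ (hi.integral_prod_right.const_mul _) fun ω => ?_
  · refine (((h.integrable_mul t t).add (h.integrable_mul s s)).sub
      ((h.integrable_mul s t).const_mul 2)).congr (ae_of_all _ fun ω => ?_)
    simp only [Pi.add_apply, Pi.sub_apply]
    ring
  · simp only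
    rw [integral_Icc_eq_integral_Ioc]
    exact sq_sub_le_mul_integral (h.hasDerivAt ω) (h.continuous_deriv ω) hst

/-- The case of zero shift, where the Wronskian vanishes. -/
lemma corr_self_sub (h : IsL2Curve σ W W') {s t : ℝ} (hst : s ≤ t) :
    corr σ W (t, t) - corr σ W (s, s) = 2 * ∫ τ in Icc s t, ∫ ω, W (τ, ω) * W' (τ, ω) ∂σ := by
  have i := h.integrable_mul_deriv_shift s t 0
  have := h.two_mul_integral_mul_deriv_shift hst 0
  simp only [add_zero] at this i
  rw [integral_prod _ i] at this
  rw [this]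
  simp [wronskian, mul_comm]

lemma ae_integrable_mul_deriv (h : IsL2Curve σ W W') {Y Y' : ℝ × Ω → ℝ} (hY : IsL2Curve σ Y Y') :
    ∀ᵐ t, Integrable (fun ω => W (t, ω) * Y' (t, ω)) σ := by
  have key : ∀ N : ℕ, ∀ᵐ t, t ∈ Icc (-(N : ℝ)) N → Integrable (fun ω => W (t, ω) * Y' (t, ω)) σ := by
    intro N
    have i := h.integrable_shift_mul (hY.integrable_deriv (-(N : ℝ)) N) 0
    simp only [add_zero] at i
    exact (ae_restrict_iff' measurableSet_Icc).1 i.prod_right_ae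
  filter_upwards [ae_all_iff.2 key] with t ht
  obtain ⟨N, hN⟩ := exists_nat_ge |t|
  exact ht N (abs_le.1 hN)

end IsL2Curve

end

/-! ### Solutions as curves in `L²` of the half-sphere; Green's identity with a dilate. -/

section

variable {n : ℕ} {a : ℝ} {u v : Space n → ℝ}

lemma IsNeumann.isL2Curve (ha : -1 < a) {f : Space n → ℝ} {g} (hf : IsNeumann a f g) :
    IsL2Curve (sphereWt n a) (fun p => f (pol p)) (fun p => rad f (pol p)) where
  hasDerivAt ω t := hasDerivAt_exp_smul (hf.contDiffOn.of_le (by norm_num)) (hsv_mem ω) t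
  continuous_deriv ω := (continuousOn_rad (hf.contDiffOn.of_le (by norm_num))).comp_continuous
    (continuous_pol.comp (by fun_prop : Continuous fun t : ℝ => (t, ω))) fun t => pol_mem _
  measurable := (hf.contDiffOn.continuousOn.comp_continuous continuous_pol pol_mem).measurable
  measurable_deriv := ((continuousOn_rad (hf.contDiffOn.of_le (by norm_num))).comp_continuous
    continuous_pol pol_mem).measurable
  bounded s t := by
    obtain ⟨C, -, hC⟩ := exists_bound_closedUpperHalf hf.continuousOn (Real.exp t)
    refine ⟨C, fun τ hτ ω => hC _ (upperHalf_subset_closedUpperHalf (pol_mem _)) ?_⟩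
    rw [norm_pol]
    exact Real.exp_le_exp.2 hτ.2
  integrable_sq s t := by
    refine integrableOn_polar (q := fun z => rad f z ^ 2) (fun R => ?_) s t
    refine ((hf.locEnergy ha R).const_mul (R ^ 2)).mono'
      ?_ ?_
    · exact (aestronglyMeasurable_wt ((continuousOn_rad
        (hf.contDiffOn.of_le (by norm_num))).pow 2)).restrict
    · filter_upwards [ae_restrict_mem measurableSet_closedBall] with z hz
      rw [Real.norm_of_nonneg (sq_nonneg _)]
      refine (sq_rad_le f z).trans (mul_le_mul_of_nonneg_right ?_ (sq_nonneg _))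
      exact pow_le_pow_left₀ (norm_nonneg _) (by simpa using hz) 2

lemma pol_add (t h : ℝ) (ω : HS n) : pol (t + h, ω) = Real.exp h • pol (t, ω) := by
  simp [pol, smul_smul, Real.exp_add, mul_comm]

lemma rad_comp_smul (f : Space n → ℝ) (c : ℝ) (z : Space n) :
    rad (fun w => f (c • w)) z = rad f (c • z) := by
  unfold rad
  rw [fderiv_comp_smul]
  simp

/-- Green's identity for a function and its dilate. -/
lemma IsNeumann.wronskian_eq (ha : -1 < a) {f : Space n → ℝ} {g} (hf : IsNeumann a f g) (h : ℝ) :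
    ∀ᵐ t, Real.exp ((n - 1 + a) * t) * IsL2Curve.wronskian (sphereWt n a) (fun p => f (pol p))
        (fun p => rad f (pol p)) h t =
      ∫ x in Metric.ball 0 (Real.exp t), (f (pt x 0) * (Real.exp h ^ (1 - a) * g (Real.exp h • x)) -
        f (Real.exp h • pt x 0) * g x) := by
  have := isFiniteMeasure_sphereWt (n := n) ha
  have hd := hf.dilate (Real.exp_pos h)
  have hf1 : ContDiffOn ℝ 1 f (upperHalf n) := hf.contDiffOn.of_le (by norm_num)
  have hd1 : ContDiffOn ℝ 1 (fun z => f (Real.exp h • z)) (upperHalf n) :=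
    hd.contDiffOn.of_le (by norm_num)
  filter_upwards [hd.flux ha hf1 hf.continuousOn (hf.locEnergy ha),
    hf.flux ha hd1 hd.continuousOn (hd.locEnergy ha), hd.isL2Curve ha |>.ae_integrable_mul_deriv (hf.isL2Curve ha),
    hf.isL2Curve ha |>.ae_integrable_mul_deriv (hd.isL2Curve ha)] with t h1 h2 i1 i2
  have e : ∀ ω : HS n, f (pol (t, ω)) * rad f (pol (t + h, ω)) - rad f (pol (t, ω)) * f (pol (t + h, ω)) =
      f (pol (t, ω)) * rad (fun z => f (Real.exp h • z)) (pol (t, ω)) -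
        f (Real.exp h • pol (t, ω)) * rad f (pol (t, ω)) := fun ω => by
    rw [rad_comp_smul, pol_add]
    ring
  have j1 : IntegrableOn (fun x => f (pt x 0) * (Real.exp h ^ (1 - a) * g (Real.exp h • x)))
      (Metric.ball 0 (Real.exp t)) :=
    (integrableOn_closedBall_boundary ((continuousOn_comp_pt hf.continuousOn).mul
      hd.continuous_boundary) _).mono_set Metric.ball_subset_closedBall
  have j2 : IntegrableOn (fun x => f (Real.exp h • pt x 0) * g x) (Metric.ball 0 (Real.exp t)) :=
    (integrableOn_closedBall_boundary ((continuousOn_comp_pt hd.continuousOn).mul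
      hf.continuous_boundary) _).mono_set Metric.ball_subset_closedBall
  simp only [IsL2Curve.wronskian, e]
  rw [integral_sub i2 i1, mul_sub, h1, h2, integral_sub j1 j2]
  -- By symmetry of the energy form the two Dirichlet terms cancel, and only boundary integrals
  -- remain.
  simp only [fderiv_gradient_comm f]
  ring

end

/-! ### Height, energy and flux as functions of the logarithmic radius. -/

section

variable {n : ℕ} {a : ℝ} {u v : Space n → ℝ}

/-- The height at radius `e ^ t`. -/
def massLog (a : ℝ) (u v : Space n → ℝ) (t : ℝ) : ℝ :=
  IsL2Curve.corr (sphereWt n a) (fun p => u (pol p)) (t, t) +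
    IsL2Curve.corr (sphereWt n a) (fun p => v (pol p)) (t, t)

/-- The Dirichlet energy in the half-ball of radius `e ^ t`. -/
def dirInt (a : ℝ) (u v : Space n → ℝ) (t : ℝ) : ℝ :=
  ∫ z in Metric.ball 0 (Real.exp t), (‖gradient u z‖ ^ 2 + ‖gradient v z‖ ^ 2) ∂(wt n a)

/-- The potential energy on the flat part of the half-ball of radius `e ^ t`. -/
def potInt (u v : Space n → ℝ) (t : ℝ) : ℝ :=
  ∫ x in Metric.ball 0 (Real.exp t), u (pt x 0) ^ 2 * v (pt x 0) ^ 2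

/-- The normalized potential energy at radius `e ^ t`. -/
def potLog (a : ℝ) (u v : Space n → ℝ) (t : ℝ) : ℝ := Real.exp (-(n - 1 + a) * t) * potInt u v t

/-- The normalized radial flux at radius `e ^ t`. -/
def fluxLog (a : ℝ) (u v : Space n → ℝ) (t : ℝ) : ℝ :=
  Real.exp (-(n - 1 + a) * t) * (dirInt a u v t + 2 * potInt u v t)

namespace IsSolution

lemma continuous_boundary_left (h : IsSolution a u v) : Continuous fun x => u (pt x 0) :=
  continuousOn_comp_pt h.continuousOn_u

lemma continuous_boundary_right (h : IsSolution a u v) : Continuous fun x => v (pt x 0) :=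
  continuousOn_comp_pt h.continuousOn_v

lemma continuous_potential (h : IsSolution a u v) :
    Continuous fun x => u (pt x 0) ^ 2 * v (pt x 0) ^ 2 :=
  (h.continuous_boundary_left.pow 2).mul (h.continuous_boundary_right.pow 2)

lemma integrableOn_dirichlet (h : IsSolution a u v) (ha : -1 < a) (R : ℝ) :
    IntegrableOn (fun z => ‖gradient u z‖ ^ 2 + ‖gradient v z‖ ^ 2) (Metric.closedBall 0 R) (wt n a) :=
  (h.isNeumann_left.locEnergy ha R).add (h.symm.isNeumann_left.locEnergy ha R)

lemma continuous_dirInt (h : IsSolution a u v) (ha : -1 < a) : Continuous (dirInt a u v) :=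
  continuous_integral_ball (h.integrableOn_dirichlet ha) fun _ hr => wt_sphere hr

lemma continuous_potInt (h : IsSolution a u v) : Continuous (potInt u v) :=
  continuous_integral_ball (integrableOn_closedBall_boundary h.continuous_potential)
    fun _ hr => Measure.addHaar_sphere_of_ne_zero _ _ hr.ne'

lemma continuous_potLog (h : IsSolution a u v) : Continuous (potLog a u v) :=
  (by fun_prop : Continuous fun t : ℝ => Real.exp (-(n - 1 + a) * t)).mul h.continuous_potInt

lemma continuous_fluxLog (h : IsSolution a u v) (ha : -1 < a) : Continuous (fluxLog a u v) :=
  (by fun_prop : Continuous fun t : ℝ => Real.exp (-(n - 1 + a) * t)).mul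
    ((h.continuous_dirInt ha).add (continuous_const.mul h.continuous_potInt))

lemma potInt_nonneg (u v : Space n → ℝ) (t : ℝ) : 0 ≤ potInt u v t :=
  integral_nonneg fun _ => by positivity

lemma dirInt_nonneg (u v : Space n → ℝ) (t : ℝ) : 0 ≤ dirInt a u v t :=
  integral_nonneg fun _ => by positivity

lemma potLog_nonneg (u v : Space n → ℝ) (t : ℝ) : 0 ≤ potLog a u v t :=
  mul_nonneg (Real.exp_pos _).le (potInt_nonneg u v t)

lemma fluxLog_nonneg (u v : Space n → ℝ) (t : ℝ) : 0 ≤ fluxLog a u v t :=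
  mul_nonneg (Real.exp_pos _).le (add_nonneg (dirInt_nonneg u v t)
    (mul_nonneg zero_le_two (potInt_nonneg u v t)))

/-- The flux formula with `k = f`, for `u` and for `v`. Each boundary term is `u²v²`, hence the
factor `2` in front of the potential. -/
lemma integral_mul_rad_eq (h : IsSolution a u v) (ha : -1 < a) : ∀ᵐ t,
    (∫ ω, u (pol (t, ω)) * rad u (pol (t, ω)) ∂(sphereWt n a)) +
      ∫ ω, v (pol (t, ω)) * rad v (pol (t, ω)) ∂(sphereWt n a) = fluxLog a u v t := by
  have hu := h.isNeumann_left
  have hv := h.symm.isNeumann_left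
  filter_upwards [hu.flux ha (hu.contDiffOn.of_le (by norm_num)) hu.continuousOn (hu.locEnergy ha),
    hv.flux ha (hv.contDiffOn.of_le (by norm_num)) hv.continuousOn (hv.locEnergy ha)] with t h1 h2
  have e1 : ∀ x, u (pt x 0) * (u (pt x 0) * v (pt x 0) ^ 2) = u (pt x 0) ^ 2 * v (pt x 0) ^ 2 :=
    fun x => by ring
  have e2 : ∀ x, v (pt x 0) * (v (pt x 0) * u (pt x 0) ^ 2) = u (pt x 0) ^ 2 * v (pt x 0) ^ 2 :=
    fun x => by ring
  simp only [fderiv_gradient_self, e1, e2] at h1 h2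
  have e3 : dirInt a u v t = (∫ z in Metric.ball 0 (Real.exp t), ‖gradient u z‖ ^ 2 ∂(wt n a)) +
      ∫ z in Metric.ball 0 (Real.exp t), ‖gradient v z‖ ^ 2 ∂(wt n a) :=
    integral_add ((hu.locEnergy ha _).mono_set Metric.ball_subset_closedBall)
      ((hv.locEnergy ha _).mono_set Metric.ball_subset_closedBall)
  have e4 : Real.exp (-(n - 1 + a) * t) * Real.exp ((n - 1 + a) * t) = 1 := by
    rw [← Real.exp_add, ← add_mul, neg_add_cancel, zero_mul, Real.exp_zero]
  have h3 : ∀ x y : ℝ, Real.exp ((n - 1 + a) * t) * x = y → x = Real.exp (-(n - 1 + a) * t) * y := by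
    rintro x y rfl
    rw [← mul_assoc, e4, one_mul]
  rw [h3 _ _ h1, h3 _ _ h2, fluxLog, e3, potInt]
  ring

lemma massLog_sub (h : IsSolution a u v) (ha : -1 < a) {s t : ℝ} (hst : s ≤ t) :
    massLog a u v t - massLog a u v s = 2 * ∫ τ in Icc s t, fluxLog a u v τ := by
  have := isFiniteMeasure_sphereWt (n := n) ha
  have cu := h.isNeumann_left.isL2Curve ha
  have cv := h.symm.isNeumann_left.isL2Curve ha
  have e1 := cu.corr_self_sub hst
  have e2 := cv.corr_self_sub hst
  have i1 := (cu.integrable_mul_deriv_shift s t 0).integral_prod_left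
  have i2 := (cv.integrable_mul_deriv_shift s t 0).integral_prod_left
  simp only [add_zero] at i1 i2
  have e3 : ∫ τ in Icc s t, fluxLog a u v τ = _ :=
    (integral_congr_ae (ae_restrict_of_ae (h.integral_mul_rad_eq ha))).symm.trans (integral_add i1 i2)
  rw [e3, mul_add, ← e1, ← e2, massLog, massLog]
  ring

lemma continuous_massLog (h : IsSolution a u v) (ha : -1 < a) : Continuous (massLog a u v) := by
  have := isFiniteMeasure_sphereWt (n := n) ha
  exact ((h.isNeumann_left.isL2Curve ha).continuous_corr.comp (continuous_id.prodMk continuous_id)).add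
    ((h.symm.isNeumann_left.isL2Curve ha).continuous_corr.comp (continuous_id.prodMk continuous_id))

lemma massLog_pos (h : IsSolution a u v) (ha : -1 < a) (t : ℝ) : 0 < massLog a u v t := by
  have := isFiniteMeasure_sphereWt (n := n) ha
  have key : ∀ {f : Space n → ℝ} {g}, IsNeumann a f g → (∀ z ∈ closedUpperHalf n, 0 < f z) →
      0 < IsL2Curve.corr (sphereWt n a) (fun p => f (pol p)) (t, t) := by
    intro f g hf hpos
    have hp : ∀ ω : HS n, 0 < f (pol (t, ω)) * f (pol (t, ω)) := fun ω =>
      mul_self_pos.2 (hpos _ (upperHalf_subset_closedUpperHalf (pol_mem _))).ne'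
    refine (integral_pos_iff_support_of_nonneg (fun ω => (hp ω).le)
      ((hf.isL2Curve ha).integrable_mul t t)).2 ?_
    rw [show Function.support (fun ω : HS n => f (pol (t, ω)) * f (pol (t, ω))) = univ from
      eq_univ_of_forall fun ω => (hp ω).ne']
    exact Measure.measure_univ_pos.2 sphereWt_ne_zero
  exact add_pos (key h.isNeumann_left h.pos_u) (key h.symm.isNeumann_left h.pos_v)

/-- Pulling the larger ball back to radius `e^t` gives `e^{nh}`, and the normalization gives
`e^{-(n-1+a)h}`. The product `e^{(1-a)h}` is the factor in the Neumann datum of a dilate, so this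
expression can be compared with the Wronskian pointwise. -/
lemma potLog_add (u v : Space n → ℝ) (t h : ℝ) :
    potLog a u v (t + h) = Real.exp (-(n - 1 + a) * t) * ∫ x in Metric.ball 0 (Real.exp t),
      Real.exp h ^ (1 - a) * (u (Real.exp h • pt x 0) ^ 2 * v (Real.exp h • pt x 0) ^ 2) := by
  have e := Measure.setIntegral_comp_smul_of_pos
    (volume : Measure (EuclideanSpace ℝ (Fin n))) (fun x => u (pt x 0) ^ 2 * v (pt x 0) ^ 2)
    (Metric.ball 0 (Real.exp t)) (Real.exp_pos h)
  rw [smul_ball (Real.exp_pos h).ne', smul_zero, Real.norm_of_nonneg (Real.exp_pos h).le,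
    ← Real.exp_add, finrank_euclideanSpace_fin, smul_eq_mul] at e
  have hs : ∀ x : EuclideanSpace ℝ (Fin n), Real.exp h • pt x 0 = pt (Real.exp h • x) 0 := fun x => by
    rw [smul_pt, mul_zero]
  simp only [hs]
  rw [integral_const_mul, e, potLog, potInt, add_comm t h, ← Real.exp_nat_mul, ← Real.exp_neg,
    ← Real.exp_mul, ← mul_assoc, ← mul_assoc, ← Real.exp_add, ← Real.exp_add]
  congr 2
  ring

end IsSolution

end

/-! ### The lower bound for the Wronskian from the coupling term. -/

section

variable {n : ℕ} {a : ℝ} {u v : Space n → ℝ}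

/-- The algebraic identity behind the convexity of the coupling term. -/
lemma coupling_ge {p w P W M L Λ : ℝ} (hp : 0 < p) (hw : 0 < w) (hP : 0 < P) (hW : 0 < W)
    (hpM : p ≤ M) (hwM : w ≤ M) (hPM : P ≤ M) (hWM : W ≤ M) (hL : 1 ≤ L) (hLΛ : L ≤ Λ) :
    L * (P ^ 2 * W ^ 2) - p ^ 2 * w ^ 2 - Λ * M ^ 2 * ((P - p) ^ 2 + (W - w) ^ 2) ≤
      (p * (L * (P * W ^ 2)) - P * (p * w ^ 2)) + (w * (L * (W * P ^ 2)) - W * (w * p ^ 2)) := by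
  have hM : 0 < M := hp.trans_le hpM
  have hΛ : 1 ≤ Λ := hL.trans hLΛ
  have h1 : 0 ≤ (L - 1) * (P * W * p * w) := mul_nonneg (by linarith) (by positivity)
  have h2 : L * P * W ≤ Λ * M ^ 2 := by
    calc L * P * W = L * (P * W) := by ring
      _ ≤ Λ * (M * M) := by gcongr
      _ = Λ * M ^ 2 := by ring
  have h3 : p * w ≤ Λ * M ^ 2 := by
    calc p * w = 1 * (p * w) := by ring
      _ ≤ Λ * (M * M) := by gcongr
      _ = Λ * M ^ 2 := by ring
  have h4 : |L * P * W - p * w| ≤ Λ * M ^ 2 := by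
    have : 0 < L * P * W := by positivity
    have : 0 < p * w := by positivity
    exact abs_le.2 ⟨by linarith, by linarith⟩
  have h5 : |(P - p) * (W - w)| ≤ (P - p) ^ 2 + (W - w) ^ 2 := by
    rw [abs_mul]
    nlinarith [sq_abs (P - p), sq_abs (W - w), sq_nonneg (|P - p| - |W - w|), sq_nonneg (P - p),
      sq_nonneg (W - w)]
  have h6 : (L * P * W - p * w) * ((P - p) * (W - w)) ≤
      Λ * M ^ 2 * ((P - p) ^ 2 + (W - w) ^ 2) := by
    refine (le_abs_self _).trans ?_
    rw [abs_mul]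
    exact mul_le_mul h4 h5 (abs_nonneg _) ((abs_nonneg _).trans h4)
  -- The right-hand side is `(LPW - pw)(pW + Pw)`, and `pW + Pw = PW + pw - (P - p)(W - w)`.
  -- Expanding gives `L P²W² - p²w² + (L - 1) PWpw - (LPW - pw)(P - p)(W - w)`; `h1` drops the third
  -- term and `h6` bounds the fourth.
  nlinarith [h1, h6]

/-- Lower bound for the Wronskian of a solution and its dilates. -/
lemma IsSolution.exists_wronskian_ge (h : IsSolution a u v) (ha : -1 < a) (ha1 : a < 1) (s t : ℝ) :
    ∃ C, 0 ≤ C ∧ ∀ r : ℝ, 0 < r → r ≤ 1 → ∀ᵐ τ, τ ∈ Icc s t →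
      potLog a u v (τ + r) - potLog a u v τ - C * r ^ 2 ≤
        IsL2Curve.wronskian (sphereWt n a) (fun p => u (pol p)) (fun p => rad u (pol p)) r τ +
        IsL2Curve.wronskian (sphereWt n a) (fun p => v (pol p)) (fun p => rad v (pol p)) r τ := by
  obtain ⟨B, hB, hBd⟩ := h.exists_boundary_difference ha ha1 (Real.exp_pos t)
  obtain ⟨M₁, hM₁, hu⟩ := exists_bound_closedUpperHalf h.continuousOn_u (Real.exp (t + 1))
  obtain ⟨M₂, hM₂, hv⟩ := exists_bound_closedUpperHalf h.continuousOn_v (Real.exp (t + 1))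
  set M := max M₁ M₂ with hM
  set Λ := Real.exp (1 - a) with hΛ
  obtain ⟨K, hK⟩ := (isCompact_Icc (a := s) (b := t)).exists_bound_of_continuousOn
    (f := fun τ : ℝ => Real.exp (-(n - 1 + a) * τ)) (by fun_prop)
  have hKM : 0 ≤ |K| * (Λ * M ^ 2 * B) := by positivity
  refine ⟨|K| * (Λ * M ^ 2 * B), hKM, fun r hr hr1 => ?_⟩
  filter_upwards [h.isNeumann_left.wronskian_eq ha r, h.symm.isNeumann_left.wronskian_eq ha r]
    with τ w1 w2 hτ
  set E := Real.exp (-(n - 1 + a) * τ) with hE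
  set X : Set (EuclideanSpace ℝ (Fin n)) := Metric.ball 0 (Real.exp τ) with hX
  have hs : ∀ (c : ℝ) (x : EuclideanSpace ℝ (Fin n)), c • pt x 0 = pt (c • x) 0 := fun c x => by
    rw [smul_pt, mul_zero]
  have e4 : E * Real.exp ((n - 1 + a) * τ) = 1 := by
    rw [hE, ← Real.exp_add, ← add_mul, neg_add_cancel, zero_mul, Real.exp_zero]
  have h3 : ∀ x y : ℝ, Real.exp ((n - 1 + a) * τ) * x = y → x = E * y := by
    rintro x y rfl
    rw [← mul_assoc, e4, one_mul]
  have cu := h.continuous_boundary_left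
  have cv := h.continuous_boundary_right
  have cU : Continuous fun x : EuclideanSpace ℝ (Fin n) => u (pt (Real.exp r • x) 0) :=
    cu.comp (continuous_const_smul _)
  have cV : Continuous fun x : EuclideanSpace ℝ (Fin n) => v (pt (Real.exp r • x) 0) :=
    cv.comp (continuous_const_smul _)
  have io : ∀ {q : EuclideanSpace ℝ (Fin n) → ℝ}, Continuous q → IntegrableOn q X := fun hq =>
    (integrableOn_closedBall_boundary hq _).mono_set Metric.ball_subset_closedBall
  rw [h3 _ _ w1, h3 _ _ w2, potLog_add, potLog, potInt, ← mul_add, ← mul_sub, ← hE]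
  simp only [hs] at hBd ⊢
  set L := Real.exp r ^ (1 - a) with hL
  -- Here `a < 1` makes the scaling of the potential favourable: the discarded term is a difference
  -- form of `(1 - a) J ≥ 0`.
  have hL1 : 1 ≤ L := Real.one_le_rpow (Real.one_le_exp hr.le) (by linarith)
  have hLΛ : L ≤ Λ := by
    rw [hL, hΛ, ← Real.exp_mul]
    exact Real.exp_le_exp.2 (by nlinarith)
  have i1 : IntegrableOn (fun x => u (pt x 0) * (L * (u (pt (Real.exp r • x) 0) *
      v (pt (Real.exp r • x) 0) ^ 2)) - u (pt (Real.exp r • x) 0) * (u (pt x 0) * v (pt x 0) ^ 2)) X :=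
    io ((cu.mul (continuous_const.mul (cU.mul (cV.pow 2)))).sub (cU.mul (cu.mul (cv.pow 2))))
  have i2 : IntegrableOn (fun x => v (pt x 0) * (L * (v (pt (Real.exp r • x) 0) *
      u (pt (Real.exp r • x) 0) ^ 2)) - v (pt (Real.exp r • x) 0) * (v (pt x 0) * u (pt x 0) ^ 2)) X :=
    io ((cv.mul (continuous_const.mul (cV.mul (cU.pow 2)))).sub (cV.mul (cv.mul (cu.pow 2))))
  have i3 : IntegrableOn (fun x => L * (u (pt (Real.exp r • x) 0) ^ 2 * v (pt (Real.exp r • x) 0) ^ 2)) X :=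
    io (continuous_const.mul ((cU.pow 2).mul (cV.pow 2)))
  have i4 : IntegrableOn (fun x => u (pt x 0) ^ 2 * v (pt x 0) ^ 2) X := io ((cu.pow 2).mul (cv.pow 2))
  have c5 : Continuous fun x => (u (pt (Real.exp r • x) 0) - u (pt x 0)) ^ 2 +
      (v (pt (Real.exp r • x) 0) - v (pt x 0)) ^ 2 :=
    ((cU.sub cu).pow 2).add ((cV.sub cv).pow 2)
  rw [← integral_add i1 i2, ← integral_sub i3 i4]
  have key := setIntegral_mono_on (μ := volume) ((i3.sub i4).sub ((io c5).const_mul (Λ * M ^ 2))) (i1.add i2)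
    Metric.isOpen_ball.measurableSet fun x hx => by
      have hx' : ‖x‖ ≤ Real.exp τ := (mem_ball_zero_iff.1 hx).le
      have x1 : ‖pt x 0‖ ≤ Real.exp (t + 1) := by
        rw [norm_pt_zero_right]
        exact hx'.trans (Real.exp_le_exp.2 (by linarith [hτ.2]))
      have x2 : ‖pt (Real.exp r • x) 0‖ ≤ Real.exp (t + 1) := by
        rw [norm_pt_zero_right, norm_smul, Real.norm_of_nonneg (Real.exp_pos r).le, add_comm, Real.exp_add]
        exact mul_le_mul (Real.exp_le_exp.2 hr1) (hx'.trans (Real.exp_le_exp.2 hτ.2))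
          (norm_nonneg _) (Real.exp_pos _).le
      have m1 : pt x 0 ∈ closedUpperHalf n := pt_mem_closedUpperHalf le_rfl
      have m2 : pt (Real.exp r • x) 0 ∈ closedUpperHalf n := pt_mem_closedUpperHalf le_rfl
      have b1 : ∀ z ∈ closedUpperHalf n, ‖z‖ ≤ Real.exp (t + 1) → u z ≤ M := fun z hz hz' =>
        (le_abs_self _).trans ((hu z hz hz').trans (le_max_left _ _))
      have b2 : ∀ z ∈ closedUpperHalf n, ‖z‖ ≤ Real.exp (t + 1) → v z ≤ M := fun z hz hz' =>
        (le_abs_self _).trans ((hv z hz hz').trans (le_max_right _ _))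
      exact coupling_ge (h.pos_u _ m1) (h.pos_v _ m1) (h.pos_u _ m2) (h.pos_v _ m2)
        (b1 _ m1 x1) (b2 _ m1 x1) (b1 _ m2 x2) (b2 _ m2 x2) hL1 hLΛ
  have e5 := integral_sub (i3.sub i4) ((io c5).const_mul (Λ * M ^ 2))
  have e6 := integral_const_mul (μ := volume.restrict X) (Λ * M ^ 2)
    fun x => (u (pt (Real.exp r • x) 0) - u (pt x 0)) ^ 2 + (v (pt (Real.exp r • x) 0) - v (pt x 0)) ^ 2
  -- The quadratic error is `O(r²)` by the Lipschitz estimate for the traces. Mere continuity would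
  -- only give `o(1)`, whereas the limit below needs `o(r)`.
  have k2 : ∫ x in X, ((u (pt (Real.exp r • x) 0) - u (pt x 0)) ^ 2 +
      (v (pt (Real.exp r • x) 0) - v (pt x 0)) ^ 2) ≤ B * r ^ 2 := by
    refine (setIntegral_mono_set (integrableOn_closedBall_boundary c5 _)
      (ae_of_all _ fun x => by positivity) (ae_of_all _ ?_)).trans (hBd r hr hr1)
    exact Metric.ball_subset_closedBall.trans
      (Metric.closedBall_subset_closedBall (Real.exp_le_exp.2 hτ.2))
  have hE0 : 0 < E := Real.exp_pos _
  have hEK : E ≤ |K| := ((le_abs_self _).trans (hK τ hτ)).trans (le_abs_self _)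
  have k3 := mul_le_mul_of_nonneg_left key hE0.le
  have k4 : E * (Λ * M ^ 2 * ∫ x in X, ((u (pt (Real.exp r • x) 0) - u (pt x 0)) ^ 2 +
      (v (pt (Real.exp r • x) 0) - v (pt x 0)) ^ 2)) ≤ |K| * (Λ * M ^ 2 * B) * r ^ 2 := by
    calc _ ≤ |K| * (Λ * M ^ 2 * (B * r ^ 2)) := by
          refine mul_le_mul hEK (mul_le_mul_of_nonneg_left k2 (by positivity)) ?_ (abs_nonneg _)
          exact mul_nonneg (by positivity) (integral_nonneg fun _ => by positivity)
      _ = _ := by ring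
  simp only [Pi.sub_apply, Pi.add_apply] at k3 e5
  rw [e5, e6, mul_sub] at k3
  linarith

end

/-! ### One-variable analysis: from correlation bounds to growth of the flux and monotonicity of the
quotient. -/

section

lemma tendsto_integral_div_sq {φ : ℝ → ℝ} (hφ : Continuous φ) {ℓ : ℝ}
    (h : Tendsto (fun r => φ r / r) (𝓝[>] 0) (𝓝 ℓ)) :
    Tendsto (fun k => (∫ r in (0 : ℝ)..k, φ r) / k ^ 2) (𝓝[>] 0) (𝓝 (ℓ / 2)) := by
  have hc : Continuous fun k => ∫ r in (0 : ℝ)..k, φ r :=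
    intervalIntegral.continuous_primitive (fun _ _ => hφ.intervalIntegrable _ _) 0
  refine HasDerivAt.lhopital_zero_nhdsGT (f' := φ) (g' := fun k => 2 * k)
    (Eventually.of_forall fun k => ?_) (Eventually.of_forall fun k => ?_) ?_ ?_ ?_ ?_
  · exact intervalIntegral.integral_hasDerivAt_right (hφ.intervalIntegrable _ _)
      (hφ.stronglyMeasurableAtFilter _ _) hφ.continuousAt
  · simpa using hasDerivAt_pow 2 k
  · filter_upwards [self_mem_nhdsWithin] with k hk
    exact mul_ne_zero two_ne_zero (ne_of_gt hk)
  · exact (by simpa using hc.tendsto 0 : Tendsto _ (𝓝 (0 : ℝ)) (𝓝 (0 : ℝ))).mono_left nhdsWithin_le_nhds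
  · exact (by simpa using (continuous_pow 2).tendsto (0 : ℝ) :
      Tendsto (fun k : ℝ => k ^ 2) (𝓝 (0 : ℝ)) (𝓝 (0 : ℝ))).mono_left nhdsWithin_le_nhds
  · refine (h.div_const 2).congr fun r => ?_
    rw [div_div, mul_comm]

lemma hasDerivAt_integral_shift {J : ℝ → ℝ} (hJ : Continuous J) (s t : ℝ) :
    HasDerivAt (fun r => ∫ τ in s..t, (J (τ + r) - J τ)) (J t - J s) 0 := by
  have hp : ∀ x, HasDerivAt (fun r => ∫ τ in (0 : ℝ)..x + r, J τ) (J x) 0 := fun x => by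
    have := (intervalIntegral.integral_hasDerivAt_right (a := 0) (b := x + 0) (hJ.intervalIntegrable _ _)
      (hJ.stronglyMeasurableAtFilter _ _) hJ.continuousAt).comp_const_add x 0
    simpa using this
  have e : ∀ r, ∫ τ in s..t, (J (τ + r) - J τ) =
      (∫ τ in (0 : ℝ)..t + r, J τ) - (∫ τ in (0 : ℝ)..s + r, J τ) - ∫ τ in s..t, J τ := fun r => by
    have c : Continuous fun τ => J (τ + r) := hJ.comp (continuous_add_const r)
    rw [intervalIntegral.integral_sub (c.intervalIntegrable _ _)
      (hJ.intervalIntegrable _ _), intervalIntegral.integral_comp_add_right,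
      intervalIntegral.integral_interval_sub_left (hJ.intervalIntegrable _ _) (hJ.intervalIntegrable _ _)]
  simp only [e]
  exact ((hp t).sub (hp s)).sub_const _

lemma integral_shift_sub {H : ℝ → ℝ} (hH : Continuous H) (s t k : ℝ) :
    ∫ τ in s..t, (H (τ + k) - H τ) = ∫ r in (0 : ℝ)..k, (H (t + r) - H (s + r)) := by
  have i : ∀ a b : ℝ, IntervalIntegrable H volume a b := fun a b => hH.intervalIntegrable _ _
  have c : ∀ x : ℝ, Continuous fun r => H (x + r) := fun x => hH.comp (continuous_const_add x)
  have c' : Continuous fun τ => H (τ + k) := hH.comp (continuous_add_const k)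
  rw [intervalIntegral.integral_sub (c'.intervalIntegrable _ _) (i _ _),
    intervalIntegral.integral_sub ((c t).intervalIntegrable _ _) ((c s).intervalIntegrable _ _),
    intervalIntegral.integral_comp_add_right, intervalIntegral.integral_comp_add_left,
    intervalIntegral.integral_comp_add_left, add_zero, add_zero]
  have e1 := intervalIntegral.integral_add_adjacent_intervals (i s t) (i t (t + k))
  have e2 := intervalIntegral.integral_add_adjacent_intervals (i s (s + k)) (i (s + k) (t + k))
  linarith

lemma tendsto_shift_sub_div {H : ℝ → ℝ} {x d : ℝ} (h : HasDerivAt H d x) :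
    Tendsto (fun r => (H (x + r) - H x) / r) (𝓝[>] 0) (𝓝 d) := by
  refine ((hasDerivAt_iff_tendsto_slope_zero.1 h).mono_left
    (nhdsWithin_mono _ fun r hr => ne_of_gt hr)).congr fun r => ?_
  rw [smul_eq_mul, div_eq_inv_mul]

/-- Data of an autocorrelation `c` with diagonal `H`, satisfying the bounds of an `H¹` curve. -/
structure IsCorrelation (H F S : ℝ → ℝ) (c : ℝ × ℝ → ℝ) : Prop where
  hasDerivAt : ∀ t, HasDerivAt H (2 * F t) t
  continuous_flux : Continuous F
  continuous : Continuous c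
  pos : ∀ t, 0 < H t
  integrable : ∀ s t, IntervalIntegrable S volume s t
  nonneg : ∀ t, 0 ≤ S t
  dist_le : ∀ s t, s ≤ t → H t + H s - 2 * c (s, t) ≤ (t - s) * ∫ τ in s..t, S τ
  sq_le : ∀ s t, (c (s, t) - H s) ^ 2 ≤ (H t + H s - 2 * c (s, t)) * H s

namespace IsCorrelation

variable {H F S : ℝ → ℝ} {c : ℝ × ℝ → ℝ}

lemma continuous_height (h : IsCorrelation H F S c) : Continuous H :=
  continuous_iff_continuousAt.2 fun t => (h.hasDerivAt t).continuousAt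

lemma dist_nonneg (h : IsCorrelation H F S c) (s t : ℝ) : 0 ≤ H t + H s - 2 * c (s, t) :=
  nonneg_of_mul_nonneg_left ((sq_nonneg _).trans (h.sq_le s t)) (h.pos s)

lemma dist_div_le (h : IsCorrelation H F S c) (x : ℝ) {r : ℝ} (hr : 0 < r) :
    (H (x + r) + H x - 2 * c (x, x + r)) / r ≤ ∫ τ in x..x + r, S τ := by
  have := h.dist_le x (x + r) (by linarith)
  rw [add_sub_cancel_left] at this
  rwa [div_le_iff₀' hr]

/-- The squared distance is at most `r ∫_x^{x+r} S`, and the integral of a locally integrable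
function over a shrinking interval tends to zero. -/
lemma tendsto_dist_div (h : IsCorrelation H F S c) (x : ℝ) :
    Tendsto (fun r => (H (x + r) + H x - 2 * c (x, x + r)) / r) (𝓝[>] 0) (𝓝 0) := by
  have h1 : Tendsto (fun r => ∫ τ in x..x + r, S τ) (𝓝[>] 0) (𝓝 0) := by
    have : Continuous fun r => ∫ τ in x..x + r, S τ :=
      (intervalIntegral.continuous_primitive h.integrable x).comp (continuous_const_add x)
    have := this.tendsto 0
    simp only [add_zero, intervalIntegral.integral_same] at this
    exact this.mono_left nhdsWithin_le_nhds
  refine tendsto_of_tendsto_of_tendsto_of_le_of_le' tendsto_const_nhds h1 ?_ ?_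
  · filter_upwards [self_mem_nhdsWithin] with r hr
    exact div_nonneg (h.dist_nonneg _ _) (le_of_lt hr)
  · filter_upwards [self_mem_nhdsWithin] with r hr
    exact h.dist_div_le x hr

lemma corr_sub_div_eq (x r : ℝ) : (c (x, x + r) - H x) / r =
    1 / 2 * ((H (x + r) - H x) / r) - 1 / 2 * ((H (x + r) + H x - 2 * c (x, x + r)) / r) := by
  ring

/-- By polarization `c(x, x+r) - H(x)` is half the increment of `H` minus half the squared distance.
The latter is `o(r)`, and half of `H'` is `F`. -/
lemma tendsto_corr_sub_div (h : IsCorrelation H F S c) (x : ℝ) :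
    Tendsto (fun r => (c (x, x + r) - H x) / r) (𝓝[>] 0) (𝓝 (F x)) := by
  simp only [corr_sub_div_eq]
  have := ((tendsto_shift_sub_div (h.hasDerivAt x)).const_mul (1 / 2)).sub
    ((h.tendsto_dist_div x).const_mul (1 / 2))
  convert this using 2
  ring

/-- A bound uniform in the base point and in the step, needed for dominated convergence in the
integrated limit. -/
lemma exists_corr_sub_div_le (h : IsCorrelation H F S c) (s t : ℝ) :
    ∃ M, ∀ x ∈ Icc s t, ∀ r, 0 < r → r ≤ 1 → |(c (x, x + r) - H x) / r| ≤ M := by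
  obtain ⟨K, hK⟩ := (isCompact_Icc (a := s) (b := t + 1)).exists_bound_of_continuousOn
    h.continuous_flux.continuousOn
  refine ⟨K + 1 / 2 * ∫ τ in s..t + 1, S τ, fun x hx r hr hr1 => ?_⟩
  have h1 : |(H (x + r) - H x) / r| ≤ 2 * K := by
    have e : H (x + r) - H x = ∫ τ in x..x + r, 2 * F τ :=
      (intervalIntegral.integral_eq_sub_of_hasDerivAt (fun τ _ => h.hasDerivAt τ)
        ((continuous_const.mul h.continuous_flux).intervalIntegrable _ _)).symm
    have := intervalIntegral.norm_integral_le_of_norm_le_const (a := x) (b := x + r)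
      (f := fun τ => 2 * F τ) (C := 2 * K) fun τ hτ => by
        rw [uIoc_of_le (by linarith)] at hτ
        rw [norm_mul, Real.norm_ofNat]
        have := hK τ ⟨by linarith [hτ.1, hx.1], by linarith [hτ.2, hx.2]⟩
        linarith
    rw [← e, add_sub_cancel_left, abs_of_pos hr] at this
    rw [abs_div, abs_of_pos hr, div_le_iff₀ hr]
    exact this
  have h2 : (H (x + r) + H x - 2 * c (x, x + r)) / r ≤ ∫ τ in s..t + 1, S τ :=
    (h.dist_div_le x hr).trans (intervalIntegral.integral_mono_interval hx.1 (by linarith)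
      (by linarith [hx.2]) (ae_of_all _ h.nonneg) (h.integrable _ _))
  have h3 : 0 ≤ (H (x + r) + H x - 2 * c (x, x + r)) / r := div_nonneg (h.dist_nonneg _ _) hr.le
  rw [corr_sub_div_eq]
  rw [abs_le] at h1 ⊢
  constructor <;> linarith [h1.1, h1.2]

lemma tendsto_integral_sq_div (h : IsCorrelation H F S c) {s t : ℝ} (hst : s ≤ t) :
    Tendsto (fun k => ∫ τ in s..t, ((c (τ, τ + k) - H τ) / k) ^ 2 / H τ) (𝓝[>] 0)
      (𝓝 (∫ τ in s..t, F τ ^ 2 / H τ)) := by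
  obtain ⟨M, hM⟩ := h.exists_corr_sub_div_le s t
  obtain ⟨K, hK⟩ := (isCompact_Icc (a := s) (b := t)).exists_bound_of_continuousOn
    (h.continuous_height.inv₀ fun t => (h.pos t).ne').continuousOn
  have hc := h.continuous
  have hH := h.continuous_height
  refine intervalIntegral.tendsto_integral_filter_of_dominated_convergence (fun _ => M ^ 2 * K)
    (Eventually.of_forall fun k => ?_) ?_ intervalIntegrable_const (ae_of_all _ fun τ _ => ?_)
  · have : Continuous fun τ => ((c (τ, τ + k) - H τ) / k) ^ 2 / H τ :=
      (((hc.comp (by fun_prop : Continuous fun τ => (τ, τ + k))).sub hH).div_const k).pow 2 |>.div hH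
        fun τ => (h.pos τ).ne'
    exact this.aestronglyMeasurable
  · filter_upwards [Ioc_mem_nhdsGT (zero_lt_one' ℝ)] with k hk
    refine ae_of_all _ fun τ hτ => ?_
    rw [uIoc_of_le hst] at hτ
    have hτ' := Ioc_subset_Icc_self hτ
    rw [norm_div, norm_pow, div_eq_mul_inv, ← norm_inv]
    exact mul_le_mul (pow_le_pow_left₀ (norm_nonneg _) (hM τ hτ' k hk.1 hk.2) 2) (hK τ hτ')
      (norm_nonneg _) (sq_nonneg _)
  · exact ((h.tendsto_corr_sub_div τ).pow 2).div_const _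

/-- A second-order lower bound for the correlation gives a lower bound for the growth of `F`. -/
lemma flux_growth (h : IsCorrelation H F S c) {J : ℝ → ℝ} (hJ : Continuous J) {s t C : ℝ} (hst : s ≤ t)
    (hk : ∀ k, 0 < k → k ≤ 1 →
      (∫ r in (0 : ℝ)..k, ((∫ τ in s..t, (J (τ + r) - J τ)) - C * r ^ 2)) +
        ∫ r in (0 : ℝ)..k, (c (t, t + r) - c (s, s + r)) ≤ 2 * ∫ τ in s..t, (c (τ, τ + k) - H τ)) :
    2 * (∫ τ in s..t, F τ ^ 2 / H τ) + (J t - J s) ≤ F t - F s := by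
  have hc := h.continuous
  have hH := h.continuous_height
  set Ψ : ℝ → ℝ := fun r => ∫ τ in s..t, (J (τ + r) - J τ) with hΨ
  have cΨ : Continuous Ψ := by
    refine intervalIntegral.continuous_parametric_intervalIntegral_of_continuous' ?_ s t
    exact (hJ.comp (by fun_prop)).sub (hJ.comp (by fun_prop))
  have cc : ∀ x, Continuous fun r => c (x, x + r) := fun x => hc.comp (by fun_prop)
  have cH : ∀ x, Continuous fun r => H (x + r) := fun x => hH.comp (by fun_prop)
  -- By polarization `H(x+r) - c(x, x+r)` is half the increment of `H` plus half the squared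
  -- distance. In `φ` the distance at `t` is kept, being `o(r)`, while the one at `s` enters with a
  -- minus sign and is dropped.
  set φ : ℝ → ℝ := fun r => 1 / 2 * (H (t + r) - H t) - 1 / 2 * (H (s + r) - H s) +
    1 / 2 * (H (t + r) + H t - 2 * c (t, t + r)) - Ψ r + C * r ^ 2 with hφ
  have cφ : Continuous φ := ((((continuous_const.mul ((cH t).sub continuous_const)).sub
    (continuous_const.mul ((cH s).sub continuous_const))).add
    (continuous_const.mul (((cH t).add continuous_const).sub (continuous_const.mul (cc t))))).sub cΨ).add
    (by fun_prop)
  have lφ : Tendsto (fun r => φ r / r) (𝓝[>] 0) (𝓝 (F t - F s - (J t - J s))) := by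
    have l1 := tendsto_shift_sub_div (h.hasDerivAt t)
    have l2 := tendsto_shift_sub_div (h.hasDerivAt s)
    have l3 := h.tendsto_dist_div t
    have l4 := tendsto_shift_sub_div (hasDerivAt_integral_shift hJ s t)
    have l5 : Tendsto (fun r : ℝ => C * r) (𝓝[>] 0) (𝓝 0) :=
      (by simpa using (continuous_const_mul C).tendsto 0 :
        Tendsto (fun r : ℝ => C * r) (𝓝 0) (𝓝 0)).mono_left nhdsWithin_le_nhds
    have l := ((((l1.const_mul (1 / 2)).sub (l2.const_mul (1 / 2))).add (l3.const_mul (1 / 2))).sub l4).add l5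
    have e : 1 / 2 * (2 * F t) - 1 / 2 * (2 * F s) + 1 / 2 * 0 - (J t - J s) + 0 =
      F t - F s - (J t - J s) := by ring
    rw [e] at l
    refine l.congr' ?_
    filter_upwards [self_mem_nhdsWithin] with r hr
    have hr0 : r ≠ 0 := ne_of_gt hr
    simp only [hφ, hΨ, zero_add, add_zero, sub_self, intervalIntegral.integral_zero, sub_zero]
    field_simp
  -- An upper bound for the integrated squared increments of the curve: they equal the increments of
  -- `H` minus twice those of the correlation, and the hypothesis bounds the latter from below.
  have key : ∀ k, 0 < k → k ≤ 1 →
      ∫ τ in s..t, (H (τ + k) + H τ - 2 * c (τ, τ + k)) ≤ ∫ r in (0 : ℝ)..k, φ r := by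
    intro k hk0 hk1
    have c1 : Continuous fun τ => c (τ, τ + k) := hc.comp (by fun_prop)
    have c2 : Continuous fun τ => H (τ + k) := hH.comp (by fun_prop)
    have e1 : ∫ τ in s..t, (H (τ + k) + H τ - 2 * c (τ, τ + k)) =
        (∫ τ in s..t, (H (τ + k) - H τ)) - 2 * ∫ τ in s..t, (c (τ, τ + k) - H τ) := by
      have d1 : Continuous fun τ => H (τ + k) - H τ := c2.sub hH
      have d2 : Continuous fun τ => 2 * (c (τ, τ + k) - H τ) := continuous_const.mul (c1.sub hH)
      rw [← intervalIntegral.integral_const_mul, ← intervalIntegral.integral_sub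
        (d1.intervalIntegrable _ _) (d2.intervalIntegrable _ _)]
      congr 1
      funext τ
      ring
    rw [e1, integral_shift_sub hH]
    have d1 : Continuous fun r => H (t + r) - H (s + r) := (cH t).sub (cH s)
    have d2 : Continuous fun r => c (t, t + r) - c (s, s + r) := (cc t).sub (cc s)
    have d3 : Continuous fun r => Ψ r - C * r ^ 2 := cΨ.sub (by fun_prop)
    have d4 : Continuous fun r => Ψ r - C * r ^ 2 + (c (t, t + r) - c (s, s + r)) := d3.add d2
    have e2 : (∫ r in (0 : ℝ)..k, (H (t + r) - H (s + r))) - ((∫ r in (0 : ℝ)..k, (Ψ r - C * r ^ 2)) +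
        ∫ r in (0 : ℝ)..k, (c (t, t + r) - c (s, s + r))) =
        ∫ r in (0 : ℝ)..k, (H (t + r) - H (s + r) - (Ψ r - C * r ^ 2 + (c (t, t + r) - c (s, s + r)))) := by
      rw [← intervalIntegral.integral_add (d3.intervalIntegrable _ _) (d2.intervalIntegrable _ _),
        ← intervalIntegral.integral_sub (d1.intervalIntegrable _ _) (d4.intervalIntegrable _ _)]
    refine (sub_le_sub_left (hk k hk0 hk1) _).trans (e2.trans_le ?_)
    refine intervalIntegral.integral_mono_on hk0.le ((d1.sub (d3.add d2)).intervalIntegrable _ _)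
      (cφ.intervalIntegrable _ _) fun r _ => ?_
    have := h.dist_nonneg s (s + r)
    simp only [hφ]
    linarith
  -- Divided by `k²`, the upper bound tends to half the limit of `φ(r)/r`, and the Cauchy–Schwarz
  -- lower bound to `∫ F²/H`.
  have lim := le_of_tendsto_of_tendsto (h.tendsto_integral_sq_div hst) (tendsto_integral_div_sq cφ lφ) ?_
  · linarith
  filter_upwards [Ioc_mem_nhdsGT (zero_lt_one' ℝ)] with k hk'
  rw [le_div_iff₀ (by have := hk'.1; positivity), ← intervalIntegral.integral_mul_const]
  refine le_trans ?_ (key k hk'.1 hk'.2)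
  have c1 : Continuous fun τ => c (τ, τ + k) := hc.comp (by fun_prop)
  have c2 : Continuous fun τ => H (τ + k) := hH.comp (by fun_prop)
  refine intervalIntegral.integral_mono_on hst (Continuous.intervalIntegrable ?_ _ _)
    (((c2.add hH).sub (continuous_const.mul c1)).intervalIntegrable _ _) fun τ _ => ?_
  · exact ((((c1.sub hH).div_const k).pow 2).div hH fun τ => (h.pos τ).ne').mul continuous_const
  · rw [div_pow, div_div, mul_comm (k ^ 2), ← div_div, div_mul_cancel₀ _ (pow_ne_zero 2 hk'.1.ne'),
      div_le_iff₀ (h.pos τ)]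
    exact h.sq_le τ (τ + k)

end IsCorrelation

/-- A quotient `E / H` is monotone when the growth of `E` dominates `E / H` times that of `H`. -/
lemma monotone_div_of_growth {E H F : ℝ → ℝ} (hE : Continuous E) (hH : ∀ t, HasDerivAt H (2 * F t) t)
    (hF : Continuous F) (hF0 : ∀ t, 0 ≤ F t) (hpos : ∀ t, 0 < H t)
    (hg : ∀ s t, s ≤ t → ∫ τ in s..t, E τ / H τ * (2 * F τ) ≤ E t - E s) :
    Monotone fun t => E t / H t := by
  intro s t hst
  have cH : Continuous H := continuous_iff_continuousAt.2 fun t => (hH t).continuousAt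
  have cq : Continuous fun t => E t / H t := hE.div cH fun t => (hpos t).ne'
  -- At a minimum point `m` of the quotient on `[s, t]`, the growth bound on `[s, m]` may be
  -- weakened by replacing `E/H` with its minimum, as `H' ≥ 0`. This gives `E(s)/H(s) ≤ E(m)/H(m)`,
  -- so the minimum is also attained at the left end.
  obtain ⟨m, hm, hmin⟩ := isCompact_Icc.exists_isMinOn (nonempty_Icc.2 hst) cq.continuousOn
  have c2 : Continuous fun τ => 2 * F τ := continuous_const.mul hF
  have h1 : E m / H m * (H m - H s) ≤ E m - E s := by
    refine le_trans ?_ (hg s m hm.1)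
    rw [← intervalIntegral.integral_eq_sub_of_hasDerivAt (fun τ _ => hH τ) (c2.intervalIntegrable _ _),
      ← intervalIntegral.integral_const_mul]
    refine intervalIntegral.integral_mono_on hm.1 ((continuous_const.mul c2).intervalIntegrable _ _)
      ((cq.mul c2).intervalIntegrable _ _) fun τ hτ => ?_
    exact mul_le_mul_of_nonneg_right (hmin ⟨hτ.1, hτ.2.trans hm.2⟩)
      (mul_nonneg zero_le_two (hF0 τ))
  have h2 : E s / H s ≤ E m / H m := by
    rw [div_le_iff₀ (hpos s)]
    rw [mul_sub, div_mul_cancel₀ _ (hpos m).ne'] at h1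
    linarith
  exact h2.trans (hmin (right_mem_Icc.2 hst))

end

/-! ### Surface integrals, height and energy in logarithmic coordinates. -/

section

variable {n : ℕ} {a : ℝ}

section Surface

lemma measurableEmbedding_smul_sphere (t : ℝ) :
    MeasurableEmbedding fun ω : Metric.sphere (0 : Space n) 1 => Real.exp t • (ω : Space n) :=
  ((continuous_const_smul _).comp continuous_subtype_val).measurableEmbedding
    ((smul_right_injective _ (Real.exp_pos t).ne').comp Subtype.val_injective)

lemma preimage_halfSphere (t : ℝ) :
    (fun ω : Metric.sphere (0 : Space n) 1 => Real.exp t • (ω : Space n)) ⁻¹' halfSphere n (Real.exp t) =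
      {ω : Metric.sphere (0 : Space n) 1 | 0 < ht (ω : Space n)} := by
  ext ω
  have hω : ‖(ω : Space n)‖ = 1 := mem_sphere_zero_iff_norm.1 ω.2
  simp [halfSphere, upperHalf, norm_smul, hω, mul_pos_iff_of_pos_left (Real.exp_pos t)]

lemma ht_pol (t : ℝ) (ω : HS n) : ht (Real.exp t • (ω.1 : Space n)) ^ a =
    Real.exp t ^ a * ht (hsv ω) ^ a := by
  rw [ht_smul]
  exact Real.mul_rpow (Real.exp_pos t).le ω.2.le

lemma restrict_surfaceMeasure (t : ℝ) :
    (surfaceMeasure n (Real.exp t)).restrict (halfSphere n (Real.exp t)) =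
      ENNReal.ofReal (Real.exp t ^ n) •
        (((volume : Measure (Space n)).toSphere).restrict {ω | 0 < ht (ω : Space n)}).map
          fun ω : Metric.sphere (0 : Space n) 1 => Real.exp t • (ω : Space n) := by
  rw [surfaceMeasure, Measure.restrict_smul, (measurableEmbedding_smul_sphere t).restrict_map,
    preimage_halfSphere]

lemma integrableOn_surface {q : Space n → ℝ} {t : ℝ}
    (hq : Integrable (fun ω => q (pol (t, ω))) (sphereWt n a)) :
    IntegrableOn (fun z => ht z ^ a * q z) (halfSphere n (Real.exp t)) (surfaceMeasure n (Real.exp t)) := by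
  rw [IntegrableOn, restrict_surfaceMeasure]
  refine Integrable.smul_measure ?_ ENNReal.ofReal_ne_top
  rw [(measurableEmbedding_smul_sphere t).integrable_map_iff,
    ← map_comap_subtype_coe (isOpen_HS (n := n)).measurableSet,
    (MeasurableEmbedding.subtype_coe isOpen_HS.measurableSet).integrable_map_iff]
  rw [sphereWt, integrable_withDensity_iff_integrable_smul' (measurable_sphere_weight a) (by simp)] at hq
  refine (hq.const_mul (Real.exp t ^ a)).congr (ae_of_all _ fun ω => ?_)
  simp only [Function.comp_apply, smul_eq_mul]
  rw [ht_pol, ENNReal.toReal_ofReal (Real.rpow_nonneg (hsv_mem ω).le _), mul_assoc]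
  rfl

/-- The area scales with `r^n` and the weight with `r^a`, which is exactly the normalization of the
height. -/
lemma setIntegral_surface (q : Space n → ℝ) (t : ℝ) :
    ∫ z in halfSphere n (Real.exp t), ht z ^ a * q z ∂(surfaceMeasure n (Real.exp t)) =
      Real.exp t ^ ((n : ℝ) + a) * ∫ ω, q (pol (t, ω)) ∂(sphereWt n a) := by
  rw [restrict_surfaceMeasure, integral_smul_measure, (measurableEmbedding_smul_sphere t).integral_map,
    ← map_comap_subtype_coe (isOpen_HS (n := n)).measurableSet,
    (MeasurableEmbedding.subtype_coe isOpen_HS.measurableSet).integral_map, sphereWt,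
    integral_withDensity_eq_integral_toReal_smul (measurable_sphere_weight a) (by simp),
    ENNReal.toReal_ofReal (pow_nonneg (Real.exp_pos t).le n), Real.rpow_add (Real.exp_pos t),
    Real.rpow_natCast, smul_eq_mul, mul_assoc, ← integral_const_mul (Real.exp t ^ a)]
  congr 2
  funext ω
  simp only [smul_eq_mul]
  rw [ht_pol, ENNReal.toReal_ofReal (Real.rpow_nonneg (hsv_mem ω).le _), mul_assoc]
  rfl

end Surface

namespace IsSolution

variable {u v : Space n → ℝ}

lemma integrable_mass (h : IsSolution a u v) (ha : -1 < a) (t : ℝ) :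
    Integrable (fun ω => u (pol (t, ω)) ^ 2 + v (pol (t, ω)) ^ 2) (sphereWt n a) ∧
      ∫ ω, (u (pol (t, ω)) ^ 2 + v (pol (t, ω)) ^ 2) ∂(sphereWt n a) = massLog a u v t := by
  have := isFiniteMeasure_sphereWt (n := n) ha
  have i1 := (h.isNeumann_left.isL2Curve ha).integrable_mul t t
  have i2 := (h.symm.isNeumann_left.isL2Curve ha).integrable_mul t t
  simp only [← sq] at i1 i2
  refine ⟨i1.add i2, ?_⟩
  rw [integral_add i1 i2, massLog]
  simp only [IsL2Curve.corr, ← sq]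

lemma height_eq (h : IsSolution a u v) (ha : -1 < a) (t : ℝ) :
    height a u v (Real.exp t) = massLog a u v t := by
  have e := setIntegral_surface (a := a) (fun z => u z ^ 2 + v z ^ 2) t
  unfold height massDensity
  rw [e, (h.integrable_mass ha t).2, ← mul_assoc, one_div_mul_cancel, one_mul]
  exact (Real.rpow_pos_of_pos (Real.exp_pos t) _).ne'

/-- The flux contains the potential twice and the energy once. The flat part is a closed ball, but
its bounding sphere is a null set. -/
lemma energy_eq (u v : Space n → ℝ) (t : ℝ) :
    energy a u v (Real.exp t) = fluxLog a u v t - potLog a u v t := by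
  have e1 : ∫ z in halfBall n (Real.exp t), dirichletDensity a u v z = dirInt a u v t :=
    (setIntegral_wt (f := fun z => ‖gradient u z‖ ^ 2 + ‖gradient v z‖ ^ 2)
      Metric.isOpen_ball.measurableSet).symm
  have e2 : ∫ x in flatPart n (Real.exp t), u (pt x 0) ^ 2 * v (pt x 0) ^ 2 = potInt u v t := by
    refine setIntegral_congr_set ?_
    have h0 := measure_eq_zero_iff_ae_notMem.1 (Measure.addHaar_sphere_of_ne_zero
      (volume : Measure (EuclideanSpace ℝ (Fin n))) 0 (Real.exp_pos t).ne')
    filter_upwards [h0] with x hx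
    have hx' : ‖x‖ ≠ Real.exp t := fun h => hx (mem_sphere_zero_iff_norm.2 h)
    refine propext ⟨fun h => ?_, fun h => Metric.ball_subset_closedBall h⟩
    exact mem_ball_zero_iff.2 (lt_of_le_of_ne (mem_closedBall_zero_iff.1 h) hx')
  rw [energy, e1, e2, fluxLog, potLog, one_div, ← Real.rpow_neg (Real.exp_pos t).le, ← Real.exp_mul,
    mul_comm t]
  ring

end IsSolution

end

/-! ### Growth of the flux for solutions, and monotonicity of the frequency. -/

section

variable {n : ℕ} {a : ℝ} {u v : Space n → ℝ}

/-- Combines the Cauchy–Schwarz inequalities of the components `u` and `v` into the one for the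
pair. -/
lemma sq_add_le_of_sq_le {A B P Q X Y : ℝ} (hA : 0 ≤ A) (hB : 0 ≤ B) (hP : 0 ≤ P) (hQ : 0 ≤ Q)
    (hX : X ^ 2 ≤ P * A) (hY : Y ^ 2 ≤ Q * B) : (X + Y) ^ 2 ≤ (P + Q) * (A + B) := by
  have h1 : (X * Y) ^ 2 ≤ (P * B) * (Q * A) := by
    calc (X * Y) ^ 2 = X ^ 2 * Y ^ 2 := mul_pow _ _ _
      _ ≤ (P * A) * (Q * B) := mul_le_mul hX hY (sq_nonneg _) (mul_nonneg hP hA)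
      _ = _ := by ring
  have h2 : 2 * (X * Y) ≤ P * B + Q * A :=
    abs_le_of_sq_le_sq' (by nlinarith [sq_nonneg (P * B - Q * A)]) (by positivity) |>.2
  nlinarith

namespace IsSolution

/-- The flux formula holds only for almost every radius, but its right-hand side is continuous, so
the integrated identity makes the height differentiable everywhere. -/
lemma hasDerivAt_massLog (h : IsSolution a u v) (ha : -1 < a) (t : ℝ) :
    HasDerivAt (massLog a u v) (2 * fluxLog a u v t) t := by
  have hF := h.continuous_fluxLog ha
  have e : ∀ x, t - 1 ≤ x → massLog a u v x =
      massLog a u v (t - 1) + 2 * ∫ τ in (t - 1)..x, fluxLog a u v τ := fun x hx => by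
    rw [intervalIntegral.integral_of_le hx, ← integral_Icc_eq_integral_Ioc, ← h.massLog_sub ha hx]
    ring
  have h1 : HasDerivAt (fun x => massLog a u v (t - 1) + 2 * ∫ τ in (t - 1)..x, fluxLog a u v τ)
      (2 * fluxLog a u v t) t :=
    ((intervalIntegral.integral_hasDerivAt_right (hF.intervalIntegrable _ _)
      (hF.stronglyMeasurableAtFilter _ _) hF.continuousAt).const_mul 2).const_add _
  refine h1.congr_of_eventuallyEq ?_
  filter_upwards [Ioi_mem_nhds (sub_one_lt t)] with x hx
  exact e x (le_of_lt hx)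

/-- The correlation of a solution between two radii. -/
def corrLog (a : ℝ) (u v : Space n → ℝ) (p : ℝ × ℝ) : ℝ :=
  IsL2Curve.corr (sphereWt n a) (fun p => u (pol p)) p + IsL2Curve.corr (sphereWt n a) (fun p => v (pol p)) p

/-- The squared norm of the radial derivative at radius `e ^ t`. -/
def radSq (a : ℝ) (u v : Space n → ℝ) (t : ℝ) : ℝ :=
  (∫ ω, rad u (pol (t, ω)) ^ 2 ∂(sphereWt n a)) + ∫ ω, rad v (pol (t, ω)) ^ 2 ∂(sphereWt n a)

lemma integrableOn_radSq (h : IsSolution a u v) (ha : -1 < a) (s t : ℝ) :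
    IntegrableOn (radSq a u v) (Icc s t) := by
  have := isFiniteMeasure_sphereWt (n := n) ha
  exact ((h.isNeumann_left.isL2Curve ha).integrable_integral_sq_deriv s t).add
    ((h.symm.isNeumann_left.isL2Curve ha).integrable_integral_sq_deriv s t)

lemma isCorrelation (h : IsSolution a u v) (ha : -1 < a) :
    IsCorrelation (massLog a u v) (fluxLog a u v) (radSq a u v) (corrLog a u v) := by
  have := isFiniteMeasure_sphereWt (n := n) ha
  have cu := h.isNeumann_left.isL2Curve ha
  have cv := h.symm.isNeumann_left.isL2Curve ha
  refine ⟨h.hasDerivAt_massLog ha, h.continuous_fluxLog ha, cu.continuous_corr.add cv.continuous_corr,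
    h.massLog_pos ha, fun s t => ?_, fun t => ?_, fun s t hst => ?_, fun s t => ?_⟩
  · rw [intervalIntegrable_iff]
    exact (h.integrableOn_radSq ha _ _).mono_set Ioc_subset_Icc_self
  · exact add_nonneg (integral_nonneg fun _ => sq_nonneg _) (integral_nonneg fun _ => sq_nonneg _)
  · have h1 := cu.sq_dist_le hst
    have h2 := cv.sq_dist_le hst
    have e : ∫ τ in Icc s t, radSq a u v τ = _ :=
      integral_add (cu.integrable_integral_sq_deriv s t) (cv.integrable_integral_sq_deriv s t)
    rw [intervalIntegral.integral_of_le hst, ← integral_Icc_eq_integral_Ioc, e, mul_add]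
    simp only [massLog, corrLog]
    linarith
  · have h1 := cu.sq_corr_sub_le s t
    have h2 := cv.sq_corr_sub_le s t
    have p1 := IsL2Curve.corr_self_nonneg (σ := sphereWt n a) (W := fun p => u (pol p)) s
    have p2 := IsL2Curve.corr_self_nonneg (σ := sphereWt n a) (W := fun p => v (pol p)) s
    have q1 := (integral_nonneg fun _ => sq_nonneg _).trans_eq (cu.integral_sq_sub s t)
    have q2 := (integral_nonneg fun _ => sq_nonneg _).trans_eq (cv.integral_sq_sub s t)
    simp only [massLog, corrLog]
    set A := IsL2Curve.corr (sphereWt n a) (fun p => u (pol p)) (s, s)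
    set B := IsL2Curve.corr (sphereWt n a) (fun p => v (pol p)) (s, s)
    set X := IsL2Curve.corr (sphereWt n a) (fun p => u (pol p)) (s, t) - A with hX
    set Y := IsL2Curve.corr (sphereWt n a) (fun p => v (pol p)) (s, t) - B with hY
    set P := IsL2Curve.corr (sphereWt n a) (fun p => u (pol p)) (t, t) + A -
      2 * IsL2Curve.corr (sphereWt n a) (fun p => u (pol p)) (s, t) with hP
    set Q := IsL2Curve.corr (sphereWt n a) (fun p => v (pol p)) (t, t) + B -
      2 * IsL2Curve.corr (sphereWt n a) (fun p => v (pol p)) (s, t) with hQ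
    have key : (X + Y) ^ 2 ≤ (P + Q) * (A + B) := sq_add_le_of_sq_le p1 p2 q1 q2 h1 h2
    refine le_trans (le_of_eq ?_) (key.trans (le_of_eq ?_))
    · rw [hX, hY]; ring
    · rw [hP, hQ]; ring

lemma flux_growth (h : IsSolution a u v) (ha : -1 < a) (ha1 : a < 1) {s t : ℝ} (hst : s ≤ t) :
    2 * (∫ τ in s..t, fluxLog a u v τ ^ 2 / massLog a u v τ) + (potLog a u v t - potLog a u v s) ≤
      fluxLog a u v t - fluxLog a u v s := by
  have := isFiniteMeasure_sphereWt (n := n) ha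
  have cu := h.isNeumann_left.isL2Curve ha
  have cv := h.symm.isNeumann_left.isL2Curve ha
  obtain ⟨C, hC, hw⟩ := h.exists_wronskian_ge ha ha1 s t
  have cJ : Continuous (potLog a u v) := h.continuous_potLog
  -- The error `C r²` of the Wronskian bound holds at each `τ`; integration over `[s, t]` multiplies
  -- it by `t - s`.
  refine (h.isCorrelation ha).flux_growth cJ (C := C * (t - s)) hst fun k hk hk1 => ?_
  have e1 := cu.integral_corr_shift hst hk.le
  have e2 := cv.integral_corr_shift hst hk.le
  have c1 : Continuous fun τ => IsL2Curve.corr (sphereWt n a) (fun p => u (pol p)) (τ, τ + k) -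
      IsL2Curve.corr (sphereWt n a) (fun p => u (pol p)) (τ, τ) :=
    (cu.continuous_corr.comp (by fun_prop)).sub (cu.continuous_corr.comp (by fun_prop))
  have c2 : Continuous fun τ => IsL2Curve.corr (sphereWt n a) (fun p => v (pol p)) (τ, τ + k) -
      IsL2Curve.corr (sphereWt n a) (fun p => v (pol p)) (τ, τ) :=
    (cv.continuous_corr.comp (by fun_prop)).sub (cv.continuous_corr.comp (by fun_prop))
  have d1 : Continuous fun r => IsL2Curve.corr (sphereWt n a) (fun p => u (pol p)) (t, t + r) -
      IsL2Curve.corr (sphereWt n a) (fun p => u (pol p)) (s, s + r) :=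
    (cu.continuous_corr_shift t).sub (cu.continuous_corr_shift s)
  have d2 : Continuous fun r => IsL2Curve.corr (sphereWt n a) (fun p => v (pol p)) (t, t + r) -
      IsL2Curve.corr (sphereWt n a) (fun p => v (pol p)) (s, s + r) :=
    (cv.continuous_corr_shift t).sub (cv.continuous_corr_shift s)
  have l1 : ∫ τ in s..t, (corrLog a u v (τ, τ + k) - massLog a u v τ) =
      (∫ τ in Icc s t, (IsL2Curve.corr (sphereWt n a) (fun p => u (pol p)) (τ, τ + k) -
        IsL2Curve.corr (sphereWt n a) (fun p => u (pol p)) (τ, τ))) +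
      ∫ τ in Icc s t, (IsL2Curve.corr (sphereWt n a) (fun p => v (pol p)) (τ, τ + k) -
        IsL2Curve.corr (sphereWt n a) (fun p => v (pol p)) (τ, τ)) := by
    rw [← integral_add c1.integrableOn_Icc c2.integrableOn_Icc, intervalIntegral.integral_of_le hst,
      integral_Icc_eq_integral_Ioc]
    congr 1
    funext τ
    simp only [corrLog, massLog]
    ring
  have l2 : ∫ r in (0 : ℝ)..k, (corrLog a u v (t, t + r) - corrLog a u v (s, s + r)) =
      (∫ r in Icc 0 k, (IsL2Curve.corr (sphereWt n a) (fun p => u (pol p)) (t, t + r) -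
        IsL2Curve.corr (sphereWt n a) (fun p => u (pol p)) (s, s + r))) +
      ∫ r in Icc 0 k, (IsL2Curve.corr (sphereWt n a) (fun p => v (pol p)) (t, t + r) -
        IsL2Curve.corr (sphereWt n a) (fun p => v (pol p)) (s, s + r)) := by
    rw [← integral_add d1.integrableOn_Icc d2.integrableOn_Icc,
      intervalIntegral.integral_of_le hk.le, integral_Icc_eq_integral_Ioc]
    congr 1
    funext τ
    simp only [corrLog]
    ring
  have w1 := cu.integrable_integral_wronskian hst k
  have w2 := cv.integrable_integral_wronskian hst k
  have l3 : ∫ r in (0 : ℝ)..k, ((∫ τ in s..t, (potLog a u v (τ + r) - potLog a u v τ)) -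
        C * (t - s) * r ^ 2) ≤
      (∫ r in Icc 0 k, ∫ τ in Icc s t, IsL2Curve.wronskian (sphereWt n a) (fun p => u (pol p))
        (fun p => rad u (pol p)) r τ) +
      ∫ r in Icc 0 k, ∫ τ in Icc s t, IsL2Curve.wronskian (sphereWt n a) (fun p => v (pol p))
        (fun p => rad v (pol p)) r τ := by
    have cΨ : Continuous fun r => (∫ τ in s..t, (potLog a u v (τ + r) - potLog a u v τ)) -
        C * (t - s) * r ^ 2 := by
      refine Continuous.sub ?_ (by fun_prop)
      refine intervalIntegral.continuous_parametric_intervalIntegral_of_continuous' ?_ s t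
      exact (cJ.comp (by fun_prop)).sub (cJ.comp (by fun_prop))
    rw [← integral_add w1 w2, intervalIntegral.integral_of_le hk.le, integral_Icc_eq_integral_Ioc]
    refine setIntegral_mono_on cΨ.integrableOn_Ioc ((w1.add w2).mono_set Ioc_subset_Icc_self)
      measurableSet_Ioc fun r hr => ?_
    have c3 : Continuous fun τ => potLog a u v (τ + r) - potLog a u v τ :=
      (cJ.comp (continuous_add_const r)).sub cJ
    have i3 : IntegrableOn (fun _ : ℝ => C * r ^ 2) (Icc s t) := continuous_const.integrableOn_Icc
    have e3 : (∫ τ in s..t, (potLog a u v (τ + r) - potLog a u v τ)) - C * (t - s) * r ^ 2 =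
        ∫ τ in Icc s t, (potLog a u v (τ + r) - potLog a u v τ - C * r ^ 2) := by
      rw [integral_sub c3.integrableOn_Icc i3, setIntegral_const, Real.volume_real_Icc_of_le hst,
        intervalIntegral.integral_of_le hst, integral_Icc_eq_integral_Ioc, smul_eq_mul]
      ring
    rw [e3, ← integral_add (cu.integrable_wronskian s t r) (cv.integrable_wronskian s t r)]
    refine setIntegral_mono_on_ae (c3.integrableOn_Icc.sub i3)
      ((cu.integrable_wronskian s t r).add (cv.integrable_wronskian s t r)) measurableSet_Icc ?_
    exact hw r hr.1 (hr.2.trans hk1)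
  rw [l1, l2, mul_add, e1, e2]
  linarith

/-- The Almgren frequency is monotone in the logarithm of the radius. -/
lemma monotone_frequency_exp (h : IsSolution a u v) (ha : -1 < a) (ha1 : a < 1) :
    Monotone fun t => (fluxLog a u v t - potLog a u v t) / massLog a u v t := by
  have hF := h.continuous_fluxLog ha
  have hJ : Continuous (potLog a u v) := h.continuous_potLog
  have hH := h.continuous_massLog ha
  have hpos := h.massLog_pos ha
  refine monotone_div_of_growth (E := fun t => fluxLog a u v t - potLog a u v t) (hF.sub hJ)
    (h.hasDerivAt_massLog ha) hF (fluxLog_nonneg u v) hpos fun s t hst => ?_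
  have h1 := h.flux_growth ha ha1 hst
  -- Pointwise `(F - J) F ≤ F²`, as both `F` and `J` are nonnegative.
  have h2 : ∫ τ in s..t, (fluxLog a u v τ - potLog a u v τ) / massLog a u v τ * (2 * fluxLog a u v τ) ≤
      2 * ∫ τ in s..t, fluxLog a u v τ ^ 2 / massLog a u v τ := by
    rw [← intervalIntegral.integral_const_mul]
    refine intervalIntegral.integral_mono_on hst
      ((((hF.sub hJ).div hH fun t => (hpos t).ne').mul (continuous_const.mul hF)).intervalIntegrable _ _)
      ((continuous_const.mul ((hF.pow 2).div hH fun t => (hpos t).ne')).intervalIntegrable _ _)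
      fun τ _ => ?_
    rw [div_mul_eq_mul_div, ← mul_div_assoc]
    refine div_le_div_of_nonneg_right ?_ (hpos τ).le
    nlinarith [mul_nonneg (potLog_nonneg (a := a) u v τ) (fluxLog_nonneg (a := a) u v τ)]
  linarith

end IsSolution

end

end FracSystem

end

theorem proposition3p2 (n : ℕ) (hn : 1 ≤ n) (s : ℝ) (hs0 : 0 < s) (hs1 : s < 1)
    (u v : FracSystem.Space n → ℝ) (h : FracSystem.IsSolution (1 - 2 * s) u v) :
    (∀ r : ℝ, 0 < r →
      IntegrableOn (FracSystem.dirichletDensity (1 - 2 * s) u v) (FracSystem.halfBall n r) ∧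
      IntegrableOn (fun x => u (FracSystem.pt x 0) ^ 2 * v (FracSystem.pt x 0) ^ 2)
        (FracSystem.flatPart n r) ∧
      IntegrableOn (FracSystem.massDensity (1 - 2 * s) u v) (FracSystem.halfSphere n r)
        (FracSystem.surfaceMeasure n r) ∧
      0 < FracSystem.height (1 - 2 * s) u v r) ∧
    MonotoneOn (FracSystem.frequency (1 - 2 * s) u v) (Ioi 0) := by
  have ha : -1 < 1 - 2 * s := by linarith
  have ha1 : 1 - 2 * s < 1 := by linarith
  refine ⟨fun r hr => ⟨?_, ?_, ?_, ?_⟩, ?_⟩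
  · exact ((FracSystem.integrableOn_wt_iff Metric.isOpen_ball.measurableSet).1
      ((h.integrableOn_dirichlet ha r).mono_set Metric.ball_subset_closedBall))
  · exact FracSystem.integrableOn_closedBall_boundary h.continuous_potential r
  · rw [← Real.exp_log hr]
    exact FracSystem.integrableOn_surface (h.integrable_mass ha (Real.log r)).1
  · rw [← Real.exp_log hr, h.height_eq ha]
    exact h.massLog_pos ha _
  · intro r hr r' hr' hrr
    have := h.monotone_frequency_exp ha ha1 (Real.log_le_log hr hrr)
    simp only at this
    rw [← FracSystem.IsSolution.energy_eq, ← FracSystem.IsSolution.energy_eq, ← h.height_eq ha,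
      ← h.height_eq ha, Real.exp_log hr, Real.exp_log hr'] at this
    exact this
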